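/- **Theorem (Angry Tri-Separation Theorem).** All graphs are simple and may be finite or infinite. A graph is *3-connected* if it has more than three vertices and deleting fewer than three vertices does not disconnect it. A *mixed-separation* of a graph $G$ is a pair $(A,B)$ of vertex sets with $A\cup B=V(G)$ such that $A\setminus B$ and $B\setminus A$ are both nonempty; its *order* is $|A\cap B|+|E(A\setminus B,B\setminus A)|$, where $E(A\setminus B,B\setminus A)$ is the set of edges of $G$ between $A\setminus B$ and $B\setminus A$. It is a *3-separation* if it has order three and $E(A\setminus B,B\setminus A)=\emptyset$. A *tri-separation* of $G$ is a mixed-separation $(A,B)$ of order three such that every vertex in $A\cap B$ has at least two neighbours in $A$ and at least two neighbours in $B$. It is *nontrivial* if both $G[A]$ and $G[B]$ include a cycle. Two mixed-separations $(A,B)$ and $(C,D)$ are *nested* if, after possibly exchanging $A$ with $B$ or $C$ with $D$, we have $A\subseteq C$ and $B\supseteq D$. A tri-separation of $G$ is *totally nested* if it is nested with every tri-separation of $G$. A *wheel* consists of a cycle (of finite length at least three) and one further vertex adjacent to all the vertices of the cycle; in particular $K_4$ is a wheel. A graph $G$ is *internally 4-connected* if it is 3-connected, every 3-separation $(A,B)$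 of $G$ has a side $A$ or $B$ that induces a claw $K_{1,3}$, and $G$ is isomorphic neither to $K_4$ nor to $K_{3,3}$. For every 3-connected graph $G$, exactly one of the following is true: 1. $G$ has a totally-nested nontrivial tri-separation; 2. $G$ is a wheel, or $G$ is a $K_{3,m}$ for some (finite or infinite) cardinal $m\ge 3$; 3. $G$ is internally 4-connected. -/

import Mathlib

namespace TriSep

universe u

variable {V : Type u}

/-- `G` is `k`-connected: it has more than `k` vertices, and deleting fewer than `k` vertices
does not disconnect it. -/
def IsKConnected (k : ℕ) (G : SimpleGraph V) : Prop :=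
  (k : ℕ∞) < ENat.card V ∧ ∀ S : Set V, S.encard < k → (G.induce Sᶜ).Connected

/-- `(A, B)` is a mixed-separation (of any graph on `V`). -/
def IsMixedSeparation (A B : Set V) : Prop :=
  A ∪ B = Set.univ ∧ (A \ B).Nonempty ∧ (B \ A).Nonempty

/-- The edges in the separator of `(A, B)`: the edges between `A \ B` and `B \ A`. -/
def sepEdges (G : SimpleGraph V) (A B : Set V) : Set (Sym2 V) :=
  {e | e ∈ G.edgeSet ∧ ∃ a ∈ A \ B, ∃ b ∈ B \ A, e = s(a, b)}

/-- The order of `(A, B)`: the size of its separator, which is the disjoint union of the vertex set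
`A ∩ B` and the edge set `sepEdges G A B`. -/
noncomputable def order (G : SimpleGraph V) (A B : Set V) : ℕ∞ :=
  (A ∩ B).encard + (sepEdges G A B).encard

/-- A `3`-separation: a mixed-separation of order three without edges in its separator. -/
def IsThreeSeparation (G : SimpleGraph V) (A B : Set V) : Prop :=
  IsMixedSeparation A B ∧ sepEdges G A B = ∅ ∧ order G A B = 3

/-- A tri-separation: a mixed-separation of order three such that every vertex in `A ∩ B` has at
least two neighbours in `A` and at least two neighbours in `B`. -/
def IsTriSeparation (G : SimpleGraph V) (A B : Set V) : Prop :=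
  IsMixedSeparation A B ∧ order G A B = 3 ∧
    ∀ v ∈ A ∩ B, 2 ≤ (G.neighborSet v ∩ A).encard ∧ 2 ≤ (G.neighborSet v ∩ B).encard

/-- Both sides induce subgraphs that include a cycle. -/
def IsNontrivial (G : SimpleGraph V) (A B : Set V) : Prop :=
  ¬ (G.induce A).IsAcyclic ∧ ¬ (G.induce B).IsAcyclic

/-- The partial order on mixed-separations. -/
def SepLE (A B C D : Set V) : Prop := A ⊆ C ∧ D ⊆ B

/-- `(A, B)` and `(C, D)` are nested: they are comparable after possibly switching the name `A`
with `B` or the name `C` with `D`. -/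
def Nested (A B C D : Set V) : Prop :=
  SepLE A B C D ∨ SepLE B A C D ∨ SepLE A B D C ∨ SepLE B A D C

/-- `(A, B)` is nested with every tri-separation of `G`. -/
def IsTotallyNested (G : SimpleGraph V) (A B : Set V) : Prop :=
  ∀ C D : Set V, IsTriSeparation G C D → Nested A B C D

/-- `G` has a totally-nested nontrivial tri-separation. -/
def HasTotallyNestedNontrivial (G : SimpleGraph V) : Prop :=
  ∃ A B : Set V, IsTriSeparation G A B ∧ IsNontrivial G A B ∧ IsTotallyNested G A B

/-- The wheel with rim a cycle of length `n` (for `3 ≤ n`) and one further vertex, the centre, which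
is adjacent to all the vertices of the rim. -/
def wheelGraph (n : ℕ) : SimpleGraph (Fin n ⊕ Unit) :=
  (SimpleGraph.cycleGraph n ⊕g (⊥ : SimpleGraph Unit)) ⊔ completeBipartiteGraph (Fin n) Unit

def IsWheel (G : SimpleGraph V) : Prop :=
  ∃ n : ℕ, 3 ≤ n ∧ Nonempty (G ≃g wheelGraph n)

/-- `G` is a `K_{3,m}` for some `3 ≤ m`, where `m` may be an infinite cardinal (that of `I`). -/
def IsKThreeM (G : SimpleGraph V) : Prop :=
  ∃ I : Type u, 3 ≤ ENat.card I ∧ Nonempty (G ≃g completeBipartiteGraph (Fin 3) I)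

/-- `A` induces a claw, that is, a `K_{1,3}`. -/
def InducesClaw (G : SimpleGraph V) (A : Set V) : Prop :=
  Nonempty (G.induce A ≃g completeBipartiteGraph (Fin 1) (Fin 3))

/-- `G` is internally `4`-connected. -/
def IsInternallyFourConnected (G : SimpleGraph V) : Prop :=
  IsKConnected 3 G ∧
    (∀ A B : Set V, IsThreeSeparation G A B → InducesClaw G A ∨ InducesClaw G B) ∧
    ¬ Nonempty (G ≃g (⊤ : SimpleGraph (Fin 4))) ∧
    ¬ Nonempty (G ≃g completeBipartiteGraph (Fin 3) (Fin 3))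

/-- Exactly one of three propositions is true. -/
def ExactlyOne (P Q R : Prop) : Prop :=
  (P ∧ ¬ Q ∧ ¬ R) ∨ (¬ P ∧ Q ∧ ¬ R) ∨ (¬ P ∧ ¬ Q ∧ R)

end TriSep

/-! Existence argues by contradiction from the absence of all three outcomes. Since the graph is not
internally 4-connected, it has a 3-separation without a claw side. Dropping from each side the
separator vertices with only one neighbour there turns it into a tri-separation
(`IsThreeSeparation.isTriSeparation`), which is nontrivial because a side of a tri-separation with
two vertices includes a cycle (`IsTriSeparation.not_isAcyclic`). Among the nontrivial
tri-separations, one with the most vertices in its separator is chosen; it is crossed by a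
tri-separation. Nearly every local step is an application of `IsKConnected.not_separated`: two
vertices or edges never separate.

Crossing. A separator vertex of degree three already leads to a wheel or to a totally-nested
tri-separation (`IsTriSeparation.hasTotallyNestedNontrivial_or_isWheel`), so there is none. Then no
strict side lies in the other separator, and two opposite corners are nonempty. By submodularity
their separators have exactly three elements, which fixes the sizes of centre and links
(`IsCross.counts`). Two cases remain (`IsCross.exists_isNecklace_or`). Either both separators are
the same three vertices and all four corners are nonempty; or the centre is one vertex and each link
is one element, and then, by maximality, deleting the centre leaves a ring of four bags, a necklace.

Necklaces. A bag with a cutvertex between its ends is cut into shorter bags. A bag with an inner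
vertex but no such cutvertex is unsplit, and it or the bag opposite gives a tri-separation nested
with all others (`IsGoodNecklace.hasTotallyNestedNontrivial`). If this never happens, all bags are
paths and the graph is a wheel (`IsNecklace.isWheel`).

Four parts. If three vertices `X` leave four parts, no tri-separation has vertices of `X` strictly
on both sides, since each part would need its own separator element. Hence a component of the rest
gives a totally-nested tri-separation, unless its side is a single vertex. If all of them fail, the
components are single vertices, `X` is independent, and the graph is a `K_{3,m}`
(`hasTotallyNestedNontrivial_or_isKThreeM`).

Exclusivity. In an internally 4-connected graph, the sides of a nontrivial tri-separation would
extend to those of a 3-separation, with cycles on both sides and hence no claw. In a wheel or a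
`K_{3,m}`, the tri-separations `({u}, {u}ᶜ)` keep the separator of a totally-nested tri-separation
away from vertices of degree three; then a rotation of the wheel, or a regrouping of the large
class, produces a crossing tri-separation. -/

namespace TriSep

universe u

variable {V : Type u} {G : SimpleGraph V}

/-! ### Separators, small cuts, and cycles in the sides. -/

/-- The separator of `(A, B)` as one set of vertices and edges. -/
def sep (G : SimpleGraph V) (A B : Set V) : Set (V ⊕ Sym2 V) :=
  Sum.inl '' (A ∩ B) ∪ Sum.inr '' sepEdges G A B

@[simp] lemma inl_mem_sep {A B : Set V} {w : V} : Sum.inl w ∈ sep G A B ↔ w ∈ A ∧ w ∈ B := by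
  simp [sep]

@[simp] lemma inr_mem_sep {A B : Set V} {a b : V} : Sum.inr s(a, b) ∈ sep G A B ↔
    G.Adj a b ∧ ((a ∈ A ∧ a ∉ B ∧ b ∈ B ∧ b ∉ A) ∨ (b ∈ A ∧ b ∉ B ∧ a ∈ B ∧ a ∉ A)) := by
  simp only [sep, sepEdges, Set.mem_union, Set.mem_image, reduceCtorEq, and_false, exists_false,
    false_or, Sum.inr.injEq, exists_eq_right, Set.mem_ofPred_eq, SimpleGraph.mem_edgeSet,
    Set.mem_sdiff]
  constructor
  · rintro ⟨h, c, hc, d, hd, e⟩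
    rcases Sym2.eq_iff.1 e with ⟨rfl, rfl⟩ | ⟨rfl, rfl⟩ <;> tauto
  · rintro ⟨h, h' | h'⟩
    · exact ⟨h, a, ⟨h'.1, h'.2.1⟩, b, ⟨h'.2.2.1, h'.2.2.2⟩, rfl⟩
    · exact ⟨h, b, ⟨h'.1, h'.2.1⟩, a, ⟨h'.2.2.1, h'.2.2.2⟩, Sym2.eq_swap⟩

lemma order_eq_encard_sep (A B : Set V) : order G A B = (sep G A B).encard := by
  rw [sep, Set.encard_union_eq, Sum.inl_injective.encard_image, Sum.inr_injective.encard_image]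
  · rfl
  · rw [Set.disjoint_left]
    rintro _ ⟨a, _, rfl⟩ ⟨b, _, h⟩
    cases h

lemma sep_subset_iff {A B : Set V} {W : Set (V ⊕ Sym2 V)} : sep G A B ⊆ W ↔
    (∀ w, w ∈ A → w ∈ B → Sum.inl w ∈ W) ∧
    (∀ a b, G.Adj a b → a ∈ A → a ∉ B → b ∈ B → b ∉ A → Sum.inr s(a, b) ∈ W) := by
  constructor
  · intro h
    exact ⟨fun w h1 h2 => h (by simp [h1, h2]), fun a b hab h1 h2 h3 h4 => h (by simp [*])⟩
  · rintro ⟨h1, h2⟩ (w | e) hw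
    · rw [inl_mem_sep] at hw; exact h1 w hw.1 hw.2
    · induction e using Sym2.ind with | _ a b =>
      rw [inr_mem_sep] at hw
      rcases hw with ⟨h, h' | h'⟩
      · exact h2 a b h h'.1 h'.2.1 h'.2.2.1 h'.2.2.2
      · rw [Sym2.eq_swap]; exact h2 b a h.symm h'.1 h'.2.1 h'.2.2.1 h'.2.2.2

lemma sep_comm (A B : Set V) : sep G A B = sep G B A := by
  apply Set.Subset.antisymm <;>
  · rw [sep_subset_iff]
    refine ⟨fun w h1 h2 => by simp [h1, h2], fun a b hab h1 h2 h3 h4 => ?_⟩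
    simp [*]

lemma order_comm (A B : Set V) : order G A B = order G B A := by
  simp [order_eq_encard_sep, sep_comm]

lemma sepEdges_comm (A B : Set V) : sepEdges G A B = sepEdges G B A := by
  ext e
  simp only [sepEdges, Set.mem_ofPred_eq]
  constructor <;>
  · rintro ⟨h, a, ha, b, hb, rfl⟩
    exact ⟨h, b, hb, a, ha, Sym2.eq_swap⟩

lemma mem_sepEdges {A B : Set V} {e : Sym2 V} : e ∈ sepEdges G A B ↔ Sum.inr e ∈ sep G A B := by
  simp [sep]

lemma IsMixedSeparation.symm {A B : Set V} (h : IsMixedSeparation A B) : IsMixedSeparation B A :=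
  ⟨by rw [Set.union_comm]; exact h.1, h.2.2, h.2.1⟩

lemma IsMixedSeparation.mem_or {A B : Set V} (h : IsMixedSeparation A B) (w : V) :
    w ∈ A ∨ w ∈ B := by
  have := h.1.symm ▸ Set.mem_univ w
  exact this

lemma IsTriSeparation.symm {A B : Set V} (h : IsTriSeparation G A B) : IsTriSeparation G B A :=
  ⟨h.1.symm, by rw [order_comm]; exact h.2.1, fun v hv => (h.2.2 v ⟨hv.2, hv.1⟩).symm⟩

lemma Nested.swap_left {A B C D : Set V} (h : Nested A B C D) : Nested B A C D := by
  unfold Nested at *; tauto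

lemma Nested.swap_right {A B C D : Set V} (h : Nested A B C D) : Nested A B D C := by
  unfold Nested at *; tauto

lemma two_le_encard_iff {α : Type*} {s : Set α} :
    2 ≤ s.encard ↔ ∃ a ∈ s, ∃ b ∈ s, a ≠ b := by
  have : (2 : ℕ∞) = 1 + 1 := by norm_num
  rw [this, ENat.add_one_le_iff (by simp), Set.one_lt_encard_iff]
  constructor
  · rintro ⟨a, b, ha, hb, hab⟩; exact ⟨a, ha, b, hb, hab⟩
  · rintro ⟨a, ha, b, hb, hab⟩; exact ⟨a, b, ha, hb, hab⟩

lemma three_le_encard_iff {α : Type*} {s : Set α} :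
    3 ≤ s.encard ↔ ∃ a ∈ s, ∃ b ∈ s, ∃ c ∈ s, a ≠ b ∧ a ≠ c ∧ b ≠ c := by
  constructor
  · intro h
    obtain ⟨t, hts, ht⟩ := Set.exists_subset_encard_eq h
    obtain ⟨a, b, c, hab, hac, hbc, rfl⟩ := Set.encard_eq_three.1 ht
    exact ⟨a, hts (by simp), b, hts (by simp), c, hts (by simp), hab, hac, hbc⟩
  · rintro ⟨a, ha, b, hb, c, hc, hab, hac, hbc⟩
    have : ({a, b, c} : Set α).encard = 3 := Set.encard_eq_three.2 ⟨a, b, c, hab, hac, hbc, rfl⟩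
    rw [← this]
    exact Set.encard_le_encard (by rintro x (rfl | rfl | rfl) <;> assumption)

lemma not_two_le_encard {α : Type*} {s : Set α} :
    ¬ 2 ≤ s.encard ↔ ∀ a ∈ s, ∀ b ∈ s, a = b := by
  rw [two_le_encard_iff]; push Not; rfl

lemma four_le_encard {α : Type*} {s : Set α} {a b c d : α} (ha : a ∈ s) (hb : b ∈ s) (hc : c ∈ s)
    (hd : d ∈ s) (hab : a ≠ b) (hac : a ≠ c) (had : a ≠ d) (hbc : b ≠ c) (hbd : b ≠ d)
    (hcd : c ≠ d) : 4 ≤ s.encard := by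
  have : ({a, b, c, d} : Set α).encard = 4 :=
    Set.encard_eq_four.2 ⟨a, b, c, d, hab, hac, had, hbc, hbd, hcd, rfl⟩
  rw [← this]
  exact Set.encard_le_encard (by rintro x (rfl | rfl | rfl | rfl) <;> assumption)

lemma not_four_of_encard_eq_three {α : Type*} {s : Set α} (hs : s.encard = 3) {a b c d : α}
    (ha : a ∈ s) (hb : b ∈ s) (hc : c ∈ s)
    (hd : d ∈ s) (hab : a ≠ b) (hac : a ≠ c) (had : a ≠ d) (hbc : b ≠ c) (hbd : b ≠ d)
    (hcd : c ≠ d) : False := by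
  have := four_le_encard ha hb hc hd hab hac had hbc hbd hcd
  rw [hs] at this
  exact absurd this (by decide)

/-- The sides of a mixed-separation of order at most `n` can be enlarged to get rid of all edges in
its separator, without increasing the order. -/
lemma exists_vertex_separation {n : ℕ} (hV : ((n + 1 : ℕ) : ℕ∞) < ENat.card V) {A B : Set V}
    (h : IsMixedSeparation A B) (ho : order G A B ≤ n) :
    ∃ A' B', A ⊆ A' ∧ B ⊆ B' ∧ IsMixedSeparation A' B' ∧ sepEdges G A' B' = ∅ ∧
      order G A' B' ≤ n := by
  have hfin : (sepEdges G A B).Finite := by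
    apply Set.finite_of_encard_le_coe (k := n)
    exact le_trans (le_add_self) ho
  obtain ⟨k, hk⟩ : ∃ k, (sepEdges G A B).ncard = k := ⟨_, rfl⟩
  induction k using Nat.strong_induction_on generalizing A B with
  | _ k ih =>
  -- Adding the end `a` of a separator edge to `B` trades that edge for the vertex `a`, so the order
  -- does not grow and the number of edges drops. The second vertex `a'` keeps the strict side
  -- nonempty.
  have key : ∀ {A B : Set V}, IsMixedSeparation A B → order G A B ≤ n →
      (sepEdges G A B).Finite → (sepEdges G A B).ncard = k → ∀ a b, G.Adj a b → a ∈ A → a ∉ B →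
      b ∈ B → b ∉ A → ∀ a', a' ∈ A → a' ∉ B → a' ≠ a → ∃ A' B', A ⊆ A' ∧ B ⊆ B' ∧
      IsMixedSeparation A' B' ∧ sepEdges G A' B' = ∅ ∧ order G A' B' ≤ n := by
    intro A B h ho hfin hk a b hab haA haB hbB hbA a' ha'A ha'B hne
    have hsub : sepEdges G A (insert a B) ⊆ sepEdges G A B \ {s(a, b)} := by
      rintro _ ⟨he, c, hc, d, hd, rfl⟩
      have hca : c ≠ a := fun h => hc.2 (by simp [h])
      have hda : d ≠ a := fun h => hd.2 (h ▸ haA)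
      refine ⟨⟨he, c, ⟨hc.1, fun h => hc.2 (by simp [h])⟩, d, ⟨?_, hd.2⟩, rfl⟩, ?_⟩
      · have := hd.1
        simpa [hda] using this
      · simp [hca, hda]
    have hmem : s(a, b) ∈ sepEdges G A B := ⟨hab, a, ⟨haA, haB⟩, b, ⟨hbB, hbA⟩, rfl⟩
    have hlt : (sepEdges G A (insert a B)).ncard < k := by
      rw [← hk]
      exact lt_of_le_of_lt (Set.ncard_le_ncard hsub (hfin.subset Set.sdiff_subset))
        (Set.ncard_sdiff_singleton_lt_of_mem hmem hfin)
    have hmix : IsMixedSeparation A (insert a B) := by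
      refine ⟨?_, ⟨a', ha'A, by simp [hne, ha'B]⟩, ⟨b, by simp [hbB], hbA⟩⟩
      rw [Set.union_insert, h.1]; simp
    have ho' : order G A (insert a B) ≤ n := by
      refine le_trans ?_ ho
      rw [order_eq_encard_sep, order_eq_encard_sep]
      have : sep G A (insert a B) ⊆ insert (Sum.inl a) (sep G A B \ {Sum.inr s(a, b)}) := by
        rw [sep_subset_iff]
        refine ⟨fun w h1 h2 => ?_, fun c d hcd h1 h2 h3 h4 => ?_⟩
        · rcases h2 with rfl | h2
          · simp
          · simp [h1, h2]
        · have := hsub (show s(c, d) ∈ sepEdges G A (insert a B) from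
            ⟨hcd, c, ⟨h1, h2⟩, d, ⟨h3, h4⟩, rfl⟩)
          right
          exact ⟨mem_sepEdges.1 this.1, by simpa using this.2⟩
      refine le_trans (Set.encard_le_encard this) ?_
      rw [Set.encard_exchange]
      · simp [haB]
      · simp [*]
    obtain ⟨A', B', h1, h2, h3⟩ := ih _ hlt hmix ho' (hfin.subset (hsub.trans Set.sdiff_subset)) rfl
    exact ⟨A', B', h1, (Set.subset_insert _ _).trans h2, h3⟩
  by_cases he : sepEdges G A B = ∅
  · exact ⟨A, B, subset_rfl, subset_rfl, h, he, ho⟩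
  obtain ⟨_, hab, a, ha, b, hb, rfl⟩ := Set.nonempty_iff_ne_empty.2 he
  by_cases h1 : ∃ a' ∈ A \ B, a' ≠ a
  · obtain ⟨a', ha', hne⟩ := h1
    exact key h ho hfin hk a b hab ha.1 ha.2 hb.1 hb.2 a' ha'.1 ha'.2 hne
  by_cases h2 : ∃ b' ∈ B \ A, b' ≠ b
  · obtain ⟨b', hb', hne⟩ := h2
    rw [order_comm] at ho
    rw [sepEdges_comm] at hfin hk
    obtain ⟨A', B', h1, h2, h3, h4, h5⟩ :=
      key h.symm ho hfin hk b a hab.symm hb.1 hb.2 ha.1 ha.2 b' hb'.1 hb'.2 hne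
    exact ⟨B', A', h2, h1, h3.symm, by rw [sepEdges_comm]; exact h4, by rw [order_comm]; exact h5⟩
  -- Both strict sides are now single vertices, and with an edge in the separator this bounds the
  -- number of vertices by `n + 1`.
  push Not at h1 h2
  exfalso
  have huniv : (Set.univ : Set V) ⊆ insert a (insert b (A ∩ B)) := by
    intro w _
    by_cases hwA : w ∈ A <;> by_cases hwB : w ∈ B
    · simp [hwA, hwB]
    · simp [h1 w ⟨hwA, hwB⟩]
    · simp [h2 w ⟨hwB, hwA⟩]
    · exact absurd (h.mem_or w) (by tauto)
  have e1 : ENat.card V ≤ (A ∩ B).encard + 1 + 1 := by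
    rw [← Set.encard_univ]
    refine (Set.encard_le_encard huniv).trans ((Set.encard_insert_le _ _).trans ?_)
    gcongr
    exact Set.encard_insert_le _ _
  have e2 : (A ∩ B).encard + 1 ≤ n := by
    refine le_trans ?_ ho
    unfold order
    gcongr
    rw [Set.one_le_encard_iff_nonempty]
    exact Set.nonempty_iff_ne_empty.2 he
  have e3 : ENat.card V ≤ (n + 1 : ℕ) := by
    refine e1.trans ?_
    push_cast
    gcongr
  exact absurd hV (not_lt.2 e3)

/-- In a `3`-connected graph every mixed-separation has order at least three. -/
lemma IsKConnected.three_le_order (hG : IsKConnected 3 G) {A B : Set V}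
    (h : IsMixedSeparation A B) : 3 ≤ order G A B := by
  by_contra hlt
  rw [not_le] at hlt
  have hle : order G A B ≤ (2 : ℕ) := by
    have : (3 : ℕ∞) = (2 : ℕ) + 1 := by norm_num
    rw [this] at hlt
    exact Order.le_of_lt_add_one hlt
  obtain ⟨A', B', -, -, h', he, ho⟩ := exists_vertex_separation (n := 2) (by simpa using hG.1) h hle
  have hS : (A' ∩ B').encard < (3 : ℕ) := by
    refine lt_of_le_of_lt (le_trans (le_self_add) ho) (by decide)
  have hc := hG.2 _ hS
  obtain ⟨a, haA, haB⟩ := h'.2.1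
  obtain ⟨b, hbB, hbA⟩ := h'.2.2
  obtain ⟨p⟩ := hc.preconnected ⟨a, fun h => haB h.2⟩ ⟨b, fun h => hbA h.1⟩
  have : ∀ {x y : ↥(A' ∩ B')ᶜ} (p : (G.induce (A' ∩ B')ᶜ).Walk x y), x.1 ∈ A' → y.1 ∈ A' := by
    intro x y p
    induction p with
    | nil => exact id
    | @cons x z y hxz p ih =>
      intro hx
      apply ih
      by_contra hz
      have hzB : z.1 ∈ B' := (h'.mem_or z.1).resolve_left hz
      have hxB : x.1 ∉ B' := fun h => x.2 ⟨hx, h⟩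
      have : s(x.1, z.1) ∈ sepEdges G A' B' := ⟨hxz, x.1, ⟨hx, hxB⟩, z.1, ⟨hzB, hz⟩, rfl⟩
      rw [he] at this
      exact this
  exact hbA (this p haA)

/-- In a `3`-connected graph, no set of at most two vertices and edges separates a vertex in `K`
from a vertex outside `K`. -/
lemma IsKConnected.not_separated (hG : IsKConnected 3 G) (K : Set V) (W : Set (V ⊕ Sym2 V))
    (hW : W.encard ≤ 2) {k z : V} (hk : k ∈ K) (hkW : Sum.inl k ∉ W) (hz : z ∉ K)
    (hzW : Sum.inl z ∉ W)
    (h : ∀ a b, a ∈ K → b ∉ K → G.Adj a b →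
      Sum.inl a ∈ W ∨ Sum.inl b ∈ W ∨ Sum.inr s(a, b) ∈ W) : False := by
  -- The vertices of `W` are put on both sides; the separator then lies inside `W`.
  have hmix : IsMixedSeparation (K ∪ {w | Sum.inl w ∈ W}) (Kᶜ ∪ {w | Sum.inl w ∈ W}) := by
    refine ⟨?_, ⟨k, by simp [hk], by simp [hk, hkW]⟩, ⟨z, by simp [hz], by simp [hz, hzW]⟩⟩
    ext w; simp; tauto
  have h3 := hG.three_le_order hmix
  rw [order_eq_encard_sep] at h3
  have hsub : sep G (K ∪ {w | Sum.inl w ∈ W}) (Kᶜ ∪ {w | Sum.inl w ∈ W}) ⊆ W := by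
    rw [sep_subset_iff]
    simp only [Set.mem_union, Set.mem_ofPred_eq, Set.mem_compl_iff]
    refine ⟨fun w => by tauto, fun a b hab h1 h2 h3 h4 => ?_⟩
    have := h a b (by tauto) (by tauto) hab
    tauto
  have := (h3.trans (Set.encard_le_encard hsub)).trans hW
  exact absurd this (by decide)

lemma encard_pair_le {α : Type*} (a b : α) : ({a, b} : Set α).encard ≤ 2 := by
  refine (Set.encard_insert_le _ _).trans ?_
  rw [Set.encard_singleton]; norm_num

lemma encard_insert_le_two {α : Type*} (a : α) {s : Set α} (hs : s.encard ≤ 1) :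
    (insert a s).encard ≤ 2 := by
  refine (Set.encard_insert_le _ _).trans ?_
  calc s.encard + 1 ≤ 1 + 1 := by gcongr
    _ = 2 := by norm_num

lemma encard_sdiff_singleton_le_two {α : Type*} {a : α} {s : Set α} (hs : s.encard = 3)
    (ha : a ∈ s) : (s \ {a}).encard ≤ 2 := by
  have := Set.encard_sdiff_singleton_add_one ha
  rw [hs] at this
  have h3 : (3 : ℕ∞) = 2 + 1 := by norm_num
  rw [h3] at this
  exact ((ENat.add_left_injective_of_ne_top ENat.one_ne_top) this).le

/-- Every set that separates `k` from `z` has at least three elements, in the version for degrees. -/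
lemma IsKConnected.three_le_degree (hG : IsKConnected 3 G) (v : V) :
    3 ≤ (G.neighborSet v).encard := by
  by_contra hlt
  rw [not_le] at hlt
  have hle : (G.neighborSet v).encard ≤ 2 := by
    have : (3 : ℕ∞) = 2 + 1 := by norm_num
    rw [this] at hlt
    exact Order.le_of_lt_add_one hlt
  have hex : ∃ z, z ≠ v ∧ ¬ G.Adj v z := by
    by_contra hcon
    push Not at hcon
    have : (Set.univ : Set V) ⊆ insert v (G.neighborSet v) := by
      intro z _
      by_cases h : z = v
      · simp [h]
      · simp [hcon z h]
    have h1 := (Set.encard_le_encard this).trans (Set.encard_insert_le _ _)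
    rw [Set.encard_univ] at h1
    have h2 : ENat.card V ≤ 3 := h1.trans (by
      calc (G.neighborSet v).encard + 1 ≤ 2 + 1 := by gcongr
        _ = 3 := by norm_num)
    exact absurd hG.1 (not_lt.2 h2)
  obtain ⟨z, hz, hvz⟩ := hex
  refine hG.not_separated {v} (Sum.inl '' G.neighborSet v)
    (by rwa [Sum.inl_injective.encard_image]) (k := v) (z := z) rfl (by simp) (by simpa using hz)
    (by simpa using hvz) ?_
  rintro a b rfl hb hab
  simp [hab]

lemma IsTriSeparation.encard_sep {A B : Set V} (h : IsTriSeparation G A B) :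
    (sep G A B).encard = 3 := by
  rw [← order_eq_encard_sep]; exact h.2.1

/-- Every vertex in the separator has a neighbour in the strict side. -/
lemma IsKConnected.exists_adj_left (hG : IsKConnected 3 G) {A B : Set V}
    (h : IsMixedSeparation A B) (hs : (sep G A B).encard = 3) {w : V} (hA : w ∈ A) (hB : w ∈ B) :
    ∃ a, a ∈ A ∧ a ∉ B ∧ G.Adj w a := by
  by_contra hcon
  push Not at hcon
  obtain ⟨k, hkA, hkB⟩ := h.2.1
  refine hG.not_separated (A \ B) (sep G A B \ {Sum.inl w})
    (encard_sdiff_singleton_le_two hs (by simp [hA, hB])) (k := k) (z := w) ⟨hkA, hkB⟩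
    (by simp [hkB]) (by simp [hB]) (by simp) ?_
  rintro a b ⟨haA, haB⟩ hb hab
  by_cases hbB : b ∈ B
  · by_cases hbA : b ∈ A
    · right; left
      refine ⟨by simp [*], ?_⟩
      rintro h
      cases h
      exact hcon a haA haB hab.symm
    · right; right
      simp [*]
  · exact absurd ⟨(h.mem_or b).resolve_right hbB, hbB⟩ hb

lemma IsKConnected.exists_adj_right (hG : IsKConnected 3 G) {A B : Set V}
    (h : IsMixedSeparation A B) (hs : (sep G A B).encard = 3) {w : V} (hA : w ∈ A) (hB : w ∈ B) :
    ∃ a, a ∈ B ∧ a ∉ A ∧ G.Adj w a :=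
  hG.exists_adj_left h.symm (by rwa [sep_comm]) hB hA

/-- The edges in the separator form a matching, from the viewpoint of a strict side with at least
two vertices. -/
lemma IsKConnected.eq_of_adj_of_adj (hG : IsKConnected 3 G) {A B : Set V}
    (h : IsMixedSeparation A B) (hs : (sep G A B).encard = 3) {u u' b b' : V} (hA : u ∈ A)
    (hB : u ∉ B) (hA' : u' ∈ A) (hB' : u' ∉ B) (hne : u' ≠ u) (hb : b ∉ A) (hb' : b' ∉ A)
    (hub : G.Adj u b) (hub' : G.Adj u b') : b = b' := by
  by_contra hbb
  have hbB := (h.mem_or b).resolve_left hb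
  have hbB' := (h.mem_or b').resolve_left hb'
  have hubu : u ≠ b := fun e => hb (e ▸ hA)
  have hubu' : u ≠ b' := fun e => hb' (e ▸ hA)
  -- Trading the two edges for their common end `u` leaves two elements, which would still separate
  -- `u'` from `b`.
  have h1 : (insert (Sum.inl u) ((sep G A B \ {Sum.inr s(u, b)}) \ {Sum.inr s(u, b')})).encard
      ≤ 2 := by
    rw [Set.encard_exchange]
    · exact encard_sdiff_singleton_le_two hs (by simp [*])
    · simp [hB]
    · refine ⟨by simp [*], ?_⟩
      simp only [Set.mem_singleton_iff, Sum.inr.injEq, Sym2.eq_iff]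
      tauto
  refine hG.not_separated (A \ (B ∪ {u})) _ h1 (k := u') (z := b) ⟨hA', by simp [*]⟩
    (by simp [*]) (by simp [*]) (by simp [hubu.symm, hb]) ?_
  rintro a c ⟨haA, haB⟩ hc hac
  simp only [Set.mem_union, Set.mem_singleton_iff, not_or] at haB
  by_cases hcu : c = u
  · right; left; simp [hcu]
  by_cases hcB : c ∈ B
  · by_cases hcA : c ∈ A
    · right; left
      simp [*]
    · right; right
      have := haB.2
      have hab : a ≠ b := fun e => hb (e ▸ haA)
      have hab' : a ≠ b' := fun e => hb' (e ▸ haA)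
      simp [*]
  · exact absurd ⟨(h.mem_or c).resolve_right hcB, by simp [*]⟩ hc

/-- Here `A₁` is one end of a bridge `ab` of the side `A`, and `hX` says that it carries at most one
separator element. If `A₁` has a vertex outside `B`, the bridge and that element are a cut of size
two. Otherwise `A₁` is a single separator vertex whose only neighbour in `A` is `b`, against the
degree condition. -/
lemma not_acyclic_aux (hG : IsKConnected 3 G) {A B : Set V} (h : IsTriSeparation G A B)
    {A₁ : Set V} (hA₁ : A₁ ⊆ A) {a b : V} (ha : a ∈ A₁)
    (hcut : ∀ x ∈ A₁, ∀ y ∈ A, y ∉ A₁ → G.Adj x y → x = a ∧ y = b)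
    (hX : ∀ e ∈ sep G A B, ∀ e' ∈ sep G A B,
      ((∃ w ∈ A₁, e = Sum.inl w) ∨ ∃ x ∈ A₁, ∃ y, y ∉ A ∧ e = Sum.inr s(x, y)) →
      ((∃ w ∈ A₁, e' = Sum.inl w) ∨ ∃ x ∈ A₁, ∃ y, y ∉ A ∧ e' = Sum.inr s(x, y)) → e = e') :
    False := by
  have hmix := h.1
  by_cases hk : ∃ k ∈ A₁, k ∉ B
  · obtain ⟨k, hk, hkB⟩ := hk
    obtain ⟨z, hzB, hzA⟩ := hmix.2.2
    refine hG.not_separated (A₁ \ B) (insert (Sum.inr s(a, b)) {e ∈ sep G A B |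
      ((∃ w ∈ A₁, e = Sum.inl w) ∨ ∃ x ∈ A₁, ∃ y, y ∉ A ∧ e = Sum.inr s(x, y))})
      (encard_insert_le_two _ ?_) (k := k) (z := z) ⟨hk, hkB⟩ (by simp [hkB])
      (fun e => hzA (hA₁ e.1)) (by simp [hzA]) ?_
    · rw [Set.encard_le_one_iff]
      rintro e e' ⟨he, he1⟩ ⟨he', he1'⟩
      exact hX e he e' he' he1 he1'
    · rintro x y ⟨hx, hxB⟩ hy hxy
      by_cases hyA : y ∈ A
      · by_cases hy1 : y ∈ A₁
        · have hyB : y ∈ B := by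
            by_contra hyB
            exact hy ⟨hy1, hyB⟩
          right; left; right
          exact ⟨by simp [*], Or.inl ⟨y, hy1, rfl⟩⟩
        · obtain ⟨rfl, rfl⟩ := hcut x hx y hyA hy1 hxy
          simp
      · right; right; right
        have := (hmix.mem_or y).resolve_left hyA
        exact ⟨by simp [*, hA₁ hx], Or.inr ⟨x, hx, y, hyA, rfl⟩⟩
  · push Not at hk
    have hsing : ∀ x ∈ A₁, x = a := by
      intro x hx
      have := hX (Sum.inl x) (by simp [hA₁ hx, hk x hx]) (Sum.inl a) (by simp [hA₁ ha, hk a ha])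
        (Or.inl ⟨x, hx, rfl⟩) (Or.inl ⟨a, ha, rfl⟩)
      exact Sum.inl_injective this
    obtain ⟨c, hc, d, hd, hcd⟩ := two_le_encard_iff.1 (h.2.2 a ⟨hA₁ ha, hk a ha⟩).1
    have key : ∀ y, G.Adj a y → y ∈ A → y = b := by
      intro y hay hyA
      refine (hcut a ha y hyA ?_ hay).2
      intro hy
      exact hay.ne (hsing y hy).symm
    exact hcd ((key c hc.1 hc.2).trans (key d hd.1 hd.2).symm)

/-- A side of a tri-separation with at least two vertices includes a cycle. -/
lemma IsTriSeparation.not_isAcyclic (hG : IsKConnected 3 G) {A B : Set V}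
    (h : IsTriSeparation G A B) (hA : 2 ≤ A.encard) : ¬ (G.induce A).IsAcyclic := by
  intro hac
  have hmix := h.1
  have hs := h.encard_sep
  -- Without an edge in `A` there is no separator vertex, so all edges at `A` are in the separator;
  -- removing one edge at `u` leaves at most two elements, which separate `u'` from `u`.
  have hedge : ∃ a ∈ A, ∃ b ∈ A, G.Adj a b := by
    by_contra hcon
    push Not at hcon
    have hS : ∀ w ∈ A, w ∉ B := by
      intro w hw hwB
      obtain ⟨c, hc, -⟩ := two_le_encard_iff.1 (h.2.2 w ⟨hw, hwB⟩).1
      exact hcon w hw c hc.2 hc.1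
    obtain ⟨u, hu, u', hu', hne⟩ := two_le_encard_iff.1 hA
    obtain ⟨c, hc, -⟩ := three_le_encard_iff.1 (hG.three_le_degree u)
    have hc : G.Adj u c := hc
    have hcA : c ∉ A := fun hcA => hcon u hu c hcA hc
    have hcB := (hmix.mem_or c).resolve_left hcA
    refine hG.not_separated (A \ {u}) (sep G A B \ {Sum.inr s(u, c)})
      (encard_sdiff_singleton_le_two hs (by simp [*])) (k := u') (z := u) ⟨hu', by simp [hne.symm]⟩
      (by simp [hS u' hu']) (by simp) (by simp [hS u hu]) ?_
    rintro x y ⟨hx, hxu⟩ hy hxy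
    by_cases hyA : y ∈ A
    · exact absurd hxy (hcon x hx y hyA)
    · right; right
      have := (hmix.mem_or y).resolve_left hyA
      have hxu : x ≠ u := hxu
      have hxc : x ≠ c := fun e => hcA (e ▸ hx)
      simp [*]
  obtain ⟨a, ha, b, hb, hab⟩ := hedge
  have hbr := SimpleGraph.isAcyclic_iff_forall_adj_isBridge.1 hac
    (show (G.induce A).Adj ⟨a, ha⟩ ⟨b, hb⟩ from hab)
  rw [SimpleGraph.isBridge_iff] at hbr
  set H := (G.induce A).deleteEdges {s((⟨a, ha⟩ : A), ⟨b, hb⟩)} with hH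
  let A₁ : Set V := {w | ∃ hw : w ∈ A, H.Reachable ⟨a, ha⟩ ⟨w, hw⟩}
  have hA₁ : A₁ ⊆ A := fun w hw => hw.1
  have ha₁ : a ∈ A₁ := ⟨ha, SimpleGraph.Reachable.refl _⟩
  have hb₁ : b ∉ A₁ := fun ⟨_, hr⟩ => hbr hr
  have hcut : ∀ x ∈ A₁, ∀ y ∈ A, y ∉ A₁ → G.Adj x y → x = a ∧ y = b := by
    rintro x ⟨hxA, hx⟩ y hyA hy hxy
    by_contra hne
    apply hy
    refine ⟨hyA, hx.trans (SimpleGraph.Adj.reachable ?_)⟩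
    rw [hH, SimpleGraph.deleteEdges_adj]
    refine ⟨hxy, ?_⟩
    simp only [Set.mem_singleton_iff, Sym2.eq_iff, Subtype.mk.injEq]
    rintro (h1 | ⟨rfl, rfl⟩)
    · exact hne h1
    · exact hy ha₁
  -- The three separator elements are shared between the two ends of the bridge, so one end has at
  -- most one of them.
  by_cases hX : ∀ e ∈ sep G A B, ∀ e' ∈ sep G A B,
      ((∃ w ∈ A₁, e = Sum.inl w) ∨ ∃ x ∈ A₁, ∃ y, y ∉ A ∧ e = Sum.inr s(x, y)) →
      ((∃ w ∈ A₁, e' = Sum.inl w) ∨ ∃ x ∈ A₁, ∃ y, y ∉ A ∧ e' = Sum.inr s(x, y)) → e = e'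
  · exact not_acyclic_aux hG h hA₁ ha₁ hcut hX
  · push Not at hX
    obtain ⟨e, he, e', he', he1, he1', hne⟩ := hX
    refine not_acyclic_aux hG h (A₁ := A \ A₁) (a := b) (b := a) Set.sdiff_subset ⟨hb, hb₁⟩ ?_ ?_
    · rintro x ⟨hxA, hx⟩ y hyA hy hxy
      have hy : y ∈ A₁ := by
        by_contra h
        exact hy ⟨hyA, h⟩
      exact (hcut y hy x hxA hx hxy.symm).symm
    · intro f hf f' hf' hf1 hf1'
      by_contra hff
      have key : ∀ e f, ((∃ w ∈ A₁, e = Sum.inl w) ∨ ∃ x ∈ A₁, ∃ y, y ∉ A ∧ e = Sum.inr s(x, y)) →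
          ((∃ w ∈ A \ A₁, f = Sum.inl w) ∨ ∃ x ∈ A \ A₁, ∃ y, y ∉ A ∧ f = Sum.inr s(x, y)) →
          e ≠ f := by
        rintro e f (⟨w, hw, rfl⟩ | ⟨x, hx, y, hy, rfl⟩) (⟨w', hw', rfl⟩ | ⟨x', hx', y', hy', rfl⟩) h
        · cases h
          exact hw'.2 hw
        · cases h
        · cases h
        · rw [Sum.inr.injEq, Sym2.eq_iff] at h
          rcases h with ⟨rfl, rfl⟩ | ⟨rfl, rfl⟩
          · exact hx'.2 hx
          · exact hy hx'.1
      exact not_four_of_encard_eq_three hs he he' hf hf' hne (key _ _ he1 hf1) (key _ _ he1 hf1')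
        (key _ _ he1' hf1) (key _ _ he1' hf1') hff

lemma IsTriSeparation.isNontrivial (hG : IsKConnected 3 G) {A B : Set V}
    (h : IsTriSeparation G A B) (hA : 2 ≤ A.encard) (hB : 2 ≤ B.encard) : IsNontrivial G A B :=
  ⟨h.not_isAcyclic hG hA, h.symm.not_isAcyclic hG hB⟩

/-- A graph that includes a cycle has a nonempty set of vertices that induces a subgraph of minimum
degree at least two. -/
lemma exists_core_of_not_isAcyclic {A : Set V} (h : ¬ (G.induce A).IsAcyclic) :
    ∃ U : Set V, U ⊆ A ∧ U.Nonempty ∧ ∀ u ∈ U, ∃ a ∈ U, ∃ b ∈ U, a ≠ b ∧ G.Adj u a ∧ G.Adj u b := by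
  rw [SimpleGraph.IsAcyclic] at h
  push Not at h
  obtain ⟨v, c, hc⟩ := h
  refine ⟨Subtype.val '' {w | w ∈ c.support}, ?_, ⟨v.1, v, c.start_mem_support, rfl⟩, ?_⟩
  · rintro _ ⟨w, -, rfl⟩; exact w.2
  · rintro _ ⟨w, hw, rfl⟩
    have h2 := hc.ncard_neighborSet_toSubgraph_eq_two hw
    obtain ⟨x, y, hxy, he⟩ := Set.ncard_eq_two.1 h2
    have hx : c.toSubgraph.Adj w x := by
      have : x ∈ c.toSubgraph.neighborSet w := by rw [he]; simp
      exact this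
    have hy : c.toSubgraph.Adj w y := by
      have : y ∈ c.toSubgraph.neighborSet w := by rw [he]; simp
      exact this
    refine ⟨x.1, ⟨x, ?_, rfl⟩, y.1, ⟨y, ?_, rfl⟩, fun e => hxy (Subtype.ext e), hx.adj_sub,
      hy.adj_sub⟩
    · exact (c.mem_verts_toSubgraph).1 (c.toSubgraph.edge_vert hx.symm)
    · exact (c.mem_verts_toSubgraph).1 (c.toSubgraph.edge_vert hy.symm)

/-! ### Necklaces. -/

/-- `G - v` is covered by four bags that are arranged in a cyclic way, where consecutive bags meet
in exactly one vertex. -/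
structure IsNecklace (G : SimpleGraph V) (v : V) (P Q₁ Q₂ Q₃ : Set V) (x₀ x₁ x₂ x₃ : V) :
    Prop where
  cover : ∀ w, w ≠ v → w ∈ P ∨ w ∈ Q₁ ∨ w ∈ Q₂ ∨ w ∈ Q₃
  vP : v ∉ P
  vQ₁ : v ∉ Q₁
  vQ₂ : v ∉ Q₂
  vQ₃ : v ∉ Q₃
  x₀P : x₀ ∈ P
  x₁P : x₁ ∈ P
  x₁Q₁ : x₁ ∈ Q₁
  x₂Q₁ : x₂ ∈ Q₁
  x₂Q₂ : x₂ ∈ Q₂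
  x₃Q₂ : x₃ ∈ Q₂
  x₃Q₃ : x₃ ∈ Q₃
  x₀Q₃ : x₀ ∈ Q₃
  inter₁ : ∀ w, w ∈ P → w ∈ Q₁ → w = x₁
  inter₂ : ∀ w, w ∈ Q₁ → w ∈ Q₂ → w = x₂
  inter₃ : ∀ w, w ∈ Q₂ → w ∈ Q₃ → w = x₃
  inter₀ : ∀ w, w ∈ Q₃ → w ∈ P → w = x₀
  disj₀₂ : ∀ w, w ∈ P → w ∉ Q₂
  disj₁₃ : ∀ w, w ∈ Q₁ → w ∉ Q₃
  edge : ∀ a b, G.Adj a b → a ≠ v → b ≠ v →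
    (a ∈ P ∧ b ∈ P) ∨ (a ∈ Q₁ ∧ b ∈ Q₁) ∨ (a ∈ Q₂ ∧ b ∈ Q₂) ∨ (a ∈ Q₃ ∧ b ∈ Q₃)

namespace IsNecklace

variable {v x₀ x₁ x₂ x₃ : V} {P Q₁ Q₂ Q₃ : Set V}

lemma rotate (h : IsNecklace G v P Q₁ Q₂ Q₃ x₀ x₁ x₂ x₃) :
    IsNecklace G v Q₁ Q₂ Q₃ P x₁ x₂ x₃ x₀ where
  cover w hw := by have := h.cover w hw; tauto
  vP := h.vQ₁
  vQ₁ := h.vQ₂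
  vQ₂ := h.vQ₃
  vQ₃ := h.vP
  x₀P := h.x₁Q₁
  x₁P := h.x₂Q₁
  x₁Q₁ := h.x₂Q₂
  x₂Q₁ := h.x₃Q₂
  x₂Q₂ := h.x₃Q₃
  x₃Q₂ := h.x₀Q₃
  x₃Q₃ := h.x₀P
  x₀Q₃ := h.x₁P
  inter₁ := h.inter₂
  inter₂ := h.inter₃
  inter₃ := h.inter₀
  inter₀ := h.inter₁
  disj₀₂ := h.disj₁₃
  disj₁₃ w h1 h2 := h.disj₀₂ w h2 h1
  edge a b hab ha hb := by have := h.edge a b hab ha hb; tauto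

lemma reflect (h : IsNecklace G v P Q₁ Q₂ Q₃ x₀ x₁ x₂ x₃) :
    IsNecklace G v P Q₃ Q₂ Q₁ x₁ x₀ x₃ x₂ where
  cover w hw := by have := h.cover w hw; tauto
  vP := h.vP
  vQ₁ := h.vQ₃
  vQ₂ := h.vQ₂
  vQ₃ := h.vQ₁
  x₀P := h.x₁P
  x₁P := h.x₀P
  x₁Q₁ := h.x₀Q₃
  x₂Q₁ := h.x₃Q₃
  x₂Q₂ := h.x₃Q₂
  x₃Q₂ := h.x₂Q₂
  x₃Q₃ := h.x₂Q₁
  x₀Q₃ := h.x₁Q₁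
  inter₁ w h1 h2 := h.inter₀ w h2 h1
  inter₂ w h1 h2 := h.inter₃ w h2 h1
  inter₃ w h1 h2 := h.inter₂ w h2 h1
  inter₀ w h1 h2 := h.inter₁ w h2 h1
  disj₀₂ := h.disj₀₂
  disj₁₃ w h1 h2 := h.disj₁₃ w h2 h1
  edge a b hab ha hb := by have := h.edge a b hab ha hb; tauto

variable (h : IsNecklace G v P Q₁ Q₂ Q₃ x₀ x₁ x₂ x₃)
include h

lemma x₀_ne_x₁ : x₀ ≠ x₁ := fun e => h.disj₁₃ x₁ h.x₁Q₁ (e ▸ h.x₀Q₃)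

lemma x₂_notMem : x₂ ∉ P := fun e => h.disj₀₂ _ e h.x₂Q₂

lemma x₂_ne_v : x₂ ≠ v := fun e => h.vQ₁ (e ▸ h.x₂Q₁)

lemma x₀_ne_v : x₀ ≠ v := fun e => h.vP (e ▸ h.x₀P)

lemma x₁_ne_v : x₁ ≠ v := fun e => h.vP (e ▸ h.x₁P)

lemma x₂_ne_x₀ : x₂ ≠ x₀ := fun e => h.x₂_notMem (e ▸ h.x₀P)

lemma x₂_ne_x₁ : x₂ ≠ x₁ := fun e => h.x₂_notMem (e ▸ h.x₁P)

lemma mem_of_adj_inner {p b : V} (hp : p ∈ P) (h0 : p ≠ x₀) (h1 : p ≠ x₁) (hpb : G.Adj p b)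
    (hb : b ≠ v) : b ∈ P := by
  have hpv : p ≠ v := fun e => h.vP (e ▸ hp)
  have := h.edge p b hpb hpv hb
  have := h.inter₁ p hp
  have := h.inter₀ p
  have := h.disj₀₂ p hp
  tauto

lemma eq_of_adj_outer {w b : V} (hw : w ∉ P) (hwv : w ≠ v) (hwb : G.Adj w b) (hb : b ∈ P) :
    (b = x₀ ∧ w ∈ Q₃) ∨ (b = x₁ ∧ w ∈ Q₁) := by
  have hbv : b ≠ v := fun e => h.vP (e ▸ hb)
  have := h.edge w b hwb hwv hbv
  have := h.inter₁ b hb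
  have := h.inter₀ b
  have := h.disj₀₂ b hb
  tauto

/-- Edges into `P` from outside reach `x₀` only from `Q₃` and `x₁` only from `Q₁`, and these bags
are disjoint. -/
lemma not_adj_both {w b b' : V} (hw : w ∉ P) (hwv : w ≠ v) (hwb : G.Adj w b) (hb : b ∈ P)
    (hwb' : G.Adj w b') (hb' : b' ∈ P) : b = b' := by
  have h1 := h.eq_of_adj_outer hw hwv hwb hb
  have h2 := h.eq_of_adj_outer hw hwv hwb' hb'
  have := h.disj₁₃ w
  rcases h1 with ⟨rfl, h1⟩ | ⟨rfl, h1⟩ <;> rcases h2 with ⟨rfl, h2⟩ | ⟨rfl, h2⟩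
  · rfl
  · exact absurd h1 (this h2)
  · exact absurd h2 (this h1)
  · rfl

/-- The centre has a neighbour in the interior of `P`, unless the latter is empty. -/
lemma exists_adj_inner (hG : IsKConnected 3 G) {p : V} (hp : p ∈ P) (h0 : p ≠ x₀) (h1 : p ≠ x₁) :
    ∃ q ∈ P, q ≠ x₀ ∧ q ≠ x₁ ∧ G.Adj v q := by
  by_contra hcon
  push Not at hcon
  refine hG.not_separated (P \ {x₀, x₁}) {Sum.inl x₀, Sum.inl x₁} (encard_pair_le _ _)
    (k := p) (z := x₂) ⟨hp, by simp [*]⟩ (by simp [*]) (fun e => h.x₂_notMem e.1)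
    (by simp [h.x₂_ne_x₀, h.x₂_ne_x₁]) ?_
  rintro a b ⟨ha, ha'⟩ hb hab
  simp only [Set.mem_insert_iff, Set.mem_singleton_iff, not_or] at ha'
  by_cases hbv : b = v
  · exact absurd hab.symm (hbv ▸ hcon a ha ha'.1 ha'.2)
  have hbP := h.mem_of_adj_inner ha ha'.1 ha'.2 hab hbv
  have : b = x₀ ∨ b = x₁ := by
    by_contra h'
    exact hb ⟨hbP, by simpa using h'⟩
  rcases this with rfl | rfl <;> simp

lemma exists_adj_outer_left (hG : IsKConnected 3 G) : ∃ q, q ∉ P ∧ q ≠ v ∧ G.Adj x₀ q := by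
  by_contra hcon
  push Not at hcon
  refine hG.not_separated {w | w ∉ P ∧ w ≠ v} {Sum.inl v, Sum.inl x₁} (encard_pair_le _ _)
    (k := x₂) (z := x₀) ⟨h.x₂_notMem, h.x₂_ne_v⟩ (by simp [h.x₂_ne_v, h.x₂_ne_x₁])
    (fun e => e.1 h.x₀P) (by simp [h.x₀_ne_v, h.x₀_ne_x₁]) ?_
  rintro a b ⟨ha, ha'⟩ hb hab
  by_cases hbv : b = v
  · simp [hbv]
  have hbP : b ∈ P := by
    by_contra h'
    exact hb ⟨h', hbv⟩
  rcases h.eq_of_adj_outer ha ha' hab hbP with ⟨rfl, -⟩ | ⟨rfl, -⟩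
  · exact absurd hab.symm (hcon a ha ha')
  · simp

lemma exists_adj_outer_right (hG : IsKConnected 3 G) : ∃ q, q ∉ P ∧ q ≠ v ∧ G.Adj x₁ q :=
  h.reflect.exists_adj_outer_left hG

/-- A set of vertices outside of `P` that avoids `x₂` cannot be separated from the rest by `x₀`,
`x₁` and one further vertex or edge. -/
lemma eq_empty_of_boundary (hG : IsKConnected 3 G) {K : Set V} (hKP : ∀ k ∈ K, k ∉ P)
    (hKv : v ∉ K) (hx : x₂ ∉ K) {W : Set (V ⊕ Sym2 V)} (hW : W.encard ≤ 1)
    (hKW : ∀ k ∈ K, Sum.inl k ∉ W)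
    (hb : ∀ a b, a ∈ K → b ∉ K → G.Adj a b →
      b = x₀ ∨ b = x₁ ∨ Sum.inl b ∈ W ∨ Sum.inr s(a, b) ∈ W)
    {z : V} (hz : z ∉ K) (hz0 : z ≠ x₀) (hz1 : z ≠ x₁) (hzW : Sum.inl z ∉ W) : K = ∅ := by
  by_contra hne
  obtain ⟨k, hk⟩ := Set.nonempty_iff_ne_empty.2 hne
  have hv : ∀ a ∈ K, a ≠ v := fun a ha e => hKv (e ▸ ha)
  -- As `K` avoids `x₂`, its part in `Q₁` is attached only to `x₁` and `W`. If that part is empty,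
  -- `K` has no edge to `x₁` and is attached only to `x₀` and `W`. Either way two elements cut it
  -- off.
  by_cases hk1 : ∃ k ∈ K, k ∈ Q₁
  · obtain ⟨k, hk, hk1⟩ := hk1
    refine hG.not_separated (K ∩ Q₁) (insert (Sum.inl x₁) W) (encard_insert_le_two _ hW)
      (k := k) (z := z) ⟨hk, hk1⟩ ?_ (fun e => hz e.1) (by simp [hz1, hzW]) ?_
    · have : k ≠ x₁ := fun e => hKP k hk (e ▸ h.x₁P)
      simp [this, hKW k hk]
    · rintro a b ⟨ha, ha1⟩ hbK hab
      have haP := hKP a ha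
      have ha2 : a ∉ Q₂ := fun e => hx (h.inter₂ a ha1 e ▸ ha)
      have ha3 := h.disj₁₃ a ha1
      by_cases hbK' : b ∈ K
      · have := h.edge a b hab (hv a ha) (hv b hbK')
        have : b ∈ Q₁ := by tauto
        exact absurd ⟨hbK', this⟩ hbK
      · rcases hb a b ha hbK' hab with rfl | rfl | h' | h'
        · have := h.edge a b hab (hv a ha) h.x₀_ne_v
          have h4 : b ∈ Q₁ := by tauto
          exact absurd h.x₀Q₃ (h.disj₁₃ _ h4)
        · simp
        · simp [h']
        · simp [h']
  · push Not at hk1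
    refine hG.not_separated K (insert (Sum.inl x₀) W) (encard_insert_le_two _ hW)
      (k := k) (z := z) hk ?_ hz (by simp [hz0, hzW]) ?_
    · have : k ≠ x₀ := fun e => hKP k hk (e ▸ h.x₀P)
      simp [this, hKW k hk]
    · intro a b ha hbK hab
      rcases hb a b ha hbK hab with rfl | rfl | h' | h'
      · simp
      · rcases h.eq_of_adj_outer (hKP a ha) (hv a ha) hab h.x₁P with ⟨e, -⟩ | ⟨-, h4⟩
        · exact absurd e.symm h.x₀_ne_x₁
        · exact absurd h4 (hk1 a ha)
      · simp [h']
      · simp [h']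

end IsNecklace

/-! ### Split and unsplit bags. -/

/-- Elements of the separator (or, more generally, vertices and edges) inside `P`. -/
def inside (P : Set V) : Set (V ⊕ Sym2 V) :=
  {e | (∃ w ∈ P, e = Sum.inl w) ∨ ∃ a ∈ P, ∃ b ∈ P, e = Sum.inr s(a, b)}

@[simp] lemma inl_mem_inside {P : Set V} {w : V} : Sum.inl w ∈ inside P ↔ w ∈ P := by
  simp [inside]

@[simp] lemma inr_mem_inside {P : Set V} {a b : V} :
    Sum.inr s(a, b) ∈ inside P ↔ a ∈ P ∧ b ∈ P := by
  simp only [inside, Set.mem_ofPred_eq, reduceCtorEq, and_false, exists_false, false_or,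
    Sum.inr.injEq, Sym2.eq_iff]
  constructor
  · rintro ⟨c, hc, d, hd, ⟨rfl, rfl⟩ | ⟨rfl, rfl⟩⟩ <;> tauto
  · rintro ⟨ha, hb⟩
    exact ⟨a, ha, b, hb, by simp⟩

/-- `P` is not separated by fewer than two vertices and edges inside `P`. -/
def Unsplit (G : SimpleGraph V) (P : Set V) : Prop :=
  ∀ C D : Set V, (∀ w ∈ P, w ∈ C ∨ w ∈ D) → (∃ a ∈ P, a ∉ D) → (∃ b ∈ P, b ∉ C) →
    2 ≤ (sep G C D ∩ inside P).encard

/-- `z` is a cutvertex of `P` that separates `x₀` from `x₁`, as witnessed by `P₁` and `P₂`. -/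
structure IsSplit (G : SimpleGraph V) (P : Set V) (x₀ x₁ z : V) (P₁ P₂ : Set V) : Prop where
  ne₀ : z ≠ x₀
  ne₁ : z ≠ x₁
  mem₀ : x₀ ∈ P₁
  mem₁ : x₁ ∈ P₂
  z₁ : z ∈ P₁
  z₂ : z ∈ P₂
  mem_iff : ∀ w, w ∈ P ↔ w ∈ P₁ ∨ w ∈ P₂
  inter : ∀ w, w ∈ P₁ → w ∈ P₂ → w = z
  edge : ∀ a b, a ∈ P → b ∈ P → G.Adj a b → (a ∈ P₁ ∧ b ∈ P₁) ∨ (a ∈ P₂ ∧ b ∈ P₂)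

lemma IsSplit.symm {P P₁ P₂ : Set V} {x₀ x₁ z : V} (h : IsSplit G P x₀ x₁ z P₁ P₂) :
    IsSplit G P x₁ x₀ z P₂ P₁ where
  ne₀ := h.ne₁
  ne₁ := h.ne₀
  mem₀ := h.mem₁
  mem₁ := h.mem₀
  z₁ := h.z₂
  z₂ := h.z₁
  mem_iff w := by rw [h.mem_iff, or_comm]
  inter w h1 h2 := h.inter w h2 h1
  edge a b ha hb hab := (h.edge a b ha hb hab).symm

/-- When `ab` is the only possible edge across, placing `a` on both sides makes it a cutvertex; `a ≠
x₀` keeps the split proper. -/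
lemma isSplit_of_edge {P C D : Set V} {x₀ x₁ a b : V} (hcov : ∀ w ∈ P, w ∈ C ∨ w ∈ D)
    (hT : ∀ z ∈ P, z ∈ C → z ∉ D) (h0P : x₀ ∈ P) (h0C : x₀ ∈ C) (h1P : x₁ ∈ P) (h1D : x₁ ∈ D)
    (haP : a ∈ P) (haC : a ∈ C) (ha0 : a ≠ x₀)
    (huniq : ∀ c d, c ∈ P → d ∈ P → c ∈ C → d ∈ D → G.Adj c d → c = a ∧ d = b) :
    IsSplit G P x₀ x₁ a (P ∩ C) ((P ∩ D) ∪ {a}) where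
  ne₀ := ha0
  ne₁ := fun e => hT a haP haC (e ▸ h1D)
  mem₀ := ⟨h0P, h0C⟩
  mem₁ := Or.inl ⟨h1P, h1D⟩
  z₁ := ⟨haP, haC⟩
  z₂ := Or.inr rfl
  mem_iff w := by
    constructor
    · intro hw
      rcases hcov w hw with h | h
      · exact Or.inl ⟨hw, h⟩
      · exact Or.inr (Or.inl ⟨hw, h⟩)
    · rintro (h' | (h' | rfl))
      · exact h'.1
      · exact h'.1
      · exact haP
  inter := by
    rintro w hw (hw' | hw')
    · exact absurd hw'.2 (hT w hw.1 hw.2)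
    · exact hw'
  edge c d hc hd hcd := by
    by_cases hcC : c ∈ C <;> by_cases hdC : d ∈ C
    · exact Or.inl ⟨⟨hc, hcC⟩, ⟨hd, hdC⟩⟩
    · have hdD := (hcov d hd).resolve_left hdC
      exact Or.inr ⟨Or.inr (huniq c d hc hd hcC hdD hcd).1, Or.inl ⟨hd, hdD⟩⟩
    · have hcD := (hcov c hc).resolve_left hcC
      exact Or.inr ⟨Or.inl ⟨hc, hcD⟩, Or.inr (huniq d c hd hc hdC hcD hcd.symm).1⟩
    · exact Or.inr ⟨Or.inl ⟨hc, (hcov c hc).resolve_left hcC⟩,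
        Or.inl ⟨hd, (hcov d hd).resolve_left hdC⟩⟩

namespace IsNecklace

variable {v x₀ x₁ x₂ x₃ : V} {P Q₁ Q₂ Q₃ : Set V}
variable (h : IsNecklace G v P Q₁ Q₂ Q₃ x₀ x₁ x₂ x₃)
include h

/-- With both ends in `C`, the set `P \ C` can be left only through `v` and the at most one
separator element inside `P`. -/
lemma ends_not_mem_same_side (hG : IsKConnected 3 G) {C D : Set V}
    (hcov : ∀ w ∈ P, w ∈ C ∨ w ∈ D) (hD : ∃ b ∈ P, b ∉ C)
    (hlt : ∀ e ∈ sep G C D ∩ inside P, ∀ e' ∈ sep G C D ∩ inside P, e = e') (h0 : x₀ ∈ C)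
    (h1 : x₁ ∈ C) : False := by
  obtain ⟨k, hk, hkC⟩ := hD
  refine hG.not_separated (P \ C) (insert (Sum.inl v) (sep G C D ∩ inside P))
    (encard_insert_le_two _ (Set.encard_le_one_iff.2 fun a b ha hb => hlt a ha b hb))
    (k := k) (z := x₂) ⟨hk, hkC⟩ ?_ (fun e => h.x₂_notMem e.1) ?_ ?_
  · have : k ≠ v := fun e => h.vP (e ▸ hk)
    simp [hkC, this]
  · simp [h.x₂_ne_v, h.x₂_notMem]
  · rintro a b ⟨haP, haC⟩ hb hab
    by_cases hbv : b = v
    · simp [hbv]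
    have ha0 : a ≠ x₀ := fun e => haC (e ▸ h0)
    have ha1 : a ≠ x₁ := fun e => haC (e ▸ h1)
    have hbP := h.mem_of_adj_inner haP ha0 ha1 hab hbv
    have hbC : b ∈ C := by
      by_contra h'
      exact hb ⟨hbP, h'⟩
    have haD := (hcov a haP).resolve_left haC
    by_cases hbD : b ∈ D <;> simp [*]

/-- If all edges of `P` between `C` and `D` join `x₀` to `x₁`, then `C` contains no inner vertex
of `P`. -/
lemma not_mem_of_edges_eq (hG : IsKConnected 3 G) {C D : Set V}
    (hcov : ∀ w ∈ P, w ∈ C ∨ w ∈ D) (h1 : x₁ ∉ C)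
    (hE : ∀ a b, a ∈ P → b ∈ P → a ∈ C → b ∈ D → G.Adj a b → a = x₀) {p : V} (hp : p ∈ P)
    (hp0 : p ≠ x₀) : p ∉ C := by
  intro hpC
  refine hG.not_separated ((P ∩ C) \ {x₀}) {Sum.inl x₀, Sum.inl v} (encard_pair_le _ _)
    (k := p) (z := x₂) ⟨⟨hp, hpC⟩, hp0⟩ ?_ (fun e => h.x₂_notMem e.1.1)
    (by simp [h.x₂_ne_x₀, h.x₂_ne_v]) ?_
  · have : p ≠ v := fun e => h.vP (e ▸ hp)
    simp [*]
  · rintro a b ⟨⟨haP, haC⟩, ha0⟩ hb hab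
    by_cases hbv : b = v
    · simp [hbv]
    by_cases hb0 : b = x₀
    · simp [hb0]
    have ha1 : a ≠ x₁ := fun e => h1 (e ▸ haC)
    have hbP := h.mem_of_adj_inner haP ha0 ha1 hab hbv
    have hbC : b ∉ C := fun h' => hb ⟨⟨hbP, h'⟩, hb0⟩
    exact absurd (hE a b haP hbP haC ((hcov b hbP).resolve_left hbC) hab) ha0

/-- A single separator vertex inside `P` would be a cutvertex between the ends, and so would an end
of a single edge other than `x₀x₁`. If at most the edge `x₀x₁` goes across, neither side has room
for an inner vertex. -/
lemma ends_not_mem_opposite_sides (hG : IsKConnected 3 G) (hP : ∃ p ∈ P, p ≠ x₀ ∧ p ≠ x₁)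
    (hcut : ∀ z P₁ P₂, ¬ IsSplit G P x₀ x₁ z P₁ P₂) {C D : Set V}
    (hcov : ∀ w ∈ P, w ∈ C ∨ w ∈ D)
    (hlt : ∀ e ∈ sep G C D ∩ inside P, ∀ e' ∈ sep G C D ∩ inside P, e = e') (h0 : x₀ ∉ D)
    (h1 : x₁ ∉ C) : False := by
  have h0C := (hcov x₀ h.x₀P).resolve_right h0
  have h1D := (hcov x₁ h.x₁P).resolve_left h1
  by_cases hT : ∃ z ∈ P, z ∈ C ∧ z ∈ D
  · obtain ⟨z, hzP, hzC, hzD⟩ := hT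
    refine hcut z (P ∩ C) (P ∩ D) ⟨fun e => h0 (e ▸ hzD), fun e => h1 (e ▸ hzC), ⟨h.x₀P, h0C⟩,
      ⟨h.x₁P, h1D⟩, ⟨hzP, hzC⟩, ⟨hzP, hzD⟩, ?_, ?_, ?_⟩
    · intro w
      have := hcov w
      simp only [Set.mem_inter_iff]; tauto
    · rintro w ⟨hwP, hwC⟩ ⟨-, hwD⟩
      have := hlt (Sum.inl w) (by simp [*]) (Sum.inl z) (by simp [*])
      exact Sum.inl_injective this
    · intro a b ha hb hab
      by_contra hcon
      have hmem : Sum.inr s(a, b) ∈ sep G C D ∩ inside P := by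
        have := hcov a ha
        have := hcov b hb
        simp only [Set.mem_inter_iff, inr_mem_sep, inr_mem_inside] at hcon ⊢
        tauto
      have := hlt _ hmem (Sum.inl z) (by simp [*])
      cases this
  · push Not at hT
    have hT' : ∀ z ∈ P, z ∈ D → z ∉ C := fun z hz h1 h2 => hT z hz h2 h1
    by_cases hE : ∃ a b, a ∈ P ∧ b ∈ P ∧ a ∈ C ∧ b ∈ D ∧ G.Adj a b ∧ ¬ (a = x₀ ∧ b = x₁)
    · obtain ⟨a, b, haP, hbP, haC, hbD, hab, hne⟩ := hE
      have hbC : b ∉ C := hT' b hbP hbD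
      have haD : a ∉ D := hT a haP haC
      have huniq : ∀ c d, c ∈ P → d ∈ P → c ∈ C → d ∈ D → G.Adj c d → c = a ∧ d = b := by
        intro c d hc hd hcC hdD hcd
        have hdC : d ∉ C := hT' d hd hdD
        have hcD : c ∉ D := hT c hc hcC
        have := hlt (Sum.inr s(c, d)) (by simp [*]) (Sum.inr s(a, b)) (by simp [*])
        rw [Sum.inr.injEq, Sym2.eq_iff] at this
        rcases this with h' | ⟨rfl, rfl⟩
        · exact h'
        · exact absurd hcC hbC
      by_cases ha0 : a = x₀
      · exact hcut _ _ _ (isSplit_of_edge (fun w hw => (hcov w hw).symm) hT' h.x₁P h1D h.x₀P h0C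
          hbP hbD (fun e => hne ⟨ha0, e⟩)
          (fun c d hc hd hcD hdC hcd => (huniq d c hd hc hdC hcD hcd.symm).symm)).symm
      · exact hcut _ _ _ (isSplit_of_edge hcov hT h.x₀P h0C h.x₁P h1D haP haC ha0 huniq)
    · push Not at hE
      obtain ⟨p, hp, hp0, hp1⟩ := hP
      have hpC := h.not_mem_of_edges_eq hG hcov h1
        (fun a b ha hb haC hbD hab => (hE a b ha hb haC hbD hab).1) hp hp0
      exact h.reflect.not_mem_of_edges_eq hG (fun w hw => (hcov w hw).symm) h0
        (fun a b ha hb haD hbC hab => (hE b a hb ha hbC haD hab.symm).2) hp hp1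
        ((hcov p hp).resolve_left hpC)

/-- This is the dichotomy behind the analysis of necklaces: either a bag can be cut into shorter
ones, or it resists every separation with fewer than two elements inside it. -/
lemma unsplit_of_not_isSplit (hG : IsKConnected 3 G) (hP : ∃ p ∈ P, p ≠ x₀ ∧ p ≠ x₁)
    (hcut : ∀ z P₁ P₂, ¬ IsSplit G P x₀ x₁ z P₁ P₂) : Unsplit G P := by
  intro C D hcov hC hD
  by_contra hlt
  rw [not_two_le_encard] at hlt
  have hcov' : ∀ w ∈ P, w ∈ D ∨ w ∈ C := fun w hw => (hcov w hw).symm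
  have hlt' : ∀ e ∈ sep G D C ∩ inside P, ∀ e' ∈ sep G D C ∩ inside P, e = e' := by
    rwa [sep_comm]
  have s1 := h.ends_not_mem_same_side hG hcov hD hlt
  have s2 := h.ends_not_mem_same_side hG hcov' hC hlt'
  have s3 := h.ends_not_mem_opposite_sides hG hP hcut hcov hlt
  have s4 := h.ends_not_mem_opposite_sides hG hP hcut hcov' hlt'
  have := hcov x₀ h.x₀P
  have := hcov x₁ h.x₁P
  tauto

end IsNecklace

/-! ### Separators with few elements outside a bag. -/

/-- Vertices outside of `P + v`, and edges that avoid `v` and have an end outside of `P`. -/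
def outer (P : Set V) (v : V) : Set (V ⊕ Sym2 V) :=
  {e | (∃ w, w ∉ P ∧ w ≠ v ∧ e = Sum.inl w) ∨
    ∃ a b, a ∉ P ∧ a ≠ v ∧ b ≠ v ∧ e = Sum.inr s(a, b)}

/-- The vertex `v` and the edges incident with `v`. -/
def atVertex (v : V) : Set (V ⊕ Sym2 V) :=
  {e | e = Sum.inl v ∨ ∃ b, e = Sum.inr s(v, b)}

@[simp] lemma inl_mem_outer {P : Set V} {v w : V} : Sum.inl w ∈ outer P v ↔ w ∉ P ∧ w ≠ v := by
  simp [outer]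

@[simp] lemma inr_mem_outer {P : Set V} {v a b : V} :
    Sum.inr s(a, b) ∈ outer P v ↔ (a ∉ P ∨ b ∉ P) ∧ a ≠ v ∧ b ≠ v := by
  simp only [outer, Set.mem_ofPred_eq, reduceCtorEq, and_false, exists_false, false_or,
    Sum.inr.injEq, Sym2.eq_iff]
  constructor
  · rintro ⟨c, d, hc, hcv, hdv, ⟨rfl, rfl⟩ | ⟨rfl, rfl⟩⟩ <;> tauto
  · rintro ⟨h | h, ha, hb⟩
    · exact ⟨a, b, h, ha, hb, by simp⟩
    · exact ⟨b, a, h, hb, ha, by simp⟩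

@[simp] lemma inl_mem_atVertex {v w : V} : Sum.inl w ∈ atVertex v ↔ w = v := by
  simp [atVertex]

@[simp] lemma inr_mem_atVertex {v a b : V} : Sum.inr s(a, b) ∈ atVertex v ↔ a = v ∨ b = v := by
  simp only [atVertex, Set.mem_ofPred_eq, reduceCtorEq, false_or, Sum.inr.injEq, Sym2.eq_iff]
  constructor
  · rintro ⟨c, ⟨rfl, rfl⟩ | ⟨rfl, rfl⟩⟩ <;> tauto
  · rintro (rfl | rfl)
    · exact ⟨b, by simp⟩
    · exact ⟨a, by simp⟩

/-- The regions `inside P`, `outer P v` and `atVertex v` are disjoint, so each separator element is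
charged at most once. This budget of three drives the case analysis of nestedness. -/
lemma exists_counts {X : Set (V ⊕ Sym2 V)} (hX : X.encard = 3) {P : Set V} {v : V} (hv : v ∉ P) :
    ∃ a b c : ℕ, (X ∩ inside P).encard = a ∧ (X ∩ outer P v).encard = b ∧
      (X ∩ atVertex v).encard = c ∧ a + b + c ≤ 3 := by
  have hfin : X.Finite := Set.finite_of_encard_eq_coe (k := 3) hX
  have f1 : (X ∩ inside P).Finite := hfin.subset Set.inter_subset_left
  have f2 : (X ∩ outer P v).Finite := hfin.subset Set.inter_subset_left
  have f3 : (X ∩ atVertex v).Finite := hfin.subset Set.inter_subset_left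
  refine ⟨_, _, _, f1.cast_ncard_eq.symm, f2.cast_ncard_eq.symm, f3.cast_ncard_eq.symm, ?_⟩
  have d1 : Disjoint (X ∩ inside P) (X ∩ outer P v) := by
    rw [Set.disjoint_left]
    rintro (w | e) h1 h2
    · simp_all
    · induction e using Sym2.ind with | _ a b =>
      have := h1.2; have := h2.2
      simp_all
  have d2 : Disjoint ((X ∩ inside P) ∪ (X ∩ outer P v)) (X ∩ atVertex v) := by
    rw [Set.disjoint_left]
    rintro (w | e) h1 h2
    · simp only [Set.mem_union, Set.mem_inter_iff, inl_mem_inside, inl_mem_outer,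
        inl_mem_atVertex] at h1 h2
      obtain ⟨-, rfl⟩ := h2
      tauto
    · induction e using Sym2.ind with | _ a b =>
      simp only [Set.mem_union, Set.mem_inter_iff, inr_mem_inside, inr_mem_outer,
        inr_mem_atVertex] at h1 h2
      obtain ⟨-, rfl | rfl⟩ := h2 <;> tauto
  rw [← Set.ncard_union_eq d1 f1 f2, ← Set.ncard_union_eq d2 (f1.union f2) f3]
  have : X.ncard = 3 := by rw [Set.ncard_def, hX]; rfl
  rw [← this]
  apply Set.ncard_le_ncard _ hfin
  rintro e ((h | h) | h) <;> exact h.1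

namespace IsNecklace

variable {v x₀ x₁ x₂ x₃ : V} {P Q₁ Q₂ Q₃ C D : Set V}
variable (h : IsNecklace G v P Q₁ Q₂ Q₃ x₀ x₁ x₂ x₃)
include h

/-- Under these hypotheses `v` has no neighbour in `Q₂ ∪ Q₃` other than possibly `x₂` and `x₀`, so
these two would separate `x₃` from `v`. -/
lemma not_subset_compl (hG : IsKConnected 3 G)
    (hvn : ∀ n, n ∉ P → G.Adj v n → n ∈ C) (h2 : ∀ w ∈ Q₂, w ∉ C)
    (h3 : ∀ w ∈ Q₃, w ≠ x₀ → w ∉ C) : False := by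
  have hx3P : x₃ ∉ P := h.reflect.x₂_notMem
  have hx32 : x₃ ≠ x₂ := fun e => h.disj₁₃ x₂ h.x₂Q₁ (e ▸ h.x₃Q₃)
  have hx30 : x₃ ≠ x₀ := fun e => hx3P (e ▸ h.x₀P)
  have hx3v : x₃ ≠ v := h.reflect.x₂_ne_v
  refine hG.not_separated ((Q₂ ∪ Q₃) \ {x₂, x₀}) {Sum.inl x₂, Sum.inl x₀} (encard_pair_le _ _)
    (k := x₃) (z := v) ⟨Or.inl h.x₃Q₂, by simp [*]⟩ (by simp [*]) ?_
    (by simp [h.x₂_ne_v.symm, h.x₀_ne_v.symm]) ?_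
  · rintro ⟨h' | h', -⟩
    · exact h.vQ₂ h'
    · exact h.vQ₃ h'
  · rintro a b ⟨ha, ha'⟩ hb hab
    simp only [Set.mem_insert_iff, Set.mem_singleton_iff, not_or] at ha'
    have hav : a ≠ v := by
      rintro rfl
      exact ha.elim h.vQ₂ h.vQ₃
    by_cases hbv : b = v
    · subst hbv
      have haP : a ∉ P := by
        rcases ha with h' | h'
        · exact fun e => h.disj₀₂ a e h'
        · exact fun e => ha'.2 (h.inter₀ a h' e)
      have := hvn a haP hab.symm
      rcases ha with h' | h'
      · exact absurd this (h2 a h')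
      · exact absurd this (h3 a h' ha'.2)
    · have e1 := h.edge a b hab hav hbv
      have i1 := h.inter₂ a
      have i2 := h.inter₀ a
      have i3 := h.disj₀₂ a
      have i4 := h.disj₁₃ a
      have hb23 : b ∈ Q₂ ∪ Q₃ := by
        have ha23 : a ∈ Q₂ ∨ a ∈ Q₃ := ha
        show b ∈ Q₂ ∨ b ∈ Q₃
        tauto
      have : b = x₂ ∨ b = x₀ := by
        by_contra h'
        exact hb ⟨hb23, by simpa using h'⟩
      rcases this with rfl | rfl <;> simp

/-- With no separator element in this bag, vertices of `Q₁` other than `x₁` on the side of `C` would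
be cut off from `x₂` by `x₁` and `v`. -/
lemma bag_subset_compl (hG : IsKConnected 3 G) (hCD : IsMixedSeparation C D)
    (hx : x₂ ∉ C) (hno : ∀ e ∈ sep G C D ∩ outer P v, e ∉ inside Q₁) :
    ∀ w ∈ Q₁, w ≠ x₁ → w ∉ C := by
  have hxD : x₂ ∈ D := (hCD.mem_or x₂).resolve_left hx
  have hout : ∀ w ∈ Q₁, w ≠ x₁ → w ∉ P := fun w h1 h2 h3 => h2 (h.inter₁ w h3 h1)
  have hv : ∀ w ∈ Q₁, w ≠ v := fun w h1 e => h.vQ₁ (e ▸ h1)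
  intro w hw hw1 hwC
  by_cases hwD : w ∈ D
  · exact hno (Sum.inl w) (by simp [hwC, hwD, hout w hw hw1, hv w hw]) (by simpa using hw)
  · refine hG.not_separated {w | w ∈ Q₁ ∧ w ∉ D ∧ w ≠ x₁} {Sum.inl x₁, Sum.inl v}
      (encard_pair_le _ _) (k := w) (z := x₂) ⟨hw, hwD, hw1⟩ (by simp [hw1, hv w hw])
      (fun e => e.2.1 hxD) (by simp [h.x₂_ne_x₁, h.x₂_ne_v]) ?_
    rintro a b ⟨ha1, haD, hax⟩ hb hab
    by_cases hbv : b = v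
    · simp [hbv]
    by_cases hbx : b = x₁
    · simp [hbx]
    exfalso
    have ha2 : a ≠ x₂ := fun e => haD (e ▸ hxD)
    have hbQ : b ∈ Q₁ := by
      have := h.edge a b hab (hv a ha1) hbv
      have := hout a ha1 hax
      have := h.inter₂ a ha1
      have := h.disj₁₃ a ha1
      tauto
    have hbD : b ∈ D := by
      by_contra h'
      exact hb ⟨hbQ, h', hbx⟩
    have haC := (hCD.mem_or a).resolve_right haD
    have haP := hout a ha1 hax
    have hbP := hout b hbQ hbx
    have hav := hv a ha1
    by_cases hbC : b ∈ C
    · exact hno (Sum.inl b) ⟨inl_mem_sep.2 ⟨hbC, hbD⟩, inl_mem_outer.2 ⟨hbP, hbv⟩⟩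
        (inl_mem_inside.2 hbQ)
    · exact hno (Sum.inr s(a, b)) ⟨inr_mem_sep.2 ⟨hab, Or.inl ⟨haC, haD, hbD, hbC⟩⟩,
        inr_mem_outer.2 ⟨Or.inl haP, hav, hbv⟩⟩ (inr_mem_inside.2 ⟨ha1, hbQ⟩)

/-- Both ends of `Q₂` are in `D`, so `Q₂ \ D` could be left only through `v` and the single outer
element. -/
lemma middle_mem_right (hG : IsKConnected 3 G) (hCD : IsMixedSeparation C D)
    (hle : (sep G C D ∩ outer P v).encard ≤ 1) (hx2 : x₂ ∉ C) (hx3 : x₃ ∉ C) :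
    ∀ w ∈ Q₂, w ∈ D := by
  have hQ2P : ∀ w ∈ Q₂, w ∉ P := fun w h1 h2 => h.disj₀₂ w h2 h1
  have hQ2v : ∀ w ∈ Q₂, w ≠ v := fun w h1 e => h.vQ₂ (e ▸ h1)
  have hx2D := (hCD.mem_or x₂).resolve_left hx2
  have hx3D := (hCD.mem_or x₃).resolve_left hx3
  intro w hw
  by_contra hwD
  refine hG.not_separated {w | w ∈ Q₂ ∧ w ∉ D} (insert (Sum.inl v) (sep G C D ∩ outer P v))
    (encard_insert_le_two _ hle) (k := w) (z := x₂) ⟨hw, hwD⟩ (by simp [hwD, hQ2v w hw])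
    (fun e => e.2 hx2D) (by simp [h.x₂_ne_v, hx2]) ?_
  rintro a b ⟨ha, haD⟩ hbK hab
  by_cases hbv : b = v
  · simp [hbv]
  have ha2 : a ≠ x₂ := fun e => haD (e ▸ hx2D)
  have ha3 : a ≠ x₃ := fun e => haD (e ▸ hx3D)
  have hbQ : b ∈ Q₂ := by
    have := h.edge a b hab (hQ2v a ha) hbv
    have := hQ2P a ha
    have := h.inter₂ a
    have := h.inter₃ a ha
    tauto
  have hbD : b ∈ D := by
    by_contra h'
    exact hbK ⟨hbQ, h'⟩
  have haC := (hCD.mem_or a).resolve_right haD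
  by_cases hbC : b ∈ C
  · exact Or.inr (Or.inl (Or.inr ⟨inl_mem_sep.2 ⟨hbC, hbD⟩, inl_mem_outer.2 ⟨hQ2P b hbQ, hbv⟩⟩))
  · exact Or.inr (Or.inr (Or.inr ⟨inr_mem_sep.2 ⟨hab, Or.inl ⟨haC, haD, hbD, hbC⟩⟩,
      inr_mem_outer.2 ⟨Or.inl (hQ2P a ha), hQ2v a ha, hbv⟩⟩))

/-- If the only outer element were in `Q₁`, then `Q₂` and `Q₃` would contain none and hence avoid
`C`, except possibly at `x₀`; `not_subset_compl` excludes this. -/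
lemma not_inside_bag_left (hG : IsKConnected 3 G) (hCD : IsMixedSeparation C D)
    (hone : ∀ e ∈ sep G C D ∩ outer P v, ∀ e' ∈ sep G C D ∩ outer P v, e = e')
    (hvn : ∀ n, n ∉ P → G.Adj v n → n ∈ C) (hx2 : x₂ ∉ C) (hx3 : x₃ ∉ C) :
    ∀ e ∈ sep G C D ∩ outer P v, e ∉ inside Q₁ := by
  intro e he he1
  have hQ2 := h.middle_mem_right hG hCD
    (Set.encard_le_one_iff.2 fun a b ha hb => hone a ha b hb) hx2 hx3
  have he2 : e ∉ inside Q₂ := by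
    intro he2
    rcases e with w | e
    · rw [inl_mem_inside] at he1 he2
      have := h.inter₂ w he1 he2
      subst this
      exact hx2 (inl_mem_sep.1 he.1).1
    · induction e using Sym2.ind with | _ a b =>
      rw [inr_mem_inside] at he1 he2
      exact (inr_mem_sep.1 he.1).1.ne
        ((h.inter₂ a he1.1 he2.1).trans (h.inter₂ b he1.2 he2.2).symm)
  have he3 : e ∉ inside Q₃ := by
    intro he3
    rcases e with w | e
    · rw [inl_mem_inside] at he1 he3
      exact h.disj₁₃ w he1 he3
    · induction e using Sym2.ind with | _ a b =>
      rw [inr_mem_inside] at he1 he3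
      exact h.disj₁₃ a he1.1 he3.1
  refine h.not_subset_compl hG hvn ?_
    (h.reflect.bag_subset_compl hG hCD hx3 fun e' he' => by rwa [hone e' he' e he])
  intro w hw hwC
  have hwP : w ∉ P := fun h2 => h.disj₀₂ w h2 hw
  have hwv : w ≠ v := fun e => h.vQ₂ (e ▸ hw)
  have := hone e he (Sum.inl w) ⟨inl_mem_sep.2 ⟨hwC, hQ2 w hw⟩, inl_mem_outer.2 ⟨hwP, hwv⟩⟩
  rw [this] at he2
  exact he2 (inl_mem_inside.2 hw)

/-- If at most one element of the separator of `(C, D)` lies outside of `P + v`, if `v` is in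
`C \ D`, and `v` has no neighbours in `D \ C` outside of `P`, then `D \ C` is contained in `P`. -/
lemma mem_left_of_outer (hG : IsKConnected 3 G) (hCD : IsMixedSeparation C D) (hvC : v ∈ C)
    (hone : ∀ e ∈ sep G C D ∩ outer P v, ∀ e' ∈ sep G C D ∩ outer P v, e = e')
    (hvn : ∀ n, n ∉ P → G.Adj v n → n ∈ C)
    (htwo : ∃ n n', n ∉ P ∧ n' ∉ P ∧ n ≠ n' ∧ G.Adj v n ∧ G.Adj v n') {w : V} (hwP : w ∉ P) :
    w ∈ C := by
  by_contra hwC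
  have hwv : w ≠ v := fun e => hwC (e ▸ hvC)
  set K : Set V := {w | w ∉ P ∧ w ≠ v ∧ w ∉ C} with hK
  have hKne : K ≠ ∅ := Set.nonempty_iff_ne_empty.1 ⟨w, hwP, hwv, hwC⟩
  have hle : (sep G C D ∩ outer P v).encard ≤ 1 :=
    Set.encard_le_one_iff.2 fun a b ha hb => hone a ha b hb
  have hb : ∀ a b, a ∈ K → b ∉ K → G.Adj a b → b = x₀ ∨ b = x₁ ∨
      Sum.inl b ∈ sep G C D ∩ outer P v ∨ Sum.inr s(a, b) ∈ sep G C D ∩ outer P v := by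
    rintro a b ⟨haP, hav, haC⟩ hbK hab
    have haD := (hCD.mem_or a).resolve_left haC
    by_cases hbv : b = v
    · exact absurd (hvn a haP (hbv ▸ hab.symm)) haC
    by_cases hbP : b ∈ P
    · rcases h.eq_of_adj_outer haP hav hab hbP with ⟨h', -⟩ | ⟨h', -⟩
      · exact Or.inl h'
      · exact Or.inr (Or.inl h')
    have hbC : b ∈ C := by
      by_contra h'
      exact hbK ⟨hbP, hbv, h'⟩
    right; right
    by_cases hbD : b ∈ D
    · exact Or.inl ⟨inl_mem_sep.2 ⟨hbC, hbD⟩, inl_mem_outer.2 ⟨hbP, hbv⟩⟩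
    · exact Or.inr ⟨inr_mem_sep.2 ⟨hab, Or.inr ⟨hbC, hbD, haD, haC⟩⟩,
        inr_mem_outer.2 ⟨Or.inl haP, hav, hbv⟩⟩
  have hKW : ∀ k ∈ K, Sum.inl k ∉ sep G C D ∩ outer P v := fun k hk e =>
    hk.2.2 (inl_mem_sep.1 e.1).1
  have hvK : v ∉ K := fun e => e.2.1 rfl
  have hvW : Sum.inl v ∉ sep G C D ∩ outer P v := fun e => (inl_mem_outer.1 e.2).2 rfl
  -- A nonempty `K` that misses `x₂` or `x₃` is ruled out by `eq_empty_of_boundary`, so both are in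
  -- `D \ C`.
  have hx2 : x₂ ∈ K := by
    by_contra hx
    exact hKne (h.eq_empty_of_boundary hG (fun k hk => hk.1) hvK hx hle hKW hb (z := v) hvK
      h.x₀_ne_v.symm h.x₁_ne_v.symm hvW)
  have hx3 : x₃ ∈ K := by
    by_contra hx
    exact hKne (h.reflect.eq_empty_of_boundary hG (fun k hk => hk.1) hvK hx hle hKW
      (fun a b h1 h2 h3 => by have := hb a b h1 h2 h3; tauto) (z := v) hvK
      h.x₁_ne_v.symm h.x₀_ne_v.symm hvW)
  have hQ2 := h.middle_mem_right hG hCD hle hx2.2.2 hx3.2.2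
  have b1 := h.bag_subset_compl hG hCD hx2.2.2
    (h.not_inside_bag_left hG hCD hone hvn hx2.2.2 hx3.2.2)
  have b3 := h.reflect.bag_subset_compl hG hCD hx3.2.2
    (h.reflect.not_inside_bag_left hG hCD hone hvn hx3.2.2 hx2.2.2)
  -- All neighbours of `v` outside `P` are forced into `Q₂ ∩ C ∩ D`; two of them are two outer
  -- separator elements.
  have key : ∀ n, n ∉ P → G.Adj v n →
      Sum.inl n ∈ sep G C D ∩ outer P v := by
    intro n hn hvn'
    have hnC := hvn n hn hvn'
    rcases h.cover n hvn'.ne' with h' | h' | h' | h'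
    · exact absurd h' hn
    · exact absurd hnC (b1 n h' (fun e => hn (e ▸ h.x₁P)))
    · exact ⟨inl_mem_sep.2 ⟨hnC, hQ2 n h'⟩, inl_mem_outer.2 ⟨hn, hvn'.ne'⟩⟩
    · exact absurd hnC (b3 n h' (fun e => hn (e ▸ h.x₀P)))
  obtain ⟨n, n', hn, hn', hne, hvn1, hvn2⟩ := htwo
  exact hne (Sum.inl_injective (hone _ (key n hn hvn1) _ (key n' hn' hvn2)))

/-- If no element of the separator of `(C, D)` lies outside of `P + v`, then all the vertices outside
of `P + v` are in the same strict side. -/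
lemma outer_subset_side (hG : IsKConnected 3 G) (hCD : IsMixedSeparation C D)
    (hnone : ∀ e ∈ sep G C D, e ∉ outer P v) :
    (∀ w, w ∉ P → w ≠ v → w ∉ D) ∨ (∀ w, w ∉ P → w ≠ v → w ∉ C) := by
  have key : ∀ {C D : Set V}, IsMixedSeparation C D → (∀ e ∈ sep G C D, e ∉ outer P v) →
      x₂ ∉ D → ∀ w, w ∉ P → w ≠ v → w ∉ D := by
    intro C D hCD hnone hx w hwP hwv hwD
    have hK := h.eq_empty_of_boundary hG (K := {w | w ∉ P ∧ w ≠ v ∧ w ∈ D}) (W := {Sum.inl v})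
      (fun k hk => hk.1) (fun e => e.2.1 rfl) (fun e => hx e.2.2) (by simp)
      (fun k hk => by simp [hk.2.1]) ?_ (z := x₂) (fun e => hx e.2.2) h.x₂_ne_x₀ h.x₂_ne_x₁
      (by simp [h.x₂_ne_v])
    · have : w ∈ {w | w ∉ P ∧ w ≠ v ∧ w ∈ D} := ⟨hwP, hwv, hwD⟩
      rw [hK] at this
      exact this
    · rintro a b ⟨haP, hav, haD⟩ hbK hab
      by_cases hbv : b = v
      · simp [hbv]
      by_cases hbP : b ∈ P
      · rcases h.eq_of_adj_outer haP hav hab hbP with ⟨rfl, -⟩ | ⟨rfl, -⟩ <;> simp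
      have hbD : b ∉ D := fun h' => hbK ⟨hbP, hbv, h'⟩
      have hbC := (hCD.mem_or b).resolve_right hbD
      exfalso
      by_cases haC : a ∈ C
      · exact hnone (Sum.inl a) (inl_mem_sep.2 ⟨haC, haD⟩) (inl_mem_outer.2 ⟨haP, hav⟩)
      · exact hnone (Sum.inr s(a, b)) (inr_mem_sep.2 ⟨hab, Or.inr ⟨hbC, hbD, haD, haC⟩⟩)
          (inr_mem_outer.2 ⟨Or.inl haP, hav, hbv⟩)
  by_cases hx : x₂ ∈ D
  · have hxC : x₂ ∉ C := fun hx' => hnone (Sum.inl x₂) (inl_mem_sep.2 ⟨hx', hx⟩)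
      (by simp [h.x₂_notMem, h.x₂_ne_v])
    exact Or.inr (key hCD.symm (by rwa [sep_comm]) hxC)
  · exact Or.inl (key hCD hnone hx)

end IsNecklace

/-! ### The totally-nested tri-separation of an unsplit bag. -/

/-- The set `P` together with all vertices that have at least two neighbours in `P`. -/
def cutSide (G : SimpleGraph V) (P : Set V) : Set V :=
  P ∪ {w | ∃ a ∈ P, ∃ b ∈ P, a ≠ b ∧ G.Adj w a ∧ G.Adj w b}

/-- A necklace in which the bag `P` gives rise to a totally-nested nontrivial tri-separation. -/
structure IsGoodNecklace (G : SimpleGraph V) (v : V) (P Q₁ Q₂ Q₃ : Set V) (x₀ x₁ x₂ x₃ : V) : Prop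
    extends IsNecklace G v P Q₁ Q₂ Q₃ x₀ x₁ x₂ x₃ where
  unsplit : Unsplit G P
  inner : ∃ p ∈ P, p ≠ x₀ ∧ p ≠ x₁
  two : ∃ n n', n ∉ P ∧ n' ∉ P ∧ n ≠ n' ∧ G.Adj v n ∧ G.Adj v n'

/-- Charges to `x` its one contribution to the separator: `x` itself if it has two neighbours
outside `P`, and otherwise its only edge leaving `P`. -/
lemma exists_end_element (G : SimpleGraph V) (P : Set V) (x : V) :
    ∃ e : V ⊕ Sym2 V, (x ∈ cutSide G Pᶜ → e = Sum.inl x) ∧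
      (x ∉ cutSide G Pᶜ → ∀ b, b ∉ P → G.Adj x b → e = Sum.inr s(x, b)) := by
  by_cases hxB : x ∈ cutSide G Pᶜ
  · exact ⟨_, fun _ => rfl, fun h => absurd hxB h⟩
  · by_cases hb : ∃ b, b ∉ P ∧ G.Adj x b
    · obtain ⟨b, hb, hxb⟩ := hb
      refine ⟨Sum.inr s(x, b), fun h => absurd h hxB, fun _ c hc hxc => ?_⟩
      by_contra hne
      exact hxB (Or.inr ⟨b, hb, c, hc, fun e => hne (by rw [e]), hxb, hxc⟩)
    · push Not at hb
      exact ⟨Sum.inl x, fun h => absurd h hxB, fun _ c hc hxc => absurd hxc (hb c hc)⟩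

/-- If an end of `P` is in `C ∩ D` but not in the right side of the tri-separation of the necklace,
then both ends are in `C ∩ D`. -/
lemma ends_mem_of_not_mem_right {P C D : Set V} {x₀ x₁ : V} (hCD : IsTriSeparation G C D)
    (hends : ∀ p ∈ P, p ∈ C → p ∈ D → p = x₀ ∨ p = x₁) (hPCD : ∀ p ∈ P, p ∈ C → p ∈ D)
    {c : V} (hcC : c ∈ C) (hcB : c ∉ cutSide G Pᶜ) : x₀ ∈ C ∧ x₁ ∈ C := by
  have hcP : c ∈ P := by
    by_contra h'
    exact hcB (Or.inl h')
  have hcD := hPCD c hcP hcC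
  obtain ⟨a, ⟨hca, ha⟩, b, ⟨hcb, hb⟩, hab⟩ := two_le_encard_iff.1 (hCD.2.2 c ⟨hcC, hcD⟩).1
  -- Since `c` has at most one neighbour outside `P`, one of its two neighbours in `C` is in `P`; it
  -- is in `C ∩ D` too, so `c` and `d` are the two ends.
  have : ∃ d ∈ P, d ∈ C ∧ G.Adj c d := by
    by_contra h'
    push Not at h'
    exact hcB (Or.inr ⟨a, fun e => h' a e ha hca, b, fun e => h' b e hb hcb, hab, hca, hcb⟩)
  obtain ⟨d, hdP, hdC, hcd⟩ := this
  have := hends c hcP hcC hcD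
  have := hends d hdP hdC (hPCD d hdP hdC)
  have := hcd.ne
  grind

lemma two_le_inside_of_mem {P C D : Set V} {a b : V} (haP : a ∈ P) (hbP : b ∈ P) (hab : a ≠ b)
    (haC : a ∈ C)
    (haD : a ∈ D) (hbC : b ∈ C) (hbD : b ∈ D) : 2 ≤ (sep G C D ∩ inside P).encard :=
  two_le_encard_iff.2 ⟨Sum.inl a, ⟨inl_mem_sep.2 ⟨haC, haD⟩, inl_mem_inside.2 haP⟩, Sum.inl b,
    ⟨inl_mem_sep.2 ⟨hbC, hbD⟩, inl_mem_inside.2 hbP⟩, fun e => hab (Sum.inl_injective e)⟩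

namespace IsGoodNecklace

variable {v x₀ x₁ x₂ x₃ : V} {P Q₁ Q₂ Q₃ C D : Set V}
variable (h : IsGoodNecklace G v P Q₁ Q₂ Q₃ x₀ x₁ x₂ x₃)
include h

lemma mem_left_iff {w : V} : w ∈ cutSide G P ↔
    w ∈ P ∨ (w = v ∧ ∃ a ∈ P, ∃ b ∈ P, a ≠ b ∧ G.Adj w a ∧ G.Adj w b) := by
  refine or_congr_right' fun hw => ?_
  constructor
  · rintro ⟨a, ha, b, hb, hab, hwa, hwb⟩
    refine ⟨?_, a, ha, b, hb, hab, hwa, hwb⟩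
    by_contra hwv
    exact hab (h.not_adj_both hw hwv hwa ha hwb hb)
  · exact fun h => h.2

lemma mem_right_iff {w : V} : w ∈ cutSide G Pᶜ ↔
    w ∉ P ∨ ((w = x₀ ∨ w = x₁) ∧ ∃ a, a ∉ P ∧ ∃ b, b ∉ P ∧ a ≠ b ∧ G.Adj w a ∧ G.Adj w b) := by
  refine or_congr_right' fun hw => ?_
  have hw : w ∈ P := not_not.1 hw
  constructor
  · rintro ⟨a, ha, b, hb, hab, hwa, hwb⟩
    refine ⟨?_, a, ha, b, hb, hab, hwa, hwb⟩
    by_contra hw'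
    push Not at hw'
    have hav : a = v := by
      by_contra h'
      exact ha (h.mem_of_adj_inner hw hw'.1 hw'.2 hwa h')
    have hbv : b = v := by
      by_contra h'
      exact hb (h.mem_of_adj_inner hw hw'.1 hw'.2 hwb h')
    exact hab (hav.trans hbv.symm)
  · rintro ⟨-, a, ha, b, hb, hab⟩
    exact ⟨a, ha, b, hb, hab⟩

/-- Unsplitness is applied to `({w}, {w}ᶜ)`, whose separator consists of the edges at `w`. -/
lemma exists_two_adj {w : V} (hw : w ∈ P) : ∃ a ∈ P, ∃ b ∈ P, a ≠ b ∧ G.Adj w a ∧ G.Adj w b := by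
  have hex : ∃ b ∈ P, b ≠ w := by
    by_cases hw0 : w = x₀
    · exact ⟨x₁, h.x₁P, by rw [hw0]; exact h.x₀_ne_x₁.symm⟩
    · exact ⟨x₀, h.x₀P, fun e => hw0 e.symm⟩
  obtain ⟨b, hb, hbw⟩ := hex
  have := h.unsplit {w} {w}ᶜ (fun x _ => by simp [em]) ⟨w, hw, by simp⟩ ⟨b, hb, by simpa using hbw⟩
  obtain ⟨e, he, e', he', hne⟩ := two_le_encard_iff.1 this
  have key : ∀ e ∈ sep G {w} {w}ᶜ ∩ inside P, ∃ a ∈ P, G.Adj w a ∧ e = Sum.inr s(w, a) := by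
    rintro (x | e) ⟨h1, h2⟩
    · rw [inl_mem_sep] at h1
      exact absurd h1.1 h1.2
    · induction e using Sym2.ind with | _ a b =>
      rw [inr_mem_sep] at h1
      rw [inr_mem_inside] at h2
      rcases h1 with ⟨hab, ⟨h1, -⟩ | ⟨h1, -⟩⟩
      · cases h1
        exact ⟨b, h2.2, hab, rfl⟩
      · cases h1
        exact ⟨a, h2.1, hab.symm, by rw [Sym2.eq_swap]⟩
  obtain ⟨a, ha, hwa, rfl⟩ := key e he
  obtain ⟨a', ha', hwa', rfl⟩ := key e' he'
  exact ⟨a, ha, a', ha', fun e => hne (by rw [e]), hwa, hwa'⟩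

/-- The separator has one element for each of `x₀`, `x₁` and `v`: the vertex if it has two
neighbours across, and otherwise its single edge across. The degree conditions come from
`exists_two_adj`, the definition of `cutSide`, and the field `two`. -/
lemma isTriSeparation (hG : IsKConnected 3 G) :
    IsTriSeparation G (cutSide G P) (cutSide G Pᶜ) := by
  obtain ⟨p, hp, hp0, hp1⟩ := h.inner
  have hmix : IsMixedSeparation (cutSide G P) (cutSide G Pᶜ) := by
    refine ⟨?_, ⟨p, Or.inl hp, ?_⟩, ⟨x₂, Or.inl h.x₂_notMem, ?_⟩⟩
    · rw [Set.eq_univ_iff_forall]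
      intro w
      by_cases hw : w ∈ P
      · exact Or.inl (Or.inl hw)
      · exact Or.inr (Or.inl hw)
    · rw [h.mem_right_iff]
      tauto
    · rw [h.mem_left_iff]
      have := h.x₂_notMem
      have := h.x₂_ne_v
      tauto
  refine ⟨hmix, le_antisymm ?_ (hG.three_le_order hmix), ?_⟩
  · obtain ⟨e₀, h00, h01⟩ := exists_end_element G P x₀
    obtain ⟨e₁, h10, h11⟩ := exists_end_element G P x₁
    have hev : ∃ e : V ⊕ Sym2 V, (v ∈ cutSide G P → e = Sum.inl v) ∧
        (v ∉ cutSide G P → ∀ b, b ∈ P → G.Adj v b → e = Sum.inr s(v, b)) := by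
      by_cases hv : v ∈ cutSide G P
      · exact ⟨_, fun _ => rfl, fun h => absurd hv h⟩
      · obtain ⟨q, hq, -, -, hvq⟩ := h.exists_adj_inner hG hp hp0 hp1
        refine ⟨Sum.inr s(v, q), fun h => absurd h hv, fun _ c hc hvc => ?_⟩
        by_contra hne
        exact hv (Or.inr ⟨q, hq, c, hc, fun e => hne (by rw [e]), hvq, hvc⟩)
    obtain ⟨ev, hv0, hv1⟩ := hev
    rw [order_eq_encard_sep]
    have hsub : sep G (cutSide G P) (cutSide G Pᶜ) ⊆ {e₀, e₁, ev} := by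
      rw [sep_subset_iff]
      constructor
      · intro w hwA hwB
        rcases h.mem_left_iff.1 hwA with hwP | ⟨rfl, -⟩
        · rcases h.mem_right_iff.1 hwB with hwP' | ⟨rfl | rfl, -⟩
          · exact absurd hwP hwP'
          · rw [h00 hwB]; simp
          · rw [h10 hwB]; simp
        · rw [hv0 hwA]; simp
      · intro a b hab haA haB hbB hbA
        have haP : a ∈ P := by
          by_contra h'
          exact haB (Or.inl h')
        have hbP : b ∉ P := fun h' => hbA (Or.inl h')
        by_cases hbv : b = v
        · subst hbv
          have := hv1 hbA a haP hab.symm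
          rw [Sym2.eq_swap] at this
          rw [this]; simp
        · rcases h.eq_of_adj_outer hbP hbv hab.symm haP with ⟨rfl, -⟩ | ⟨rfl, -⟩
          · rw [h01 haB b hbP hab]; simp
          · rw [h11 haB b hbP hab]; simp
    refine (Set.encard_le_encard hsub).trans ((Set.encard_insert_le _ _).trans ?_)
    calc ({e₁, ev} : Set (V ⊕ Sym2 V)).encard + 1 ≤ 2 + 1 := by gcongr; exact encard_pair_le _ _
      _ = 3 := by norm_num
  · rintro w ⟨hwA, hwB⟩
    rw [two_le_encard_iff, two_le_encard_iff]
    rcases h.mem_left_iff.1 hwA with hwP | ⟨rfl, a, ha, b, hb, hab, hwa, hwb⟩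
    · obtain ⟨c, hc, d, hd, hcd, hwc, hwd⟩ := h.exists_two_adj hwP
      refine ⟨⟨c, ⟨hwc, Or.inl hc⟩, d, ⟨hwd, Or.inl hd⟩, hcd⟩, ?_⟩
      rcases h.mem_right_iff.1 hwB with hwP' | ⟨-, a, ha, b, hb, hab, hwa, hwb⟩
      · exact absurd hwP hwP'
      · exact ⟨a, ⟨hwa, Or.inl ha⟩, b, ⟨hwb, Or.inl hb⟩, hab⟩
    · obtain ⟨n, n', hn, hn', hne, hvn, hvn'⟩ := h.two
      exact ⟨⟨a, ⟨hwa, Or.inl ha⟩, b, ⟨hwb, Or.inl hb⟩, hab⟩,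
        ⟨n, ⟨hvn, Or.inl hn⟩, n', ⟨hvn', Or.inl hn'⟩, hne⟩⟩

lemma isNontrivial (hG : IsKConnected 3 G) : IsNontrivial G (cutSide G P) (cutSide G Pᶜ) := by
  refine (h.isTriSeparation hG).isNontrivial hG ?_ ?_
  · exact two_le_encard_iff.2 ⟨x₀, Or.inl h.x₀P, x₁, Or.inl h.x₁P, h.x₀_ne_x₁⟩
  · obtain ⟨n, n', hn, hn', hne, -⟩ := h.two
    exact two_le_encard_iff.2 ⟨n, Or.inl hn, n', Or.inl hn', hne⟩

/-- Here `D` is contained in `P + v`. If `v` is in `D`, its two neighbours in `D` are in `P`, which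
is what puts `v` into the left side. -/
lemma nested_of_outer (hCD : IsTriSeparation G C D) (hvC : v ∈ C)
    (hq : ∀ w, w ∉ P → w ≠ v → w ∉ D) (h0 : x₀ ∈ cutSide G Pᶜ → x₀ ∈ C)
    (h1 : x₁ ∈ cutSide G Pᶜ → x₁ ∈ C) : Nested (cutSide G P) (cutSide G Pᶜ) C D := by
  refine Or.inr (Or.inl ⟨?_, ?_⟩)
  · intro w hw
    rcases h.mem_right_iff.1 hw with hwP | ⟨rfl | rfl, -⟩
    · by_cases hwv : w = v
      · rwa [hwv]
      · exact (hCD.1.mem_or w).resolve_right (hq w hwP hwv)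
    · exact h0 hw
    · exact h1 hw
  · intro w hw
    by_cases hwP : w ∈ P
    · exact Or.inl hwP
    have hwv : w = v := by
      by_contra h'
      exact hq w hwP h' hw
    subst hwv
    obtain ⟨a, ⟨hwa, ha⟩, b, ⟨hwb, hb⟩, hab⟩ := two_le_encard_iff.1 (hCD.2.2 w ⟨hvC, hw⟩).2
    refine Or.inr ⟨a, ?_, b, ?_, hab, hwa, hwb⟩
    · by_contra h'
      exact hq a h' hwa.ne' ha
    · by_contra h'
      exact hq b h' hwb.ne' hb

/-- Each end of `P` has a neighbour outside `P + v`, and this neighbour is in `C \ D`. An end in `D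
\ C` would make the edge between them an outer separator element. -/
lemma nested_of_outer_of_forall_notMem (hG : IsKConnected 3 G) (hCD : IsTriSeparation G C D)
    (hvC : v ∈ C) (hnone : ∀ e ∈ sep G C D, e ∉ outer P v)
    (hq : ∀ w, w ∉ P → w ≠ v → w ∉ D) : Nested (cutSide G P) (cutSide G Pᶜ) C D := by
  have key : ∀ x, x ≠ v → (∃ q, q ∉ P ∧ q ≠ v ∧ G.Adj x q) → x ∈ C := by
    rintro x hxv ⟨q, hqP, hqv, hxq⟩
    by_contra hxC
    have hxD := (hCD.1.mem_or x).resolve_left hxC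
    have hqD := hq q hqP hqv
    have hqC := (hCD.1.mem_or q).resolve_right hqD
    exact hnone (Sum.inr s(x, q)) (inr_mem_sep.2 ⟨hxq, Or.inr ⟨hqC, hqD, hxD, hxC⟩⟩)
      (inr_mem_outer.2 ⟨Or.inr hqP, hxv, hqv⟩)
  exact h.nested_of_outer hCD hvC hq (fun _ => key x₀ h.x₀_ne_v (h.exists_adj_outer_left hG))
    (fun _ => key x₁ h.x₁_ne_v (h.exists_adj_outer_right hG))

/-- An inner vertex of `P` in the separator needs a neighbour in `C \ D`, but all its neighbours are
in `P + v`. -/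
lemma eq_end_of_mem_left (hG : IsKConnected 3 G) (hCD : IsTriSeparation G C D) (hPD : P ⊆ D)
    (hv : ∀ p ∈ P, p ≠ x₀ → p ≠ x₁ → p ∈ C → G.Adj p v → v ∈ D) {p : V} (hp : p ∈ P)
    (hpC : p ∈ C) : p = x₀ ∨ p = x₁ := by
  by_contra hcon
  push Not at hcon
  obtain ⟨g, hgC, hgD, hpg⟩ := hG.exists_adj_left hCD.1 hCD.encard_sep hpC (hPD hp)
  by_cases hgv : g = v
  · subst hgv
    exact hgD (hv p hp hcon.1 hcon.2 hpC hpg)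
  · exact hgD (hPD (h.mem_of_adj_inner hp hcon.1 hcon.2 hpg hgv))

lemma nested_of_centre_mem_of_subset (hG : IsKConnected 3 G) (hCD : IsTriSeparation G C D)
    (hvC : v ∈ C) (hvD : v ∈ D) (hPD : P ⊆ D) : Nested (cutSide G P) (cutSide G Pᶜ) C D := by
  have hends : ∀ p ∈ P, p ∈ C → p = x₀ ∨ p = x₁ := fun p hp hpC =>
    h.eq_end_of_mem_left hG hCD hPD (fun _ _ _ _ _ _ => hvD) hp hpC
  by_cases hCB : C ⊆ cutSide G Pᶜ
  · refine Or.inr (Or.inr (Or.inl ⟨?_, hCB⟩))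
    intro w hw
    rcases h.mem_left_iff.1 hw with hwP | ⟨rfl, -⟩
    · exact hPD hwP
    · exact hvD
  · obtain ⟨c, hcC, hcB⟩ := Set.not_subset.1 hCB
    obtain ⟨h0C, h1C⟩ := ends_mem_of_not_mem_right hCD (fun p hp hpC _ => hends p hp hpC)
      (fun p hp _ => hPD hp) hcC hcB
    -- The vertices `v`, `x₀` and `x₁` already use up the separator.
    have hnone : ∀ e ∈ sep G C D, e ∉ outer P v := by
      intro e he heo
      refine not_four_of_encard_eq_three hCD.encard_sep (inl_mem_sep.2 ⟨hvC, hvD⟩)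
        (inl_mem_sep.2 ⟨h0C, hPD h.x₀P⟩) (inl_mem_sep.2 ⟨h1C, hPD h.x₁P⟩) he ?_ ?_ ?_ ?_ ?_ ?_
      · simpa using h.x₀_ne_v.symm
      · simpa using h.x₁_ne_v.symm
      · rintro rfl
        simp at heo
      · simpa using h.x₀_ne_x₁
      · rintro rfl
        simp [h.x₀P] at heo
      · rintro rfl
        simp [h.x₁P] at heo
    rcases h.outer_subset_side hG hCD.1 hnone with hq | hq
    · exact h.nested_of_outer_of_forall_notMem hG hCD hvC hnone hq
    · obtain ⟨g, hgC, hgD⟩ := hCD.1.2.1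
      exact absurd hgC (hq g (fun e => hgD (hPD e)) (fun e => hgD (e ▸ hvD)))

/-- Unless `P` lies in one side, unsplitness gives two separator elements inside `P`; the third is
`v`, so nothing is left for the outside. -/
lemma nested_of_centre_mem (hG : IsKConnected 3 G) (hCD : IsTriSeparation G C D)
    (hvC : v ∈ C) (hvD : v ∈ D) : Nested (cutSide G P) (cutSide G Pᶜ) C D := by
  by_cases hPD : P ⊆ D
  · exact h.nested_of_centre_mem_of_subset hG hCD hvC hvD hPD
  by_cases hPC : P ⊆ C
  · exact (h.nested_of_centre_mem_of_subset hG hCD.symm hvD hvC hPC).swap_right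
  obtain ⟨a, ha, haD⟩ := Set.not_subset.1 hPD
  obtain ⟨b, hb, hbC⟩ := Set.not_subset.1 hPC
  have h2 := h.unsplit C D (fun w _ => hCD.1.mem_or w) ⟨a, ha, haD⟩ ⟨b, hb, hbC⟩
  obtain ⟨i, j, k, hi, hj, hk, hijk⟩ := exists_counts hCD.encard_sep h.vP
  have hk1 : 1 ≤ k := by
    have : 1 ≤ (sep G C D ∩ atVertex v).encard := by
      rw [Set.one_le_encard_iff_nonempty]
      exact ⟨Sum.inl v, inl_mem_sep.2 ⟨hvC, hvD⟩, by simp⟩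
    rw [hk] at this
    exact_mod_cast this
  have hi2 : 2 ≤ i := by rw [hi] at h2; exact_mod_cast h2
  have hj0 : j = 0 := by omega
  have hnone : ∀ e ∈ sep G C D, e ∉ outer P v := by
    intro e he heo
    rw [hj0] at hj
    have : sep G C D ∩ outer P v = ∅ := by simpa using hj
    exact (this ▸ (⟨he, heo⟩ : e ∈ sep G C D ∩ outer P v) : e ∈ (∅ : Set _))
  rcases h.outer_subset_side hG hCD.1 hnone with hq | hq
  · exact h.nested_of_outer_of_forall_notMem hG hCD hvC hnone hq
  · exact (h.nested_of_outer_of_forall_notMem hG hCD.symm hvD (by rwa [sep_comm]) hq).swap_right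

/-- The case of an atomic strict side `{v}`. -/
lemma nested_of_side_eq_centre (hG : IsKConnected 3 G) (hCD : IsTriSeparation G C D)
    (hvC : v ∈ C) (hvD : v ∉ D) (hγ : ∀ g, g ∈ C → g ∉ D → g = v) :
    Nested (cutSide G P) (cutSide G Pᶜ) C D := by
  have hD : ∀ w, w ≠ v → w ∈ D := by
    intro w hw
    by_contra h'
    exact hw (hγ w ((hCD.1.mem_or w).resolve_right h') h')
  have hT : ∀ w, w ∈ C → w ≠ v → G.Adj w v := by
    intro w hw hwv
    obtain ⟨g, hgC, hgD, hwg⟩ := hG.exists_adj_left hCD.1 hCD.encard_sep hw (hD w hwv)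
    rwa [hγ g hgC hgD] at hwg
  -- Each neighbour of `v` accounts for its own separator element, either itself or its edge to `v`.
  -- Two neighbours in `P` and two outside would make four.
  have hvA : v ∉ cutSide G P := by
    intro hvA
    rcases h.mem_left_iff.1 hvA with h' | ⟨-, a, ha, b, hb, hab, hva, hvb⟩
    · exact h.vP h'
    obtain ⟨n, n', hn, hn', hne, hvn, hvn'⟩ := h.two
    have key : ∀ w, G.Adj v w → ∃ e ∈ sep G C D, e = Sum.inl w ∨ e = Sum.inr s(v, w) := by
      intro w hvw
      have hwD := hD w hvw.ne'
      by_cases hwC : w ∈ C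
      · exact ⟨Sum.inl w, inl_mem_sep.2 ⟨hwC, hwD⟩, Or.inl rfl⟩
      · exact ⟨Sum.inr s(v, w), inr_mem_sep.2 ⟨hvw, Or.inl ⟨hvC, hvD, hwD, hwC⟩⟩, Or.inr rfl⟩
    have hdist : ∀ w w' (e e' : V ⊕ Sym2 V), w ≠ w' → (e = Sum.inl w ∨ e = Sum.inr s(v, w)) →
        (e' = Sum.inl w' ∨ e' = Sum.inr s(v, w')) → e ≠ e' := by
      rintro w w' e e' hw (rfl | rfl) (rfl | rfl) he
      · exact hw (Sum.inl_injective he)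
      · cases he
      · cases he
      · rw [Sum.inr.injEq, Sym2.congr_right] at he
        exact hw he
    obtain ⟨e1, he1, hh1⟩ := key a hva
    obtain ⟨e2, he2, hh2⟩ := key b hvb
    obtain ⟨e3, he3, hh3⟩ := key n hvn
    obtain ⟨e4, he4, hh4⟩ := key n' hvn'
    have hP : ∀ a n, a ∈ P → n ∉ P → a ≠ n := fun a n ha hn e => hn (e ▸ ha)
    exact not_four_of_encard_eq_three hCD.encard_sep he1 he2 he3 he4
      (hdist _ _ _ _ hab hh1 hh2) (hdist _ _ _ _ (hP _ _ ha hn) hh1 hh3)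
      (hdist _ _ _ _ (hP _ _ ha hn') hh1 hh4) (hdist _ _ _ _ (hP _ _ hb hn) hh2 hh3)
      (hdist _ _ _ _ (hP _ _ hb hn') hh2 hh4) (hdist _ _ _ _ hne hh3 hh4)
  refine Or.inr (Or.inr (Or.inl ⟨?_, ?_⟩))
  · intro w hw
    rcases h.mem_left_iff.1 hw with hwP | ⟨rfl, -⟩
    · exact hD w (fun e => h.vP (e ▸ hwP))
    · exact absurd hw hvA
  · intro c hc
    by_cases hcP : c ∈ P
    · have hcv : c ≠ v := fun e => h.vP (e ▸ hcP)
      have hcv' := hT c hc hcv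
      have hq : ∀ q, q ∉ P → q ≠ v → G.Adj c q → c ∈ cutSide G Pᶜ := fun q hqP hqv hcq =>
        Or.inr ⟨q, hqP, v, h.vP, hqv, hcq, hcv'⟩
      by_cases hc0 : c = x₀
      · obtain ⟨q, hqP, hqv, hq'⟩ := h.exists_adj_outer_left hG
        exact hq q hqP hqv (hc0 ▸ hq')
      by_cases hc1 : c = x₁
      · obtain ⟨q, hqP, hqv, hq'⟩ := h.exists_adj_outer_right hG
        exact hq q hqP hqv (hc1 ▸ hq')
      -- An inner `c` in `C ∩ D` has a second neighbour `d` in `C`, which lies in `P`; both are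
      -- adjacent to `v`, which would put `v` into the left side.
      exfalso
      obtain ⟨a, ⟨hca, ha⟩, b, ⟨hcb, hb⟩, hab⟩ :=
        two_le_encard_iff.1 (hCD.2.2 c ⟨hc, hD c hcv⟩).1
      have : ∃ d ∈ C, d ≠ v ∧ G.Adj c d := by
        by_cases hav : a = v
        · exact ⟨b, hb, fun e => hab (hav.trans e.symm), hcb⟩
        · exact ⟨a, ha, hav, hca⟩
      obtain ⟨d, hdC, hdv, hcd⟩ := this
      have hdP := h.mem_of_adj_inner hcP hc0 hc1 hcd hdv
      exact hvA (Or.inr ⟨c, hcP, d, hdP, hcd.ne, hcv'.symm, (hT d hdC hdv).symm⟩)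
    · exact Or.inl hcP

/-- All vertices outside `P` are in `C` by `mem_left_of_outer`. One of them other than `v` in `D`
would need two neighbours in `D`, both in `P`, which `not_adj_both` forbids. An end of `P` that is
in the right side but not in `C` would send two outer edges across. -/
lemma nested_of_outer_le_one (hG : IsKConnected 3 G) (hCD : IsTriSeparation G C D)
    (hvC : v ∈ C) (hvD : v ∉ D)
    (hone : ∀ e ∈ sep G C D ∩ outer P v, ∀ e' ∈ sep G C D ∩ outer P v, e = e')
    (hvn : ∀ d, G.Adj v d → d ∉ C → d ∈ P ∧ d ≠ x₀ ∧ d ≠ x₁) :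
    Nested (cutSide G P) (cutSide G Pᶜ) C D := by
  have hC : ∀ w, w ∉ P → w ∈ C := fun w hw =>
    h.mem_left_of_outer hG hCD.1 hvC hone
      (fun n hn hvn' => by
        by_contra h'
        exact hn (hvn n hvn' h').1) h.two hw
  have hq : ∀ w, w ∉ P → w ≠ v → w ∉ D := by
    intro w hwP hwv hwD
    have hwC := hC w hwP
    obtain ⟨a, ⟨hwa, ha⟩, b, ⟨hwb, hb⟩, hab⟩ := two_le_encard_iff.1 (hCD.2.2 w ⟨hwC, hwD⟩).2
    have key : ∀ d, G.Adj w d → d ∈ D → d ∈ P := by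
      intro d hwd hdD
      by_contra hdP
      have hdv : d ≠ v := fun e => hvD (e ▸ hdD)
      have := hone (Sum.inl w) ⟨inl_mem_sep.2 ⟨hwC, hwD⟩, inl_mem_outer.2 ⟨hwP, hwv⟩⟩
        (Sum.inl d) ⟨inl_mem_sep.2 ⟨hC d hdP, hdD⟩, inl_mem_outer.2 ⟨hdP, hdv⟩⟩
      exact hwd.ne (Sum.inl_injective this)
    exact hab (h.not_adj_both hwP hwv hwa (key a hwa ha) hwb (key b hwb hb))
  have hend : ∀ x, x = x₀ ∨ x = x₁ → x ∈ cutSide G Pᶜ → x ∈ C := by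
    intro x hx hxB
    by_contra hxC
    have hxP : x ∈ P := by rcases hx with rfl | rfl; exacts [h.x₀P, h.x₁P]
    have hxv : x ≠ v := fun e => h.vP (e ▸ hxP)
    rcases h.mem_right_iff.1 hxB with h' | ⟨-, a, ha, b, hb, hab, hxa, hxb⟩
    · exact h' hxP
    have hxD := (hCD.1.mem_or x).resolve_left hxC
    have key : ∀ d, G.Adj x d → d ∉ P → Sum.inr s(x, d) ∈ sep G C D ∩ outer P v := by
      intro d hxd hdP
      have hdv : d ≠ v := by
        rintro rfl
        have := hvn x hxd.symm hxC
        tauto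
      exact ⟨inr_mem_sep.2 ⟨hxd, Or.inr ⟨hC d hdP, hq d hdP hdv, hxD, hxC⟩⟩,
        inr_mem_outer.2 ⟨Or.inr hdP, hxv, hdv⟩⟩
    have := hone _ (key a hxa ha) _ (key b hxb hb)
    rw [Sum.inr.injEq, Sym2.congr_right] at this
    exact hab this
  exact h.nested_of_outer hCD hvC hq (hend x₀ (Or.inl rfl)) (hend x₁ (Or.inr rfl))

/-- One element is left to spend. If `v` has an edge to `D \ C`, that edge is the third element and
the outside is on one side; it cannot be the side of `D`, because separator edges form a matching
seen from `C \ D`. Otherwise at most one element is outer. -/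
lemma nested_of_two_le_inside (hG : IsKConnected 3 G) (hCD : IsTriSeparation G C D)
    (hvC : v ∈ C) (hvD : v ∉ D) (hγ : ∃ g, g ∈ C ∧ g ∉ D ∧ g ≠ v)
    (h2 : 2 ≤ (sep G C D ∩ inside P).encard) : Nested (cutSide G P) (cutSide G Pᶜ) C D := by
  obtain ⟨i, j, k, hi, hj, hk, hijk⟩ := exists_counts hCD.encard_sep h.vP
  have hi2 : 2 ≤ i := by rw [hi] at h2; exact_mod_cast h2
  by_cases hd : ∃ d, G.Adj v d ∧ d ∉ C
  · obtain ⟨d, hvd, hdC⟩ := hd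
    have hdD := (hCD.1.mem_or d).resolve_left hdC
    have hk1 : 1 ≤ k := by
      have : 1 ≤ (sep G C D ∩ atVertex v).encard := by
        rw [Set.one_le_encard_iff_nonempty]
        exact ⟨Sum.inr s(v, d), inr_mem_sep.2 ⟨hvd, Or.inl ⟨hvC, hvD, hdD, hdC⟩⟩, by simp⟩
      rw [hk] at this
      exact_mod_cast this
    have hj0 : j = 0 := by omega
    have hnone : ∀ e ∈ sep G C D, e ∉ outer P v := by
      intro e he heo
      rw [hj0] at hj
      have : sep G C D ∩ outer P v = ∅ := by simpa using hj
      exact (this ▸ (⟨he, heo⟩ : e ∈ sep G C D ∩ outer P v) : e ∈ (∅ : Set _))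
    rcases h.outer_subset_side hG hCD.1 hnone with hq | hq
    · exact h.nested_of_outer_of_forall_notMem hG hCD hvC hnone hq
    · exfalso
      obtain ⟨n, n', hn, hn', hne, hvn, hvn'⟩ := h.two
      obtain ⟨g, hgC, hgD, hgv⟩ := hγ
      exact hne (hG.eq_of_adj_of_adj hCD.1 hCD.encard_sep hvC hvD hgC hgD hgv
        (hq n hn hvn.ne') (hq n' hn' hvn'.ne') hvn hvn')
  · push Not at hd
    refine h.nested_of_outer_le_one hG hCD hvC hvD ?_ (fun d hvd hdC => absurd (hd d hvd) hdC)
    have : (sep G C D ∩ outer P v).encard ≤ 1 := by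
      rw [hj]
      have : j ≤ 1 := by omega
      exact_mod_cast this
    exact fun e he e' he' => Set.encard_le_one_iff.1 this e e' he he'

/-- If an inner neighbour of `v` is in `C`, it and a further neighbour in `P ∩ C` are two inside
elements. Otherwise `v` has exactly one neighbour `p` in `D \ C`, an inner vertex of `P`, and the
remaining question is whether `C` fits into the right side. If it does not, both ends of `P` are in
the separator; if it does but `v` is in the left side, the edge `vp` and a separator vertex in `P`
leave at most one outer element. -/
lemma nested_of_subset_right (hG : IsKConnected 3 G) (hCD : IsTriSeparation G C D)
    (hvC : v ∈ C) (hvD : v ∉ D) (hγ : ∃ g, g ∈ C ∧ g ∉ D ∧ g ≠ v) (hPD : P ⊆ D) :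
    Nested (cutSide G P) (cutSide G Pᶜ) C D := by
  by_cases hp : ∃ p ∈ P, p ≠ x₀ ∧ p ≠ x₁ ∧ p ∈ C ∧ G.Adj p v
  · obtain ⟨p, hpP, hp0, hp1, hpC, hpv⟩ := hp
    obtain ⟨a, ⟨hpa, ha⟩, b, ⟨hpb, hb⟩, hab⟩ := two_le_encard_iff.1 (hCD.2.2 p ⟨hpC, hPD hpP⟩).1
    have : ∃ d ∈ C, d ≠ v ∧ G.Adj p d := by
      by_cases hav : a = v
      · exact ⟨b, hb, fun e => hab (hav.trans e.symm), hpb⟩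
      · exact ⟨a, ha, hav, hpa⟩
    obtain ⟨d, hdC, hdv, hpd⟩ := this
    have hdP := h.mem_of_adj_inner hpP hp0 hp1 hpd hdv
    exact h.nested_of_two_le_inside hG hCD hvC hvD hγ
      (two_le_inside_of_mem hpP hdP hpd.ne hpC (hPD hpP) hdC (hPD hdP))
  push Not at hp
  obtain ⟨p₀, hp₀, hp₀0, hp₀1⟩ := h.inner
  obtain ⟨p, hpP, hp0, hp1, hvp⟩ := h.exists_adj_inner hG hp₀ hp₀0 hp₀1
  have hpC : p ∉ C := fun h' => hp p hpP hp0 hp1 h' hvp.symm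
  have huniq : ∀ d, G.Adj v d → d ∉ C → d = p := by
    intro d hvd hdC
    obtain ⟨g, hgC, hgD, hgv⟩ := hγ
    exact hG.eq_of_adj_of_adj hCD.1 hCD.encard_sep hvC hvD hgC hgD hgv hdC hpC hvd hvp
  have hends : ∀ p ∈ P, p ∈ C → p = x₀ ∨ p = x₁ := fun q hq hqC =>
    h.eq_end_of_mem_left hG hCD hPD (fun r hr hr0 hr1 hrC hrv => absurd hrv (hp r hr hr0 hr1 hrC))
      hq hqC
  by_cases hCB : C ⊆ cutSide G Pᶜ
  · by_cases hvA : v ∈ cutSide G P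
    · rcases h.mem_left_iff.1 hvA with h' | ⟨-, a, ha, b, hb, hab, hva, hvb⟩
      · exact absurd h' h.vP
      have : ∃ q ∈ P, G.Adj v q ∧ q ∈ C := by
        by_contra h'
        push Not at h'
        exact hab ((huniq a hva (h' a ha hva)).trans (huniq b hvb (h' b hb hvb)).symm)
      obtain ⟨q, hqP, hvq, hqC⟩ := this
      obtain ⟨i, j, k, hi, hj, hk, hijk⟩ := exists_counts hCD.encard_sep h.vP
      have hi1 : 1 ≤ i := by
        have : 1 ≤ (sep G C D ∩ inside P).encard := by
          rw [Set.one_le_encard_iff_nonempty]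
          exact ⟨Sum.inl q, inl_mem_sep.2 ⟨hqC, hPD hqP⟩, inl_mem_inside.2 hqP⟩
        rw [hi] at this
        exact_mod_cast this
      have hk1 : 1 ≤ k := by
        have : 1 ≤ (sep G C D ∩ atVertex v).encard := by
          rw [Set.one_le_encard_iff_nonempty]
          exact ⟨Sum.inr s(v, p), inr_mem_sep.2 ⟨hvp, Or.inl ⟨hvC, hvD, hPD hpP, hpC⟩⟩, by simp⟩
        rw [hk] at this
        exact_mod_cast this
      refine h.nested_of_outer_le_one hG hCD hvC hvD ?_ ?_
      · have : (sep G C D ∩ outer P v).encard ≤ 1 := by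
          rw [hj]
          have : j ≤ 1 := by omega
          exact_mod_cast this
        exact fun e he e' he' => Set.encard_le_one_iff.1 this e e' he he'
      · intro d hvd hdC
        rw [huniq d hvd hdC]
        exact ⟨hpP, hp0, hp1⟩
    · refine Or.inr (Or.inr (Or.inl ⟨?_, hCB⟩))
      intro w hw
      rcases h.mem_left_iff.1 hw with hwP | ⟨rfl, -⟩
      · exact hPD hwP
      · exact absurd hw hvA
  · obtain ⟨c, hcC, hcB⟩ := Set.not_subset.1 hCB
    obtain ⟨h0C, h1C⟩ := ends_mem_of_not_mem_right hCD (fun p hp hpC _ => hends p hp hpC)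
      (fun p hp _ => hPD hp) hcC hcB
    exact h.nested_of_two_le_inside hG hCD hvC hvD hγ
      (two_le_inside_of_mem h.x₀P h.x₁P h.x₀_ne_x₁ h0C (hPD h.x₀P) h1C (hPD h.x₁P))

/-- Now only the ends of `P` can be in `D`. If `D` does not fit into the right side, both of them
are, and they are two inside elements. -/
lemma nested_of_subset_left (hG : IsKConnected 3 G) (hCD : IsTriSeparation G C D)
    (hvC : v ∈ C) (hvD : v ∉ D) (hγ : ∃ g, g ∈ C ∧ g ∉ D ∧ g ≠ v) (hPC : P ⊆ C) :
    Nested (cutSide G P) (cutSide G Pᶜ) C D := by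
  have hends : ∀ p ∈ P, p ∈ D → p = x₀ ∨ p = x₁ := by
    intro p hp hpD
    by_contra hcon
    push Not at hcon
    obtain ⟨g, hgD, hgC, hpg⟩ := hG.exists_adj_right hCD.1 hCD.encard_sep (hPC hp) hpD
    exact hgC (hPC (h.mem_of_adj_inner hp hcon.1 hcon.2 hpg (fun e => hgC (e ▸ hvC))))
  by_cases hDB : D ⊆ cutSide G Pᶜ
  · refine Or.inl ⟨?_, hDB⟩
    intro w hw
    rcases h.mem_left_iff.1 hw with hwP | ⟨rfl, -⟩
    · exact hPC hwP
    · exact hvC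
  · obtain ⟨c, hcD, hcB⟩ := Set.not_subset.1 hDB
    obtain ⟨h0D, h1D⟩ := ends_mem_of_not_mem_right hCD.symm (fun p hp hpD _ => hends p hp hpD)
      (fun p hp _ => hPC hp) hcD hcB
    exact h.nested_of_two_le_inside hG hCD hvC hvD hγ
      (two_le_inside_of_mem h.x₀P h.x₁P h.x₀_ne_x₁ (hPC h.x₀P) h0D (hPC h.x₁P) h1D)

lemma nested_of_centre_mem_left (hG : IsKConnected 3 G) (hCD : IsTriSeparation G C D)
    (hvC : v ∈ C) (hvD : v ∉ D) : Nested (cutSide G P) (cutSide G Pᶜ) C D := by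
  by_cases hγ : ∃ g, g ∈ C ∧ g ∉ D ∧ g ≠ v
  · by_cases hPD : P ⊆ D
    · exact h.nested_of_subset_right hG hCD hvC hvD hγ hPD
    by_cases hPC : P ⊆ C
    · exact h.nested_of_subset_left hG hCD hvC hvD hγ hPC
    obtain ⟨a, ha, haD⟩ := Set.not_subset.1 hPD
    obtain ⟨b, hb, hbC⟩ := Set.not_subset.1 hPC
    exact h.nested_of_two_le_inside hG hCD hvC hvD hγ
      (h.unsplit C D (fun w _ => hCD.1.mem_or w) ⟨a, ha, haD⟩ ⟨b, hb, hbC⟩)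
  · push Not at hγ
    exact h.nested_of_side_eq_centre hG hCD hvC hvD hγ

theorem hasTotallyNestedNontrivial (hG : IsKConnected 3 G) : HasTotallyNestedNontrivial G := by
  refine ⟨_, _, h.isTriSeparation hG, h.isNontrivial hG, fun C D hCD => ?_⟩
  by_cases hvC : v ∈ C
  · by_cases hvD : v ∈ D
    · exact h.nested_of_centre_mem hG hCD hvC hvD
    · exact h.nested_of_centre_mem_left hG hCD hvC hvD
  · have hvD := (hCD.1.mem_or v).resolve_left hvC
    exact (h.nested_of_centre_mem_left hG hCD.symm hvD hvC).swap_right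

end IsGoodNecklace

/-! ### Path-like bags and the subdivision of necklaces. -/

/-- The graph induced on `P` looks like a finite path from `x₀` to `x₁`, as far as degrees are
concerned. -/
structure IsPathLike (G : SimpleGraph V) (P : Set V) (x₀ x₁ : V) : Prop where
  finite : P.Finite
  left : (G.neighborSet x₀ ∩ P).encard ≤ 1
  right : (G.neighborSet x₁ ∩ P).encard ≤ 1
  two : ∀ w ∈ P, (G.neighborSet w ∩ P).encard ≤ 2

lemma isPathLike_pair (G : SimpleGraph V) (x₀ x₁ : V) : IsPathLike G {x₀, x₁} x₀ x₁ where
  finite := by simp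
  left := by
    rw [Set.encard_le_one_iff]
    rintro a b ⟨ha, rfl | rfl⟩ ⟨hb, rfl | rfl⟩
    · rfl
    · exact absurd ha (G.irrefl)
    · exact absurd hb (G.irrefl)
    · rfl
  right := by
    rw [Set.encard_le_one_iff]
    rintro a b ⟨ha, rfl | rfl⟩ ⟨hb, rfl | rfl⟩
    · rfl
    · exact absurd hb (G.irrefl)
    · exact absurd ha (G.irrefl)
    · rfl
  two w _ := (Set.encard_le_encard Set.inter_subset_right).trans (encard_pair_le _ _)

lemma encard_union_le_two {α : Type*} {s t : Set α} (hs : s.encard ≤ 1) (ht : t.encard ≤ 1) :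
    (s ∪ t).encard ≤ 2 :=
  (Set.encard_union_le s t).trans (by simpa [one_add_one_eq_two] using add_le_add hs ht)

namespace IsSplit

variable {P P₁ P₂ : Set V} {x₀ x₁ z : V}

lemma isPathLike (h : IsSplit G P x₀ x₁ z P₁ P₂) (h₁ : IsPathLike G P₁ x₀ z)
    (h₂ : IsPathLike G P₂ z x₁) : IsPathLike G P x₀ x₁ := by
  have key₁ : ∀ w ∈ P₁, w ≠ z → G.neighborSet w ∩ P ⊆ G.neighborSet w ∩ P₁ := by
    rintro w hw hwz b ⟨hwb, hb⟩
    refine ⟨hwb, ?_⟩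
    rcases h.edge w b ((h.mem_iff w).2 (Or.inl hw)) hb hwb with h' | h'
    · exact h'.2
    · exact absurd (h.inter w hw h'.1) hwz
  have key₂ : ∀ w ∈ P₂, w ≠ z → G.neighborSet w ∩ P ⊆ G.neighborSet w ∩ P₂ := by
    rintro w hw hwz b ⟨hwb, hb⟩
    refine ⟨hwb, ?_⟩
    rcases h.edge w b ((h.mem_iff w).2 (Or.inr hw)) hb hwb with h' | h'
    · exact absurd (h.inter w h'.1 hw) hwz
    · exact h'.2
  have hP : P = P₁ ∪ P₂ := Set.ext h.mem_iff
  refine ⟨hP ▸ h₁.finite.union h₂.finite,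
    (Set.encard_le_encard (key₁ _ h.mem₀ h.ne₀.symm)).trans h₁.left,
    (Set.encard_le_encard (key₂ _ h.mem₁ h.ne₁.symm)).trans h₂.right, fun w hw => ?_⟩
  by_cases hwz : w = z
  · subst hwz
    rw [hP, Set.inter_union_distrib_left]
    exact encard_union_le_two h₁.right h₂.left
  · rcases (h.mem_iff w).1 hw with h' | h'
    · exact (Set.encard_le_encard (key₁ _ h' hwz)).trans (h₁.two w h')
    · exact (Set.encard_le_encard (key₂ _ h' hwz)).trans (h₂.two w h')

/-- A walk in `P` from `P₁` to `P₂` passes through `z`; the initial segment up to the first visit is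
taken. The strict inequality makes the recursion over bags terminate, even in infinite graphs. -/
lemma exists_walk (h : IsSplit G P x₀ x₁ z P₁ P₂) {a b : V} (p : G.Walk a b)
    (hp : ∀ w ∈ p.support, w ∈ P) (ha : a ∈ P₁) (hb : b ∈ P₂) :
    ∃ q : G.Walk a z, (∀ w ∈ q.support, w ∈ P₁) ∧ q.length ≤ p.length ∧
      (b ≠ z → q.length < p.length) := by
  induction p with
  | nil =>
    obtain rfl := h.inter _ ha hb
    exact ⟨.nil, by simpa using ha, le_rfl, fun h => absurd rfl h⟩
  | @cons a c b hac p ih =>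
    by_cases haz : a = z
    · subst haz
      exact ⟨.nil, by simpa using ha, by simp, by simp⟩
    · have hcP : c ∈ P := hp c (by simp)
      have hc : c ∈ P₁ := by
        rcases h.edge a c ((h.mem_iff a).2 (Or.inl ha)) hcP hac with h' | h'
        · exact h'.2
        · exact absurd (h.inter a ha h'.1) haz
      obtain ⟨q, hq, hl, hl'⟩ := ih (fun w hw => hp w (by simp [hw])) hc hb
      refine ⟨.cons hac q, ?_, by simpa using hl, by simpa using hl'⟩
      intro w hw
      rw [SimpleGraph.Walk.support_cons, List.mem_cons] at hw
      rcases hw with rfl | hw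
      · exact ha
      · exact hq w hw

end IsSplit

namespace IsNecklace

variable {v x₀ x₁ x₂ x₃ : V} {P Q₁ Q₂ Q₃ P₁ P₂ : Set V} {z : V}

/-- The piece beyond `z` is merged into the neighbouring bag, so the number of bags stays four. -/
lemma split_left (h : IsNecklace G v P Q₁ Q₂ Q₃ x₀ x₁ x₂ x₃)
    (hs : IsSplit G P x₀ x₁ z P₁ P₂) : IsNecklace G v P₁ (P₂ ∪ Q₁) Q₂ Q₃ x₀ z x₂ x₃ where
  cover w hw := by have := h.cover w hw; have := hs.mem_iff w; simp only [Set.mem_union]; tauto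
  vP := fun h' => h.vP ((hs.mem_iff v).2 (Or.inl h'))
  vQ₁ := fun h' => h'.elim (fun h' => h.vP ((hs.mem_iff v).2 (Or.inr h'))) h.vQ₁
  vQ₂ := h.vQ₂
  vQ₃ := h.vQ₃
  x₀P := hs.mem₀
  x₁P := hs.z₁
  x₁Q₁ := Or.inl hs.z₂
  x₂Q₁ := Or.inr h.x₂Q₁
  x₂Q₂ := h.x₂Q₂
  x₃Q₂ := h.x₃Q₂
  x₃Q₃ := h.x₃Q₃
  x₀Q₃ := h.x₀Q₃
  inter₁ w h1 h2 := by
    rcases h2 with h2 | h2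
    · exact hs.inter w h1 h2
    · obtain rfl := h.inter₁ w ((hs.mem_iff w).2 (Or.inl h1)) h2
      exact hs.inter w h1 hs.mem₁
  inter₂ w h1 h2 := by
    rcases h1 with h1 | h1
    · exact absurd h2 (h.disj₀₂ w ((hs.mem_iff w).2 (Or.inr h1)))
    · exact h.inter₂ w h1 h2
  inter₃ := h.inter₃
  inter₀ w h1 h2 := h.inter₀ w h1 ((hs.mem_iff w).2 (Or.inl h2))
  disj₀₂ w h1 := h.disj₀₂ w ((hs.mem_iff w).2 (Or.inl h1))
  disj₁₃ w h1 h2 := by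
    rcases h1 with h1 | h1
    · obtain rfl := h.inter₀ w h2 ((hs.mem_iff w).2 (Or.inr h1))
      exact hs.ne₀ (hs.inter w hs.mem₀ h1).symm
    · exact h.disj₁₃ w h1 h2
  edge a b hab ha hb := by
    have h1 := hs.edge a b
    have := h.edge a b hab ha hb
    simp only [Set.mem_union]
    tauto

lemma split_right (h : IsNecklace G v P Q₁ Q₂ Q₃ x₀ x₁ x₂ x₃)
    (hs : IsSplit G P x₀ x₁ z P₁ P₂) : IsNecklace G v P₂ Q₁ Q₂ (P₁ ∪ Q₃) z x₁ x₂ x₃ :=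
  (h.reflect.split_left hs.symm).reflect

variable (h : IsNecklace G v P Q₁ Q₂ Q₃ x₀ x₁ x₂ x₃)
include h

lemma x₃_notMem : x₃ ∉ P := h.reflect.x₂_notMem

lemma x₃_ne_v : x₃ ≠ v := h.reflect.x₂_ne_v

/-- Otherwise the vertices of `P` reachable from `x₀`, together with `Q₃` without `x₃`, are cut off
by `v` and `x₃`. -/
lemma exists_walk (hG : IsKConnected 3 G) :
    ∃ p : G.Walk x₀ x₁, ∀ w ∈ p.support, w ∈ P := by
  by_contra hno
  let R : Set V := {w | ∃ p : G.Walk x₀ w, ∀ w ∈ p.support, w ∈ P}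
  have hRP : R ⊆ P := by
    rintro w ⟨p, hp⟩
    exact hp w (by simp)
  have h0R : x₀ ∈ R := ⟨.nil, by simpa using h.x₀P⟩
  have h1R : x₁ ∉ R := hno
  have hstep : ∀ a b, a ∈ R → b ∈ P → G.Adj a b → b ∈ R := by
    rintro a b ⟨p, hp⟩ hb hab
    refine ⟨p.concat hab, fun w hw => ?_⟩
    rw [SimpleGraph.Walk.support_concat, List.mem_append] at hw
    rcases hw with hw | hw
    · exact hp w hw
    · rw [List.mem_singleton.1 hw]
      exact hb
  have hx₃ : ∀ w ∈ P, w ≠ x₃ := fun w hw e => h.x₃_notMem (e ▸ hw)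
  refine hG.not_separated (R ∪ (Q₃ \ {x₃})) {Sum.inl v, Sum.inl x₃} (encard_pair_le _ _)
    (k := x₀) (Or.inl h0R) (by simp [h.x₀_ne_v, hx₃ _ h.x₀P]) (z := x₁) ?_
    (by simp [h.x₁_ne_v, hx₃ _ h.x₁P]) ?_
  · rintro (h' | h')
    · exact h1R h'
    · exact h.disj₁₃ x₁ h.x₁Q₁ h'.1
  · intro a b ha hb hab
    by_cases hbv : b = v
    · simp [hbv]
    by_cases hb3 : b = x₃
    · simp [hb3]
    exfalso
    have hbR : b ∉ R := fun h' => hb (Or.inl h')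
    have hbQ : b ∉ Q₃ := fun h' => hb (Or.inr ⟨h', hb3⟩)
    have hav : a ≠ v := by
      rintro rfl
      rcases ha with ha | ha
      · exact h.vP (hRP ha)
      · exact h.vQ₃ ha.1
    rcases h.edge a b hab hav hbv with h' | h' | h' | h'
    · rcases ha with ha | ha
      · exact hbR (hstep a b ha h'.2 hab)
      · obtain rfl := h.inter₀ a ha.1 h'.1
        exact hbR (hstep a b h0R h'.2 hab)
    · rcases ha with ha | ha
      · obtain rfl := h.inter₁ a (hRP ha) h'.1
        exact h1R ha
      · exact h.disj₁₃ a h'.1 ha.1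
    · rcases ha with ha | ha
      · exact h.disj₀₂ a (hRP ha) h'.1
      · exact ha.2 (h.inter₃ a h'.1 ha.1)
    · exact hbQ h'.2

/-- Otherwise `x₀` and `x₂` separate `x₃` from `v`. -/
lemma exists_adj_centre (hG : IsKConnected 3 G) : ∃ n, G.Adj v n ∧ n ∉ P ∧ n ∉ Q₁ := by
  by_contra hcon
  push Not at hcon
  refine hG.not_separated ((Q₂ ∪ Q₃) \ {x₀, x₂}) {Sum.inl x₀, Sum.inl x₂} (encard_pair_le _ _)
    (k := x₃) ⟨Or.inl h.x₃Q₂, ?_⟩ ?_ (z := v) ?_ ?_ ?_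
  · have := h.x₃_notMem
    have := h.x₀P
    have := h.disj₁₃ _ h.x₂Q₁
    have := h.x₃Q₃
    simp only [Set.mem_insert_iff, Set.mem_singleton_iff]
    grind
  · have := h.x₃_notMem
    have := h.x₀P
    have := h.disj₁₃ _ h.x₂Q₁
    have := h.x₃Q₃
    simp only [Set.mem_insert_iff, Set.mem_singleton_iff, Sum.inl.injEq]
    grind
  · exact fun h' => h'.1.elim h.vQ₂ h.vQ₃
  · simp [h.x₀_ne_v.symm, h.x₂_ne_v.symm]
  · rintro a b ⟨ha, ha'⟩ hb hab
    simp only [Set.mem_insert_iff, Set.mem_singleton_iff, not_or, Sum.inl.injEq] at ha' ⊢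
    by_contra hne
    push Not at hne
    have hb' : b ∉ Q₂ ∧ b ∉ Q₃ := by
      simp only [Set.mem_sdiff, Set.mem_union, Set.mem_insert_iff, Set.mem_singleton_iff] at hb
      tauto
    have hav : a ≠ v := by
      rintro rfl
      exact ha.elim h.vQ₂ h.vQ₃
    have haP : a ∉ P := fun e => ha.elim (h.disj₀₂ a e) fun e' => ha'.1 (h.inter₀ a e' e)
    have haQ : a ∉ Q₁ := fun e => ha.elim (fun e' => ha'.2 (h.inter₂ a e e')) (h.disj₁₃ a e)
    by_cases hbv : b = v
    · subst hbv
      exact haQ (hcon a hab.symm haP)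
    · have := h.edge a b hab hav hbv
      tauto

/-- If `v` sees nothing of `P₁` but possibly `z`, and `Q₃` has only its ends, then `x₃` and `z`
separate `x₀` from `v`. -/
lemma not_isSplit_of_adj (hG : IsKConnected 3 G)
    (h₃ : ∀ w ∈ Q₃, w = x₀ ∨ w = x₃) (hs : IsSplit G P x₀ x₁ z P₁ P₂)
    (hv : ∀ a ∈ P₁, G.Adj v a → a = z) : False := by
  have h' := h.split_left hs
  have hz3 : x₀ ≠ x₃ := fun e => h.x₃_notMem (e ▸ h.x₀P)
  refine hG.not_separated (P₁ \ {z}) {Sum.inl x₃, Sum.inl z} (encard_pair_le _ _)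
    (k := x₀) ⟨hs.mem₀, hs.ne₀.symm⟩ (by simp [hs.ne₀.symm, hz3]) (z := v)
    (fun e => h'.vP e.1) ?_ ?_
  · simp [h.x₃_ne_v.symm, h'.x₁_ne_v.symm]
  · rintro a b ⟨ha, haz⟩ hb hab
    simp only [Set.mem_insert_iff, Set.mem_singleton_iff, Sum.inl.injEq] at haz ⊢
    by_contra hne
    push Not at hne
    have hbP : b ∉ P₁ := fun e => hb ⟨e, hne.2.1.2⟩
    by_cases hbv : b = v
    · subst hbv
      exact haz (hv a ha hab.symm)
    · have hav : a ≠ v := fun e => h'.vP (e ▸ ha)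
      have := h'.edge a b hab hav hbv
      have := h'.disj₀₂ a ha
      have := h'.inter₁ a ha
      have h3 := h₃ b
      have : b ≠ x₀ := fun e => hbP (e ▸ hs.mem₀)
      tauto

lemma eq_end_of_forall_not_adj (hG : IsKConnected 3 G)
    (hv : ∀ a ∈ Q₁, a ∉ P → ¬ G.Adj v a) {w : V} (hw : w ∈ Q₁) : w = x₁ ∨ w = x₂ := by
  by_contra hcon
  rw [not_or] at hcon
  refine hG.not_separated (Q₁ \ {x₁, x₂}) {Sum.inl x₁, Sum.inl x₂} (encard_pair_le _ _)
    (k := w) ⟨hw, by simpa using hcon⟩ (by simpa using hcon) (z := v)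
    (fun e => h.vQ₁ e.1) (by simp [h.x₁_ne_v.symm, h.x₂_ne_v.symm]) ?_
  rintro a b ⟨ha, ha'⟩ hb hab
  simp only [Set.mem_insert_iff, Set.mem_singleton_iff, not_or, Sum.inl.injEq] at ha' ⊢
  have haP : a ∉ P := fun e => ha'.1 (h.inter₁ a e ha)
  have hav : a ≠ v := fun e => h.vQ₁ (e ▸ ha)
  have hbv : b ≠ v := fun e => hv a ha haP (e ▸ hab.symm)
  have := h.rotate.mem_of_adj_inner ha ha'.1 ha'.2 hab hbv
  simp only [Set.mem_sdiff, Set.mem_insert_iff, Set.mem_singleton_iff] at hb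
  tauto

/-- The bag `P` is good unless `v` has at most one neighbour outside it. In that case the neighbour
`n` is an inner vertex of `Q₂`, the bags `Q₁` and `Q₃` consist of their ends, and the opposite bag
`Q₂` is unsplit. As `v` has degree at least three and only `n` in `Q₂`, the bag `Q₂` is good. -/
lemma hasTotallyNestedNontrivial_of_unsplit (hG : IsKConnected 3 G) (hu : Unsplit G P)
    (hP : ∃ p ∈ P, p ≠ x₀ ∧ p ≠ x₁) : HasTotallyNestedNontrivial G := by
  by_cases htwo : ∃ n n', n ∉ P ∧ n' ∉ P ∧ n ≠ n' ∧ G.Adj v n ∧ G.Adj v n'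
  · exact IsGoodNecklace.hasTotallyNestedNontrivial ⟨h, hu, hP, htwo⟩ hG
  have hv : ∀ a b, a ∉ P → b ∉ P → G.Adj v a → G.Adj v b → a = b := by
    intro a b ha hb hva hvb
    by_contra hab
    exact htwo ⟨a, b, ha, hb, hab, hva, hvb⟩
  obtain ⟨n, hvn, hnP, hn1⟩ := h.exists_adj_centre hG
  obtain ⟨n', hvn', hnP', hn3⟩ := h.reflect.exists_adj_centre hG
  obtain rfl := hv n n' hnP hnP' hvn hvn'
  have hn2 : n ∈ Q₂ := by
    have := h.cover n hvn.ne'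
    tauto
  have hnx2 : n ≠ x₂ := fun e => hn1 (e ▸ h.x₂Q₁)
  have hnx3 : n ≠ x₃ := fun e => hn3 (e ▸ h.x₃Q₃)
  have hQ₁ : ∀ w ∈ Q₁, w = x₁ ∨ w = x₂ := fun w hw => h.eq_end_of_forall_not_adj hG
    (fun a ha haP hva => hn1 (hv a n haP hnP hva hvn ▸ ha)) hw
  have hQ₃ : ∀ w ∈ Q₃, w = x₀ ∨ w = x₃ := fun w hw => h.reflect.eq_end_of_forall_not_adj hG
    (fun a ha haP hva => hn3 (hv a n haP hnP hva hvn ▸ ha)) hw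
  have h' := h.rotate.rotate
  have hvQ : ∀ a ∈ Q₂, G.Adj v a → a = n := fun a ha hva =>
    hv a n (fun e => h.disj₀₂ a e ha) hnP hva hvn
  have hu' : Unsplit G Q₂ := by
    refine h'.unsplit_of_not_isSplit hG ⟨n, hn2, hnx2, hnx3⟩ fun z P₁ P₂ hs => ?_
    have hsub : ∀ a, a ∈ P₁ ∨ a ∈ P₂ → a ∈ Q₂ := fun a ha => (hs.mem_iff a).2 ha
    rcases (hs.mem_iff n).1 hn2 with hn | hn
    · refine h'.reflect.not_isSplit_of_adj hG (fun w hw => (hQ₃ w hw).symm) hs.symm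
        fun a ha hva => ?_
      obtain rfl := hvQ a (hsub a (Or.inr ha)) hva
      exact hs.inter a hn ha
    · refine h'.not_isSplit_of_adj hG (fun w hw => (hQ₁ w hw).symm) hs fun a ha hva => ?_
      obtain rfl := hvQ a (hsub a (Or.inl ha)) hva
      exact hs.inter a ha hn
  refine IsGoodNecklace.hasTotallyNestedNontrivial ⟨h', hu', ⟨n, hn2, hnx2, hnx3⟩, ?_⟩ hG
  obtain ⟨a, ha, b, hb, c, hc, hab, hac, hbc⟩ := three_le_encard_iff.1 (hG.three_le_degree v)
  have h1 := fun e => hvQ a e ha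
  have h2 := fun e => hvQ b e hb
  have h3 := fun e => hvQ c e hc
  by_cases ha2 : a ∈ Q₂
  · exact ⟨b, c, fun e => hab ((h1 ha2).trans (h2 e).symm),
      fun e => hac ((h1 ha2).trans (h3 e).symm), hbc, hb, hc⟩
  · by_cases hb2 : b ∈ Q₂
    · exact ⟨a, c, ha2, fun e => hbc ((h2 hb2).trans (h3 e).symm), hac, ha, hc⟩
    · exact ⟨a, b, ha2, hb2, hab, ha, hb⟩

end IsNecklace

namespace IsNecklace

variable {v x₀ x₁ x₂ x₃ : V} {P Q₁ Q₂ Q₃ : Set V}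

/-- Induction on the length of a walk through the bag, over all necklaces with centre `v`. A split
bag falls into two bags with shorter walks; an unsplit bag with an inner vertex is excluded by
`hno`; a bag without inner vertices consists of its two ends. -/
lemma isPathLike_of_walk (hG : IsKConnected 3 G) (hno : ¬ HasTotallyNestedNontrivial G) (n : ℕ)
    (h : IsNecklace G v P Q₁ Q₂ Q₃ x₀ x₁ x₂ x₃) (p : G.Walk x₀ x₁) (hp : ∀ w ∈ p.support, w ∈ P)
    (hn : p.length ≤ n) : IsPathLike G P x₀ x₁ := by
  induction n generalizing P Q₁ Q₂ Q₃ x₀ x₁ x₂ x₃ with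
  | zero => exact absurd (SimpleGraph.Walk.eq_of_length_eq_zero (Nat.le_zero.1 hn)) h.x₀_ne_x₁
  | succ n ih =>
    by_cases hP : ∃ p ∈ P, p ≠ x₀ ∧ p ≠ x₁
    · by_cases hs : ∃ z P₁ P₂, IsSplit G P x₀ x₁ z P₁ P₂
      · obtain ⟨z, P₁, P₂, hs⟩ := hs
        obtain ⟨q, hq, -, hl⟩ := hs.exists_walk p hp hs.mem₀ hs.mem₁
        obtain ⟨q', hq', -, hl'⟩ := hs.symm.exists_walk p.reverse (by simpa using hp)
          hs.mem₁ hs.mem₀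
        have hl1 := hl hs.ne₁.symm
        have hl2 := hl' hs.ne₀.symm
        rw [SimpleGraph.Walk.length_reverse] at hl2
        exact hs.isPathLike (ih (h.split_left hs) q hq (by omega))
          (ih (h.split_right hs) q'.reverse (by simpa using hq')
            (by rw [SimpleGraph.Walk.length_reverse]; omega))
      · push Not at hs
        exact absurd (h.hasTotallyNestedNontrivial_of_unsplit hG
          (h.unsplit_of_not_isSplit hG hP hs) hP) hno
    · push Not at hP
      have : P = {x₀, x₁} := by
        ext w
        have := hP w
        have := h.x₀P
        have := h.x₁P
        simp only [Set.mem_insert_iff, Set.mem_singleton_iff]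
        grind
      rw [this]
      exact isPathLike_pair G x₀ x₁

lemma isPathLike (hG : IsKConnected 3 G) (hno : ¬ HasTotallyNestedNontrivial G)
    (h : IsNecklace G v P Q₁ Q₂ Q₃ x₀ x₁ x₂ x₃) : IsPathLike G P x₀ x₁ := by
  obtain ⟨p, hp⟩ := h.exists_walk hG
  exact h.isPathLike_of_walk hG hno _ p hp le_rfl

lemma encard_neighborSet_le (hG : IsKConnected 3 G) (hno : ¬ HasTotallyNestedNontrivial G)
    (h : IsNecklace G v P Q₁ Q₂ Q₃ x₀ x₁ x₂ x₃) {w : V} (hw : w ∈ P) (hw0 : w ≠ x₀) :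
    (G.neighborSet w \ {v}).encard ≤ 2 := by
  have hP := h.isPathLike hG hno
  have hQ := h.rotate.isPathLike hG hno
  by_cases hw1 : w = x₁
  · subst hw1
    -- At a common end, each of the two bags contributes at most one neighbour.
    refine (Set.encard_le_encard ?_).trans (encard_union_le_two hP.right hQ.left)
    rintro b ⟨hwb, hbv⟩
    have hwb' : G.Adj w b := hwb
    have := h.edge w b hwb' h.x₁_ne_v hbv
    have h2 := h.disj₀₂ w hw
    have h3 := h.disj₁₃ w h.x₁Q₁
    simp only [Set.mem_union, Set.mem_inter_iff, hwb, true_and]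
    tauto
  · refine (Set.encard_le_encard ?_).trans (hP.two w hw)
    rintro b ⟨hwb, hbv⟩
    exact ⟨hwb, h.mem_of_adj_inner hw hw0 hw1 hwb hbv⟩

lemma encard_neighborSet_le_of_ne (hG : IsKConnected 3 G) (hno : ¬ HasTotallyNestedNontrivial G)
    (h : IsNecklace G v P Q₁ Q₂ Q₃ x₀ x₁ x₂ x₃) {w : V} (hwv : w ≠ v) :
    (G.neighborSet w \ {v}).encard ≤ 2 := by
  have key : ∀ {P Q₁ Q₂ Q₃ x₀ x₁ x₂ x₃} (h : IsNecklace G v P Q₁ Q₂ Q₃ x₀ x₁ x₂ x₃),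
      w ∈ P → (G.neighborSet w \ {v}).encard ≤ 2 := by
    intro P Q₁ Q₂ Q₃ x₀ x₁ x₂ x₃ h hw
    by_cases hw0 : w = x₀
    · subst hw0
      exact h.reflect.encard_neighborSet_le hG hno h.x₀P h.x₀_ne_x₁
    · exact h.encard_neighborSet_le hG hno hw hw0
  rcases h.cover w hwv with hw | hw | hw | hw
  · exact key h hw
  · exact key h.rotate hw
  · exact key h.rotate.rotate hw
  · exact key h.rotate.rotate.rotate hw

lemma finite (hG : IsKConnected 3 G) (hno : ¬ HasTotallyNestedNontrivial G)
    (h : IsNecklace G v P Q₁ Q₂ Q₃ x₀ x₁ x₂ x₃) : Finite V := by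
  rw [← Set.finite_univ_iff]
  refine ((((h.isPathLike hG hno).finite.union (h.rotate.isPathLike hG hno).finite).union
    (h.rotate.rotate.isPathLike hG hno).finite).union
    (h.rotate.rotate.rotate.isPathLike hG hno).finite).insert v |>.subset ?_
  intro w _
  have := h.cover w
  simp only [Set.mem_insert_iff, Set.mem_union]
  tauto

end IsNecklace

/-! ### Recognition of wheels. -/

lemma exists_iso_cycleGraph {W : Type*} [Finite W] {H : SimpleGraph W} (hconn : H.Connected)
    (h2 : ∀ w, (H.neighborSet w).ncard = 2) :
    ∃ n, 3 ≤ n ∧ Nonempty (SimpleGraph.cycleGraph n ≃g H) := by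
  obtain ⟨w⟩ := hconn.nonempty
  have hcyc : H.IsCycles := fun w _ => h2 w
  obtain ⟨p, hp, hverts⟩ := hcyc.exists_cycle_toSubgraph_verts_eq_connectedComponentSupp
    (c := H.connectedComponentMk w) (v := w) rfl (Set.nonempty_of_ncard_ne_zero (by simp [h2 w]))
  obtain ⟨m, hm⟩ := Nat.exists_eq_add_of_le' hp.three_le_length
  have hsupp : ∀ x, x ∈ p.support := by
    intro x
    rw [← SimpleGraph.Walk.mem_verts_toSubgraph, hverts]
    exact SimpleGraph.ConnectedComponent.eq.2 (hconn.preconnected x w)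
  -- The cycle `p` spans the whole component, so listing its vertices without the repeated last one
  -- is a bijection.
  let f : Fin (m + 3) → W := fun i => p.getVert i
  have hinj : Function.Injective f := by
    intro i j hij
    have h1 := i.isLt
    have h2 := j.isLt
    exact Fin.ext (hp.getVert_injOn' (by simp only [Set.mem_ofPred_eq]; omega)
      (by simp only [Set.mem_ofPred_eq]; omega) hij)
  have hsurj : Function.Surjective f := by
    intro x
    obtain ⟨k, hk, hkl⟩ := SimpleGraph.Walk.mem_support_iff_exists_getVert.1 (hsupp x)
    rcases hkl.lt_or_eq with hlt | rfl
    · exact ⟨⟨k, by omega⟩, hk⟩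
    · refine ⟨0, ?_⟩
      rw [SimpleGraph.Walk.getVert_length] at hk
      simpa [f] using hk
  have hstep : ∀ i, H.Adj (f i) (f (i + 1)) := by
    intro i
    have hi : (i : ℕ) < p.length := by omega
    have h1 := p.adj_getVert_succ hi
    by_cases hlast : i = Fin.last (m + 2)
    · subst hlast
      have : (Fin.last (m + 2) : ℕ) + 1 = p.length := by simp [hm]
      rw [this, SimpleGraph.Walk.getVert_length] at h1
      simpa [f] using h1
    · have : ((i + 1 : Fin (m + 3)) : ℕ) = i + 1 := Fin.val_add_one_of_lt
        (lt_of_le_of_ne (Fin.le_last i) hlast)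
      simpa [f, this] using h1
  have hnbr : ∀ i, H.neighborSet (f i) = {f (i - 1), f (i + 1)} := by
    intro i
    -- The two neighbours differ because `1 + 1 ≠ 0` in `Fin (m + 3)`.
    have hne : f (i - 1) ≠ f (i + 1) := by
      intro e
      have e' := hinj e
      rw [sub_eq_iff_eq_add, add_assoc, left_eq_add] at e'
      exact absurd e' (ne_of_beq_false rfl)
    symm
    refine Set.eq_of_subset_of_ncard_le ?_ (by rw [h2, Set.ncard_pair hne])
    rintro _ (rfl | rfl)
    · simpa using (hstep (i - 1)).symm
    · exact hstep i
  refine ⟨m + 3, by omega, ⟨⟨Equiv.ofBijective f ⟨hinj, hsurj⟩, ?_⟩⟩⟩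
  intro i j
  change f j ∈ H.neighborSet (f i) ↔ j ∈ (SimpleGraph.cycleGraph (m + 1 + 2)).neighborSet i
  rw [hnbr, SimpleGraph.cycleGraph_neighborSet]
  simp [hinj.eq_iff]

lemma wheelGraph_adj_inl_inl {n : ℕ} {i j : Fin n} :
    (wheelGraph n).Adj (Sum.inl i) (Sum.inl j) ↔ (SimpleGraph.cycleGraph n).Adj i j := by
  simp [wheelGraph]

lemma wheelGraph_adj_inl_inr {n : ℕ} {i : Fin n} {j : Unit} :
    (wheelGraph n).Adj (Sum.inl i) (Sum.inr j) := by
  simp [wheelGraph]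

/-- A finite graph is a wheel if deleting the centre leaves a connected `2`-regular graph. -/
lemma isWheel_of_regular [Finite V] {v : V} (hconn : (G.induce {v}ᶜ).Connected)
    (hv : ∀ w, w ≠ v → G.Adj v w) (h2 : ∀ w, w ≠ v → (G.neighborSet w \ {v}).encard = 2) :
    IsWheel G := by
  obtain ⟨n, hn, ⟨e⟩⟩ := exists_iso_cycleGraph hconn (by
    rintro ⟨w, hw⟩
    have h1 : (G.neighborSet w \ {v}).ncard = 2 := by simp [Set.ncard, h2 w hw]
    rw [← h1, ← Set.ncard_image_of_injective _ Subtype.val_injective]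
    congr 1
    ext x
    simp [and_comm])
  refine ⟨n, hn, ⟨SimpleGraph.Iso.symm ⟨Equiv.ofBijective
    (Sum.elim (fun i => (e i : V)) fun _ => v) ⟨?_, ?_⟩, ?_⟩⟩⟩
  · rintro (i | i) (j | j) hij
    · simpa [Subtype.val_injective.eq_iff] using hij
    · exact absurd hij (e i).2
    · exact absurd hij.symm (e j).2
    · rfl
  · intro x
    by_cases hx : x = v
    · exact ⟨Sum.inr (), hx.symm⟩
    · obtain ⟨i, hi⟩ := e.surjective ⟨x, hx⟩
      exact ⟨Sum.inl i, by simp [hi]⟩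
  · have he : ∀ i j, G.Adj (e i) (e j) ↔ (SimpleGraph.cycleGraph n).Adj i j :=
      fun i j => e.map_adj_iff
    rintro (i | i) (j | j)
    · exact (he i j).trans wheelGraph_adj_inl_inl.symm
    · exact iff_of_true (hv _ (e i).2).symm wheelGraph_adj_inl_inr
    · exact iff_of_true (hv _ (e j).2) wheelGraph_adj_inl_inr.symm
    · simp [wheelGraph]

/-- Every vertex other than `v` has degree at least three, but at most two neighbours besides `v`.
So it is adjacent to `v` and has exactly two further neighbours. -/
theorem IsNecklace.isWheel {v x₀ x₁ x₂ x₃ : V} {P Q₁ Q₂ Q₃ : Set V}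
    (h : IsNecklace G v P Q₁ Q₂ Q₃ x₀ x₁ x₂ x₃) (hG : IsKConnected 3 G)
    (hno : ¬ HasTotallyNestedNontrivial G) : IsWheel G := by
  have := h.finite hG hno
  have hle := fun w (hw : w ≠ v) => h.encard_neighborSet_le_of_ne hG hno hw
  have hadj : ∀ w, w ≠ v → G.Adj w v := by
    intro w hw
    by_contra hwv
    have h1 : G.neighborSet w \ {v} = G.neighborSet w := by
      refine Set.sdiff_singleton_eq_self hwv
    have h2 := hle w hw
    rw [h1] at h2
    exact absurd ((hG.three_le_degree w).trans h2) (by norm_num)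
  refine isWheel_of_regular (v := v) (hG.2 {v} (by simp)) (fun w hw => (hadj w hw).symm) ?_
  intro w hw
  refine le_antisymm (hle w hw) ?_
  have h1 := hG.three_le_degree w
  have hmem : v ∈ G.neighborSet w := hadj w hw
  rw [← Set.encard_sdiff_singleton_add_one hmem] at h1
  have : (3 : ℕ∞) = 2 + 1 := by norm_num
  rw [this] at h1
  exact (ENat.add_le_add_iff_right (by simp)).1 h1

lemma exists_eq_of_encard_eq_three {α : Type*} {s : Set α} (hs : s.encard = 3) {a b : α}
    (ha : a ∈ s) (hb : b ∈ s) (hab : a ≠ b) : ∃ c, c ≠ a ∧ c ≠ b ∧ s = {a, b, c} := by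
  obtain ⟨x, y, z, hxy, hxz, hyz, rfl⟩ := Set.encard_eq_three.1 hs
  simp only [Set.mem_insert_iff, Set.mem_singleton_iff] at ha hb
  have key : ∀ c, c = x ∨ c = y ∨ c = z → c ≠ a → c ≠ b →
      ∃ c, c ≠ a ∧ c ≠ b ∧ ({x, y, z} : Set α) = {a, b, c} := by
    intro c hc hca hcb
    refine ⟨c, hca, hcb, ?_⟩
    ext w
    simp only [Set.mem_insert_iff, Set.mem_singleton_iff]
    grind
  by_cases hx : x ≠ a ∧ x ≠ b
  · exact key x (by simp) hx.1 hx.2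
  · by_cases hy : y ≠ a ∧ y ≠ b
    · exact key y (by simp) hy.1 hy.2
    · exact key z (by simp) (by grind) (by grind)

/-- There are exactly four vertices, and minimum degree three makes the graph complete. -/
lemma IsKConnected.isWheel_of_card_le_four (hG : IsKConnected 3 G) {a b c d : V}
    (h : ∀ w, w = a ∨ w = b ∨ w = c ∨ w = d) : IsWheel G := by
  have huniv : (Set.univ : Set V) = {a, b, c, d} := by
    ext w
    simpa using h w
  have hfin : Finite V := by
    rw [← Set.finite_univ_iff, huniv]
    simp
  have hcard : ENat.card V = 4 := by
    refine le_antisymm ?_ (Order.add_one_le_of_lt hG.1)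
    rw [← Set.encard_univ, huniv]
    refine (Set.encard_insert_le _ _).trans ?_
    have h3 : ({b, c, d} : Set V).encard ≤ 2 + 1 :=
      (Set.encard_insert_le _ _).trans (by gcongr; exact encard_pair_le _ _)
    calc _ ≤ (2 + 1 + 1 : ℕ∞) := by gcongr
      _ = 4 := by norm_num
  have hcompl : ∀ w : V, ({w}ᶜ : Set V).encard = 3 := by
    intro w
    have := Set.encard_add_encard_compl ({w} : Set V)
    rw [Set.encard_univ, hcard, Set.encard_singleton] at this
    have h4 : (4 : ℕ∞) = 1 + 3 := by norm_num
    rw [h4] at this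
    exact ENat.add_right_injective_of_ne_top (by simp) this
  have hadj : ∀ w, G.neighborSet w = {w}ᶜ := by
    intro w
    refine (Set.toFinite _).eq_of_subset_of_encard_le ?_ ?_
    · intro x hx
      exact fun e => G.irrefl (e ▸ hx : G.Adj w w)
    · rw [hcompl]
      exact hG.three_le_degree w
  have hadj' : ∀ w x, x ≠ w → G.Adj w x := by
    intro w x hx
    have : x ∈ G.neighborSet w := by
      rw [hadj]
      exact hx
    exact this
  refine isWheel_of_regular (v := a) (hG.2 {a} (by simp)) (hadj' a) fun w hw => ?_
  have h1 := hcompl w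
  have hmem : a ∈ ({w}ᶜ : Set V) := hw.symm
  rw [← Set.encard_sdiff_singleton_add_one hmem, ← hadj] at h1
  have h3 : (3 : ℕ∞) = 2 + 1 := by norm_num
  rw [h3] at h1
  exact ENat.add_left_injective_of_ne_top (by simp) h1

/-! ### Separator vertices of degree three. -/

namespace IsTriSeparation

variable {C D : Set V} {u t c d : V}

/-- There is a neighbour in each strict side and two neighbours in each side, so the third neighbour
counts for both sides. -/
lemma exists_neighborSet_eq (hG : IsKConnected 3 G) (h : IsTriSeparation G C D) (huC : u ∈ C)
    (huD : u ∈ D) (hu : (G.neighborSet u).encard ≤ 3) :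
    ∃ c t d, c ∈ C ∧ c ∉ D ∧ t ∈ C ∧ t ∈ D ∧ d ∈ D ∧ d ∉ C ∧ G.neighborSet u = {c, d, t} := by
  have hs := h.encard_sep
  obtain ⟨c, hcC, hcD, huc⟩ := hG.exists_adj_left h.1 hs huC huD
  obtain ⟨d, hdD, hdC, hud⟩ := hG.exists_adj_right h.1 hs huC huD
  obtain ⟨hC, hD⟩ := h.2.2 u ⟨huC, huD⟩
  have h3 : (G.neighborSet u).encard = 3 := le_antisymm hu (hG.three_le_degree u)
  obtain ⟨t, htc, htd, hN⟩ := exists_eq_of_encard_eq_three h3 (a := c) (b := d) huc hud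
    (fun e => hcD (e ▸ hdD))
  obtain ⟨a, ⟨hua, ha⟩, b, ⟨hub, hb⟩, hab⟩ := two_le_encard_iff.1 hC
  obtain ⟨a', ⟨hua', ha'⟩, b', ⟨hub', hb'⟩, hab'⟩ := two_le_encard_iff.1 hD
  rw [hN] at hua hub hua' hub'
  simp only [Set.mem_insert_iff, Set.mem_singleton_iff] at hua hub hua' hub'
  refine ⟨c, t, d, hcC, hcD, ?_, ?_, hdD, hdC, hN⟩ <;> grind

/-- The centre is `t`. The vertex `z` represents the third separator element, either as that vertex
or as an end of that edge; this is all that `hT` and `hE` record. -/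
lemma isNecklace (h : IsTriSeparation G C D)
    (hcC : c ∈ C) (hcD : c ∉ D) (huC : u ∈ C) (huD : u ∈ D) (htC : t ∈ C) (htD : t ∈ D)
    (hdD : d ∈ D) (hdC : d ∉ C) (hN : G.neighborSet u = {c, d, t}) {z : V} (hzc : z ≠ c)
    (hzd : z ≠ d) (hzu : z ≠ u) (hzt : z ≠ t) (hT : ∀ w, w ∈ C → w ∈ D → w = u ∨ w = t ∨ w = z)
    (hE : ∀ a b, a ∈ C → a ∉ D → b ∈ D → b ∉ C → G.Adj a b → a = z ∨ b = z) :
    IsNecklace G t {c, u} {u, d} (insert z (D \ C)) (insert z (C \ D)) c u d z := by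
  have hut : u ≠ t := by
    rintro rfl
    exact G.irrefl (show u ∈ G.neighborSet u by simp [hN])
  have hNu : ∀ w, G.Adj u w → w = c ∨ w = d ∨ w = t := by
    intro w hw
    have : w ∈ G.neighborSet u := hw
    simpa [hN] using this
  have hthree : ∀ w, w ≠ t → w = u ∨ w = z ∨ (w ∈ C ∧ w ∉ D) ∨ (w ∈ D ∧ w ∉ C) := by
    intro w hw
    have := hT w
    have := h.1.mem_or w
    tauto
  constructor
  case cover =>
    intro w hw
    have := hthree w hw
    simp only [Set.mem_insert_iff, Set.mem_singleton_iff, Set.mem_sdiff]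
    tauto
  case edge =>
    intro a b hab hat hbt
    simp only [Set.mem_insert_iff, Set.mem_singleton_iff, Set.mem_sdiff]
    by_cases hau : a = u
    · subst hau
      have := hNu b hab
      tauto
    · by_cases hbu : b = u
      · subst hbu
        have := hNu a hab.symm
        tauto
      · rcases (hthree a hat).resolve_left hau with rfl | ha | ha <;>
          rcases (hthree b hbt).resolve_left hbu with rfl | hb | hb
        · simp
        · simp [hb]
        · simp [hb]
        · simp [ha]
        · simp [ha, hb]
        · rcases hE a b ha.1 ha.2 hb.1 hb.2 hab with rfl | rfl
          · simp [hb]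
          · simp [ha]
        · simp [ha]
        · rcases hE b a hb.1 hb.2 ha.1 ha.2 hab.symm with rfl | rfl
          · simp [ha]
          · simp [hb]
        · simp [ha, hb]
  all_goals
    simp only [Set.mem_insert_iff, Set.mem_singleton_iff, Set.mem_sdiff]
    grind

/-- When all separator edges start at `c`, the rest of `C \ D` is attached only to `t` and `c`. -/
lemma eq_of_mem_left (hG : IsKConnected 3 G) (h : IsTriSeparation G C D)
    (hcD : c ∉ D) (htC : t ∈ C) (htD : t ∈ D) (hdD : d ∈ D) (hdC : d ∉ C)
    (hN : G.neighborSet u = {c, d, t}) (hT : ∀ w, w ∈ C → w ∈ D → w = u ∨ w = t)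
    (hE : ∀ a b, a ∈ C → a ∉ D → b ∈ D → b ∉ C → G.Adj a b → a = c) {w : V} (hwC : w ∈ C)
    (hwD : w ∉ D) : w = c := by
  by_contra hwc
  have hcu : c ∈ G.neighborSet u := by simp [hN]
  refine hG.not_separated ((C \ D) \ {c}) {Sum.inl t, Sum.inl c} (encard_pair_le _ _)
    (k := w) ⟨⟨hwC, hwD⟩, hwc⟩ ?_ (z := d) (fun e => hdC e.1.1) ?_ ?_
  · have : w ≠ t := fun e => hwD (e ▸ htD)
    simp [this, hwc]
  · have h1 : d ≠ t := fun e => hdC (e ▸ htC)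
    have h2 : d ≠ c := fun e => hcD (e ▸ hdD)
    simp [h1, h2]
  · rintro a b ⟨⟨haC, haD⟩, hac⟩ hb hab
    simp only [Set.mem_sdiff, Set.mem_singleton_iff] at hb hac
    simp only [Set.mem_insert_iff, Set.mem_singleton_iff, Sum.inl.injEq]
    by_cases hbC : b ∈ C
    · by_cases hbD : b ∈ D
      · rcases hT b hbC hbD with rfl | rfl
        · have : a ∈ G.neighborSet b := hab.symm
          rw [hN] at this
          simp only [Set.mem_insert_iff, Set.mem_singleton_iff] at this
          rcases this with rfl | rfl | rfl
          · exact absurd rfl hac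
          · exact absurd hdD haD
          · exact absurd htD haD
        · simp
      · have : b = c := by tauto
        simp [this]
    · exact absurd (hE a b haC haD ((h.1.mem_or b).resolve_left hbC) hbC hab) hac

/-- The third separator element provides `z`: a vertex serves as it is, and an edge `ab` through its
end `a` if `a ≠ c`, or `b` if `b ≠ d`. If the edge is `cd`, only the vertices `u`, `t`, `c`, `d`
exist. -/
theorem hasTotallyNestedNontrivial_or_isWheel (hG : IsKConnected 3 G)
    (h : IsTriSeparation G C D) (huC : u ∈ C) (huD : u ∈ D) (hu : (G.neighborSet u).encard ≤ 3) :
    HasTotallyNestedNontrivial G ∨ IsWheel G := by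
  obtain ⟨c, t, d, hcC, hcD, htC, htD, hdD, hdC, hN⟩ := h.exists_neighborSet_eq hG huC huD hu
  have hut : u ≠ t := by
    rintro rfl
    exact G.irrefl (show u ∈ G.neighborSet u by simp [hN])
  rw [or_iff_not_imp_left]
  intro hno
  obtain ⟨e, heu, het, hsep⟩ := exists_eq_of_encard_eq_three h.encard_sep
    (a := Sum.inl u) (b := Sum.inl t) (inl_mem_sep.2 ⟨huC, huD⟩) (inl_mem_sep.2 ⟨htC, htD⟩)
    (fun e => hut (Sum.inl_injective e))
  have he : e ∈ sep G C D := by simp [hsep]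
  have hTe : ∀ w, w ∈ C → w ∈ D → w = u ∨ w = t ∨ Sum.inl w = e := by
    intro w hC hD
    have : Sum.inl w ∈ sep G C D := inl_mem_sep.2 ⟨hC, hD⟩
    simpa [hsep] using this
  have hEe : ∀ a b, a ∈ C → a ∉ D → b ∈ D → b ∉ C → G.Adj a b → Sum.inr s(a, b) = e := by
    intro a b haC haD hbD hbC hab
    have : Sum.inr s(a, b) ∈ sep G C D := inr_mem_sep.2 ⟨hab, Or.inl ⟨haC, haD, hbD, hbC⟩⟩
    simpa [hsep] using this
  rcases e with z | e
  · obtain ⟨hzC, hzD⟩ := inl_mem_sep.1 he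
    refine (h.isNecklace hcC hcD huC huD htC htD hdD hdC hN (z := z) (fun e => hcD (e ▸ hzD))
      (fun e => hdC (e ▸ hzC)) (fun e => heu (by rw [e])) (fun e => het (by rw [e]))
      (fun w hC hD => by simpa using hTe w hC hD)
      fun a b haC haD hbD hbC hab => ?_).isWheel hG hno
    exact absurd (hEe a b haC haD hbD hbC hab) (by simp)
  · have hT : ∀ w, w ∈ C → w ∈ D → w = u ∨ w = t := fun w hC hD => by
      simpa using hTe w hC hD
    obtain ⟨a, b, haC, haD, hbD, hbC, rfl⟩ : ∃ a b, a ∈ C ∧ a ∉ D ∧ b ∈ D ∧ b ∉ C ∧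
        e = s(a, b) := by
      induction e with | _ a b
      rcases (inr_mem_sep.1 he).2 with h' | h'
      · exact ⟨a, b, h'.1, h'.2.1, h'.2.2.1, h'.2.2.2, rfl⟩
      · exact ⟨b, a, h'.1, h'.2.1, h'.2.2.1, h'.2.2.2, Sym2.eq_swap⟩
    have hE : ∀ x y, x ∈ C → x ∉ D → y ∈ D → y ∉ C → G.Adj x y → x = a ∧ y = b := by
      intro x y hxC hxD hyD hyC hxy
      have := hEe x y hxC hxD hyD hyC hxy
      rw [Sum.inr.injEq, Sym2.eq_iff] at this
      rcases this with h' | ⟨rfl, rfl⟩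
      · exact h'
      · exact absurd hyD haD
    by_cases hbd : b = d
    · by_cases hac : a = c
      · subst hbd hac
        refine hG.isWheel_of_card_le_four (a := u) (b := t) (c := a) (d := b) fun w => ?_
        have h1 := h.eq_of_mem_left hG hcD htC htD hdD hdC hN hT
          (fun x y hxC hxD hyD hyC hxy => (hE x y hxC hxD hyD hyC hxy).1) (w := w)
        have h2 := h.symm.eq_of_mem_left (u := u) (c := b) (d := a) hG hdC htD htC hcC hcD
          (by rw [hN, Set.insert_comm]) (fun w h1 h2 => hT w h2 h1)
          (fun x y hxC hxD hyD hyC hxy => (hE y x hyD hyC hxC hxD hxy.symm).2) (w := w)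
        have h3 := hT w
        have := h.1.mem_or w
        tauto
      · refine (h.isNecklace hcC hcD huC huD htC htD hdD hdC hN (z := a) hac
          (fun e => hdC (e ▸ haC)) (fun e => haD (e ▸ huD)) (fun e => haD (e ▸ htD))
          (fun w hC hD => by have := hT w hC hD; tauto)
          fun x y hxC hxD hyD hyC hxy => ?_).isWheel hG hno
        exact Or.inl (hE x y hxC hxD hyD hyC hxy).1
    · refine (h.isNecklace hcC hcD huC huD htC htD hdD hdC hN (z := b) (fun e => hcD (e ▸ hbD))
        hbd (fun e => hbC (e ▸ huC)) (fun e => hbC (e ▸ htC))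
        (fun w hC hD => by have := hT w hC hD; tauto)
        fun x y hxC hxD hyD hyC hxy => ?_).isWheel hG hno
      exact Or.inr (hE x y hxC hxD hyD hyC hxy).2

end IsTriSeparation

/-! ### Crossing tri-separations: corners, links and centre. -/

lemma encard_neighborSet_le_of_forall {X : Set (V ⊕ Sym2 V)} {u : V}
    (h : ∀ b, G.Adj u b → Sum.inl b ∈ X ∨ Sum.inr s(u, b) ∈ X) :
    (G.neighborSet u).encard ≤ X.encard := by
  classical
  refine Set.encard_le_encard_of_injOn
    (f := fun b => if Sum.inl b ∈ X then Sum.inl b else Sum.inr s(u, b)) ?_ ?_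
  · intro b hb
    by_cases hbX : Sum.inl b ∈ X
    · simp [hbX]
    · simpa [hbX] using (h b hb).resolve_left hbX
  · intro b hb c hc hbc
    by_cases hbX : Sum.inl b ∈ X <;> by_cases hcX : Sum.inl c ∈ X
    · simpa [hbX, hcX] using hbc
    · simp [hbX, hcX] at hbc
    · simp [hbX, hcX] at hbc
    · simp only [hbX, hcX, if_false, Sum.inr.injEq, Sym2.eq_iff] at hbc
      rcases hbc with h' | ⟨rfl, rfl⟩
      · exact h'.2
      · rfl

lemma ncard_add_ncard_add_ncard {α : Type*} {Z K L M : Set α} (hK : K.Finite) (hL : L.Finite)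
    (hM : M.Finite) (hmem : ∀ w, w ∈ Z ↔ w ∈ K ∨ w ∈ L ∨ w ∈ M)
    (hd : ∀ w, w ∈ K → w ∉ L ∧ w ∉ M) (hd' : ∀ w, w ∈ L → w ∉ M) :
    K.ncard + L.ncard + M.ncard = Z.ncard := by
  have h1 : Z = K ∪ (L ∪ M) := Set.ext hmem
  have h2 : Disjoint K (L ∪ M) := Set.disjoint_left.2 fun w hw hw' => by
    have := hd w hw
    rcases hw' with h | h <;> tauto
  rw [h1, Set.ncard_union_eq h2 hK (hL.union hM),
    Set.ncard_union_eq (Set.disjoint_left.2 hd') hL hM, add_assoc]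

/-- Here `X` and `Y` are the crossing separators, and `U` and `W` those of two opposite corners.
Since `|U| + |W| ≤ |X| + |Y| = 6` and both terms on the left are at least three, equality holds
throughout; comparing how `X`, `Y` and `U` decompose gives the equal link sizes. -/
lemma corner_counts {α : Type*} {X Y U W : Set α} (hX : X.encard = 3) (hY : Y.encard = 3)
    (hU : 3 ≤ U.encard) (hW : 3 ≤ W.encard) (hun : U ∪ W ⊆ X ∪ Y) (hin : U ∩ W ⊆ X ∩ Y) :
    X ∪ Y ⊆ U ∪ W ∧ X ∩ Y ⊆ U ∩ W ∧ ∃ r r' m : ℕ, r + r' + m = 3 ∧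
      ((Y \ X) ∩ W).encard = r ∧ ((X \ Y) ∩ U).encard = r ∧
      ((Y \ X) ∩ U).encard = r' ∧ ((X \ Y) ∩ W).encard = r' ∧ (X ∩ Y).encard = m := by
  have fX : X.Finite := Set.finite_of_encard_eq_coe hX
  have fY : Y.Finite := Set.finite_of_encard_eq_coe hY
  have fXY := fX.union fY
  have fU : U.Finite := fXY.subset (Set.subset_union_left.trans hun)
  have fW : W.Finite := fXY.subset (Set.subset_union_right.trans hun)
  rw [← fX.cast_ncard_eq] at hX
  rw [← fY.cast_ncard_eq] at hY
  rw [← fU.cast_ncard_eq] at hU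
  rw [← fW.cast_ncard_eq] at hW
  norm_cast at hX hY hU hW
  have e1 := Set.ncard_union_add_ncard_inter X Y fX fY
  have e2 := Set.ncard_union_add_ncard_inter U W fU fW
  have l1 := Set.ncard_le_ncard hun fXY
  have l2 := Set.ncard_le_ncard hin (fX.inter_of_left Y)
  have h1 : U ∪ W = X ∪ Y := Set.eq_of_subset_of_ncard_le hun (by omega) fXY
  have h2 : U ∩ W = X ∩ Y := Set.eq_of_subset_of_ncard_le hin (by omega) (fX.inter_of_left Y)
  refine ⟨h1.ge, h2.ge, ((Y \ X) ∩ W).ncard, ((Y \ X) ∩ U).ncard, (X ∩ Y).ncard, ?_⟩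
  have m1 : ∀ w, w ∈ U ∨ w ∈ W ↔ w ∈ X ∨ w ∈ Y := fun w => Set.ext_iff.1 h1 w
  have m2 : ∀ w, w ∈ U ∧ w ∈ W ↔ w ∈ X ∧ w ∈ Y := fun w => Set.ext_iff.1 h2 w
  have fi := fX.inter_of_left Y
  have fa : ((Y \ X) ∩ W).Finite := fW.inter_of_right _
  have fc : ((X \ Y) ∩ U).Finite := fU.inter_of_right _
  have fb : ((Y \ X) ∩ U).Finite := fU.inter_of_right _
  have fd : ((X \ Y) ∩ W).Finite := fW.inter_of_right _
  have kX := ncard_add_ncard_add_ncard (Z := X) fi fc fd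
    (fun w => by have := m1 w; have := m2 w; simp only [Set.mem_inter_iff, Set.mem_sdiff]; grind)
    (fun w => by simp only [Set.mem_inter_iff, Set.mem_sdiff]; grind)
    (fun w => by have := m2 w; simp only [Set.mem_inter_iff, Set.mem_sdiff]; grind)
  have kY := ncard_add_ncard_add_ncard (Z := Y) fi fa fb
    (fun w => by have := m1 w; have := m2 w; simp only [Set.mem_inter_iff, Set.mem_sdiff]; grind)
    (fun w => by simp only [Set.mem_inter_iff, Set.mem_sdiff]; grind)
    (fun w => by have := m2 w; simp only [Set.mem_inter_iff, Set.mem_sdiff]; grind)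
  have kU := ncard_add_ncard_add_ncard (Z := U) fi fc fb
    (fun w => by have := m1 w; have := m2 w; simp only [Set.mem_inter_iff, Set.mem_sdiff]; grind)
    (fun w => by simp only [Set.mem_inter_iff, Set.mem_sdiff]; grind)
    (fun w => by have := m2 w; simp only [Set.mem_inter_iff, Set.mem_sdiff]; grind)
  refine ⟨by omega, fa.cast_ncard_eq.symm, ?_, fb.cast_ncard_eq.symm, ?_, fi.cast_ncard_eq.symm⟩
  · rw [← fc.cast_ncard_eq]
    norm_cast
    omega
  · rw [← fd.cast_ncard_eq]
    norm_cast
    omega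

/-- Every vertex in the separator of a tri-separation has degree at least four. -/
def IsStrong (G : SimpleGraph V) : Prop :=
  ∀ A B : Set V, IsTriSeparation G A B → ∀ u, u ∈ A → u ∈ B → ¬ (G.neighborSet u).encard ≤ 3

/-- The element `e` is the only one of the separator of `(A, B)` towards `C \ D`, and `u`, `u'`
leave one further element `e'` in the other separator. If some vertex is outside both `A` and `D`,
then `e` and `e'` cut it off from `u`. Otherwise `C \ D` is a single vertex of `A ∩ B`, and its
degree is at most three. -/
lemma IsTriSeparation.not_subset_of_encard_le_one (hG : IsKConnected 3 G) (hst : IsStrong G)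
    {A B C D : Set V} (h : IsTriSeparation G A B) (h' : IsTriSeparation G C D)
    (hα : ∀ w, w ∈ A → w ∉ B → w ∈ C ∧ w ∈ D) {u u' : V} (huA : u ∈ A) (huB : u ∉ B)
    (huA' : u' ∈ A) (huB' : u' ∉ B) (huu : u ≠ u') {e : V ⊕ Sym2 V} (hes : e ∈ sep G A B)
    (he : ∀ w, w ∈ A → w ∈ B → w ∉ D → Sum.inl w = e)
    (he' : ∀ a b, a ∈ A → a ∉ B → b ∉ A → b ∉ D → G.Adj a b → Sum.inr s(a, b) = e) :
    False := by
  have hu := hα u huA huB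
  have hu' := hα u' huA' huB'
  by_cases hβ : ∃ k, k ∉ A ∧ k ∉ D
  · obtain ⟨k, hkA, hkD⟩ := hβ
    obtain ⟨e', heu, -, hY⟩ := exists_eq_of_encard_eq_three h'.encard_sep
      (a := Sum.inl u) (b := Sum.inl u') (inl_mem_sep.2 hu) (inl_mem_sep.2 hu')
      (fun e => huu (Sum.inl_injective e))
    have he'Y : e' ∈ sep G C D := by simp [hY]
    have hmemY : ∀ f ∈ sep G C D, f = Sum.inl u ∨ f = Sum.inl u' ∨ f = e' := by
      intro f hf
      simpa [hY] using hf
    have hkB := (h.1.mem_or k).resolve_left hkA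
    have hkC := (h'.1.mem_or k).resolve_right hkD
    refine hG.not_separated {w | w ∉ A ∧ w ∉ D} {e, e'} (encard_pair_le _ _) (k := k)
      ⟨hkA, hkD⟩ ?_ (z := u) (fun e => e.1 huA) ?_ ?_
    · rintro (rfl | rfl)
      · exact hkA (inl_mem_sep.1 hes).1
      · exact hkD (inl_mem_sep.1 he'Y).2
    · rintro (rfl | rfl)
      · exact huB (inl_mem_sep.1 hes).2
      · exact heu rfl
    · rintro a b ⟨haA, haD⟩ hb hab
      have haC := (h'.1.mem_or a).resolve_right haD
      have haB := (h.1.mem_or a).resolve_left haA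
      have hb' : b ∈ A ∨ b ∈ D := by
        by_contra hcon
        exact hb (not_or.1 hcon)
      by_cases hbB : b ∈ B
      · by_cases hbD : b ∈ D
        · have h1 : Sum.inl b ∈ sep G C D ∨ Sum.inr s(a, b) ∈ sep G C D := by
            by_cases hbC : b ∈ C
            · exact Or.inl (inl_mem_sep.2 ⟨hbC, hbD⟩)
            · exact Or.inr (inr_mem_sep.2 ⟨hab, Or.inl ⟨haC, haD, hbD, hbC⟩⟩)
          rcases h1 with h1 | h1
          · rcases hmemY _ h1 with h2 | h2 | h2
            · exact absurd (Sum.inl_injective h2 ▸ hbB) huB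
            · exact absurd (Sum.inl_injective h2 ▸ hbB) huB'
            · exact Or.inr (Or.inl (Or.inr h2))
          · rcases hmemY _ h1 with h2 | h2 | h2
            · cases h2
            · cases h2
            · exact Or.inr (Or.inr (Or.inr h2))
        · exact Or.inr (Or.inl (Or.inl (he b (hb'.resolve_right hbD) hbB hbD)))
      · refine Or.inr (Or.inr (Or.inl ?_))
        rw [Sym2.eq_swap]
        exact he' b a ((h.1.mem_or b).resolve_right hbB) hbB haA haD hab.symm
  · push Not at hβ
    obtain ⟨w, hwC, hwD⟩ := h'.1.2.1
    have hwA : w ∈ A := by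
      by_contra hwA
      exact hwD (hβ w hwA)
    have hwB : w ∈ B := by
      by_contra hwB
      exact hwD (hα w hwA hwB).2
    refine hst A B h w hwA hwB ?_
    rw [← h'.encard_sep]
    refine encard_neighborSet_le_of_forall fun b hwb => ?_
    by_cases hbC : b ∈ C
    · by_cases hbD : b ∈ D
      · exact Or.inl (inl_mem_sep.2 ⟨hbC, hbD⟩)
      · exfalso
        have hbA : b ∈ A := by
          by_contra hbA
          exact hbD (hβ b hbA)
        have hbB : b ∈ B := by
          by_contra hbB
          exact hbD (hα b hbA hbB).2
        exact hwb.ne (Sum.inl_injective ((he w hwA hwB hwD).trans (he b hbA hbB hbD).symm))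
    · exact Or.inr (inr_mem_sep.2 ⟨hwb,
        Or.inl ⟨hwC, hwD, (h'.1.mem_or b).resolve_left hbC, hbC⟩⟩)

/-- A strict side of a tri-separation is not included in the separator of another one. -/
lemma IsTriSeparation.not_subset_separator (hG : IsKConnected 3 G) (hst : IsStrong G)
    {A B C D : Set V} (h : IsTriSeparation G A B) (h' : IsTriSeparation G C D)
    (hα : ∀ w, w ∈ A → w ∉ B → w ∈ C ∧ w ∈ D) : False := by
  obtain ⟨u, huA, huB⟩ := h.1.2.1
  have hu := hα u huA huB
  by_cases hone : ∃ u', u' ∈ A ∧ u' ∉ B ∧ u ≠ u'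
  swap
  · push Not at hone
    refine hst C D h' u hu.1 hu.2 ?_
    rw [← h.encard_sep]
    refine encard_neighborSet_le_of_forall fun b hub => ?_
    by_cases hbA : b ∈ A
    · refine Or.inl (inl_mem_sep.2 ⟨hbA, ?_⟩)
      by_contra hbB
      exact hub.ne (hone b hbA hbB)
    · exact Or.inr (inr_mem_sep.2 ⟨hub, Or.inl ⟨huA, huB, (h.1.mem_or b).resolve_left hbA, hbA⟩⟩)
  obtain ⟨u', huA', huB', huu⟩ := hone
  -- The elements of the separator of `(A, B)` that point away from `E`. The sets `X C` and `X D`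
  -- are disjoint and nonempty inside a set of three elements, so one of them is a singleton.
  let X : Set V → Set (V ⊕ Sym2 V) := fun E => {e | e ∈ sep G A B ∧
    ((∃ w, w ∉ E ∧ e = Sum.inl w) ∨ ∃ a b, a ∈ A ∧ b ∉ A ∧ b ∉ E ∧ e = Sum.inr s(a, b))}
  have hv : ∀ {E : Set V} {w}, w ∈ A → w ∈ B → w ∉ E → Sum.inl w ∈ X E := fun hA hB hE =>
    ⟨inl_mem_sep.2 ⟨hA, hB⟩, Or.inl ⟨_, hE, rfl⟩⟩
  have he : ∀ {E : Set V} {a b}, a ∈ A → a ∉ B → b ∉ A → b ∉ E → G.Adj a b →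
      Sum.inr s(a, b) ∈ X E := fun haA haB hbA hbE hab =>
    ⟨inr_mem_sep.2 ⟨hab, Or.inl ⟨haA, haB, (h.1.mem_or _).resolve_left hbA, hbA⟩⟩,
      Or.inr ⟨_, _, haA, hbA, hbE, rfl⟩⟩
  have hne : ∀ {E : Set V} {g}, G.Adj u g → g ∉ E → (∀ w, w ∈ A → w ∉ B → w ∈ E) →
      ∃ e, e ∈ X E := by
    intro E g hug hgE hE
    by_cases hgA : g ∈ A
    · exact ⟨_, hv hgA (by_contra fun hgB => hgE (hE g hgA hgB)) hgE⟩
    · exact ⟨_, he huA huB hgA hgE hug⟩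
  have hdisj : ∀ e, e ∈ X C → e ∉ X D := by
    rintro e ⟨-, ⟨w, hw, rfl⟩ | ⟨a, b, ha, hb, hbE, rfl⟩⟩ ⟨-, ⟨w', hw', h1⟩ |
      ⟨a', b', ha', hb', hbE', h1⟩⟩
    · rw [Sum.inl.injEq] at h1
      subst h1
      exact (h'.1.mem_or w).elim hw hw'
    · cases h1
    · cases h1
    · rw [Sum.inr.injEq, Sym2.eq_iff] at h1
      rcases h1 with ⟨rfl, rfl⟩ | ⟨rfl, rfl⟩
      · exact (h'.1.mem_or b).elim hbE hbE'
      · exact hb ha'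
  obtain ⟨c, hcC, hcD, huc⟩ := hG.exists_adj_left h'.1 h'.encard_sep hu.1 hu.2
  obtain ⟨d, hdD, hdC, hud⟩ := hG.exists_adj_right h'.1 h'.encard_sep hu.1 hu.2
  obtain ⟨e, heγ⟩ := hne huc hcD fun w hwA hwB => (hα w hwA hwB).2
  obtain ⟨f, hfδ⟩ := hne hud hdC fun w hwA hwB => (hα w hwA hwB).1
  by_cases h1 : ∀ e', e' ∈ X D → e' = e
  · exact h.not_subset_of_encard_le_one hG hst h' hα huA huB huA' huB' huu heγ.1
      (fun w hA hB hD => h1 _ (hv hA hB hD))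
      (fun a b haA haB hbA hbD hab => h1 _ (he haA haB hbA hbD hab))
  by_cases h2 : ∀ f', f' ∈ X C → f' = f
  · exact h.not_subset_of_encard_le_one hG hst h'.symm (fun w hA hB => (hα w hA hB).symm)
      huA huB huA' huB' huu hfδ.1 (fun w hA hB hD => h2 _ (hv hA hB hD))
      (fun a b haA haB hbA hbD hab => h2 _ (he haA haB hbA hbD hab))
  push Not at h1 h2
  obtain ⟨e', he', hee⟩ := h1
  obtain ⟨f', hf', hff⟩ := h2
  exact not_four_of_encard_eq_three h.encard_sep heγ.1 he'.1 hfδ.1 hf'.1 hee.symm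
    (fun e => hdisj _ hfδ (e ▸ heγ)) (fun e => hdisj _ hf' (e ▸ heγ))
    (fun e => hdisj _ hfδ (e ▸ he')) (fun e => hdisj _ hf' (e ▸ he')) hff.symm

/-- Two crossing tri-separations, of which two opposite corners are nonempty. -/
structure IsCross (G : SimpleGraph V) (A B C D : Set V) : Prop where
  tri₁ : IsTriSeparation G A B
  tri₂ : IsTriSeparation G C D
  ne₁ : ∃ w, w ∈ A ∧ w ∉ B ∧ w ∈ D ∧ w ∉ C
  ne₂ : ∃ w, w ∈ B ∧ w ∉ A ∧ w ∈ C ∧ w ∉ D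

namespace IsCross

variable {A B C D : Set V}

lemma symm (h : IsCross G A B C D) : IsCross G B A D C :=
  ⟨h.tri₁.symm, h.tri₂.symm, h.ne₂, h.ne₁⟩

lemma swap (h : IsCross G A B C D) : IsCross G C D A B where
  tri₁ := h.tri₂
  tri₂ := h.tri₁
  ne₁ := by obtain ⟨w, h1, h2, h3, h4⟩ := h.ne₂; exact ⟨w, h3, h4, h1, h2⟩
  ne₂ := by obtain ⟨w, h1, h2, h3, h4⟩ := h.ne₁; exact ⟨w, h3, h4, h1, h2⟩

variable (h : IsCross G A B C D)
include h

/-- Together with `inter_subset`, this is submodularity at the level of sets rather than orders, so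
that equality also locates the individual elements. -/
lemma union_subset : sep G (B ∩ C) (A ∪ D) ∪ sep G (A ∩ D) (B ∪ C) ⊆ sep G A B ∪ sep G C D := by
  have hAB := h.tri₁.1.mem_or
  have hCD := h.tri₂.1.mem_or
  rintro (w | e)
  · simp only [Set.mem_union, inl_mem_sep, Set.mem_inter_iff]
    tauto
  · induction e with | _ a b
    have h1 := hAB a
    have h2 := hAB b
    have h3 := hCD a
    have h4 := hCD b
    simp only [Set.mem_union, inr_mem_sep, Set.mem_inter_iff]
    grind

lemma inter_subset : sep G (B ∩ C) (A ∪ D) ∩ sep G (A ∩ D) (B ∪ C) ⊆ sep G A B ∩ sep G C D := by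
  have hAB := h.tri₁.1.mem_or
  have hCD := h.tri₂.1.mem_or
  rintro (w | e)
  · simp only [Set.mem_union, inl_mem_sep, Set.mem_inter_iff]
    tauto
  · induction e with | _ a b
    have h1 := hAB a
    have h2 := hAB b
    have h3 := hCD a
    have h4 := hCD b
    simp only [Set.mem_union, inr_mem_sep, Set.mem_inter_iff]
    grind

lemma three_le_encard_corner (hG : IsKConnected 3 G) :
    3 ≤ (sep G (B ∩ C) (A ∪ D)).encard := by
  rw [← order_eq_encard_sep]
  refine hG.three_le_order ⟨?_, ?_, ?_⟩
  · ext w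
    have := h.tri₁.1.mem_or w
    have := h.tri₂.1.mem_or w
    simp only [Set.mem_union, Set.mem_inter_iff, Set.mem_univ, iff_true]
    tauto
  · obtain ⟨w, h1, h2, h3, h4⟩ := h.ne₂
    exact ⟨w, ⟨h1, h3⟩, fun e => e.elim h2 h4⟩
  · obtain ⟨w, h1, h2, h3, h4⟩ := h.ne₁
    exact ⟨w, Or.inl h1, fun e => h2 e.1⟩

end IsCross

/-- The part of the separator of `(C, D)` between the corners of `A ∩ C` and `A ∩ D`. -/
def link (G : SimpleGraph V) (A B C D : Set V) : Set (V ⊕ Sym2 V) :=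
  {e | (∃ w, w ∈ A ∧ w ∉ B ∧ w ∈ C ∧ w ∈ D ∧ e = Sum.inl w) ∨
    ∃ a b, G.Adj a b ∧ a ∈ A ∧ a ∉ B ∧ a ∈ D ∧ a ∉ C ∧ b ∈ A ∧ b ∈ C ∧ b ∉ D ∧ e = Sum.inr s(a, b)}

lemma inl_mem_link {A B C D : Set V} {w : V} :
    Sum.inl w ∈ link G A B C D ↔ w ∈ A ∧ w ∉ B ∧ w ∈ C ∧ w ∈ D := by
  simp [link]

lemma inr_mem_link {A B C D : Set V} {a b : V} (hab : G.Adj a b) (haA : a ∈ A) (haB : a ∉ B)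
    (haD : a ∈ D) (haC : a ∉ C) (hbA : b ∈ A) (hbC : b ∈ C) (hbD : b ∉ D) :
    Sum.inr s(a, b) ∈ link G A B C D :=
  Or.inr ⟨a, b, hab, haA, haB, haD, haC, hbA, hbC, hbD, rfl⟩

namespace IsCross

variable {A B C D : Set V} (h : IsCross G A B C D)
include h

lemma link_eq : link G A B C D = (sep G C D \ sep G A B) ∩ sep G (A ∩ D) (B ∪ C) := by
  have hAB := h.tri₁.1.mem_or
  have hCD := h.tri₂.1.mem_or
  ext (w | e)
  · simp only [inl_mem_link, Set.mem_inter_iff, Set.mem_sdiff, inl_mem_sep, Set.mem_union]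
    tauto
  · constructor
    · rintro (⟨w, _, _, _, _, h'⟩ | ⟨a, b, hab, haA, haB, haD, haC, hbA, hbC, hbD, h'⟩)
      · cases h'
      · cases h'
        simp [hab, haA, haB, haD, haC, hbA, hbC, hbD]
    · induction e with | _ a b
      simp only [Set.mem_inter_iff, Set.mem_sdiff, inr_mem_sep, Set.mem_union]
      rintro ⟨⟨⟨hab, h1⟩, h2⟩, -, h3⟩
      have := hAB a
      have := hAB b
      rcases h3 with h3 | h3
      · have : b ∈ A ∧ b ∈ C ∧ b ∉ D := by grind
        exact inr_mem_link hab h3.1.1 (by tauto) h3.1.2 (by tauto) this.1 this.2.1 this.2.2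
      · have : a ∈ A ∧ a ∈ C ∧ a ∉ D := by grind
        rw [Sym2.eq_swap]
        exact inr_mem_link hab.symm h3.1.1 (by tauto) h3.1.2 (by tauto) this.1 this.2.1 this.2.2

/-- The separators of both nonempty opposite corners have exactly three elements. Consequently the
two links at the corner of `A` and `C` have a common size `r`, those at the corner of `B` and `D` a
common size `r'`, and the centre accounts for the rest. -/
lemma counts (hG : IsKConnected 3 G) :
    sep G A B ∪ sep G C D ⊆ sep G (B ∩ C) (A ∪ D) ∪ sep G (A ∩ D) (B ∪ C) ∧
    sep G A B ∩ sep G C D ⊆ sep G (B ∩ C) (A ∪ D) ∩ sep G (A ∩ D) (B ∪ C) ∧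
    ∃ r r' m : ℕ, r + r' + m = 3 ∧ (link G A B C D).encard = r ∧ (link G C D A B).encard = r ∧
      (link G B A D C).encard = r' ∧ (link G D C B A).encard = r' ∧
      (sep G A B ∩ sep G C D).encard = m := by
  have h1 := corner_counts h.tri₁.encard_sep h.tri₂.encard_sep (h.three_le_encard_corner hG)
    (h.symm.three_le_encard_corner hG) h.union_subset h.inter_subset
  rw [h.link_eq, h.swap.link_eq, h.symm.link_eq, h.symm.swap.link_eq]
  simp only [sep_comm D C, sep_comm B A, Set.inter_comm C B, Set.inter_comm D A,
    Set.union_comm D A, Set.union_comm C B]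
  exact h1

/-- By equality in the submodularity, every separator edge belongs to the separator of one of the
two opposite corners. -/
lemma edge (hG : IsKConnected 3 G) {a b : V} (hab : G.Adj a b) (haA : a ∈ A) (haB : a ∉ B)
    (hbB : b ∈ B) (hbA : b ∉ A) : (b ∈ C ∧ b ∉ D) ∨ (a ∈ D ∧ a ∉ C) := by
  have h1 := (h.counts hG).1 (Or.inl (inr_mem_sep.2 ⟨hab, Or.inl ⟨haA, haB, hbB, hbA⟩⟩))
  simp only [Set.mem_union, inr_mem_sep, Set.mem_inter_iff] at h1
  tauto

/-- The neighbourhood of a corner. -/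
lemma boundary (hG : IsKConnected 3 G) {a b : V} (hab : G.Adj a b) (haA : a ∈ A) (haB : a ∉ B)
    (haC : a ∈ C) (haD : a ∉ D) (hb : b ∈ B ∨ b ∈ D) :
    (b ∈ A ∧ b ∈ B ∧ b ∈ C ∧ b ∈ D) ∨
      (Sum.inl b ∈ link G A B C D ∨ Sum.inr s(a, b) ∈ link G A B C D) ∨
      (Sum.inl b ∈ link G C D A B ∨ Sum.inr s(a, b) ∈ link G C D A B) := by
  by_cases hbB : b ∈ B
  · by_cases hbA : b ∈ A
    · by_cases hbD : b ∈ D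
      · by_cases hbC : b ∈ C
        · exact Or.inl ⟨hbA, hbB, hbC, hbD⟩
        · rcases h.swap.edge hG hab haC haD hbD hbC with h' | h'
          · exact absurd hbB h'.2
          · exact absurd haA h'.2
      · exact Or.inr (Or.inr (Or.inl (inl_mem_link.2
          ⟨(h.tri₂.1.mem_or b).resolve_right hbD, hbD, hbA, hbB⟩)))
    · rcases h.edge hG hab haA haB hbB hbA with h' | h'
      · refine Or.inr (Or.inr (Or.inr ?_))
        rw [Sym2.eq_swap]
        exact inr_mem_link hab.symm h'.1 h'.2 hbB hbA haC haA haB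
      · exact absurd h'.1 haD
  · have hbA := (h.tri₁.1.mem_or b).resolve_right hbB
    have hbD := hb.resolve_left hbB
    by_cases hbC : b ∈ C
    · exact Or.inr (Or.inl (Or.inl (inl_mem_link.2 ⟨hbA, hbB, hbC, hbD⟩)))
    · refine Or.inr (Or.inl (Or.inr ?_))
      rw [Sym2.eq_swap]
      exact inr_mem_link hab.symm hbA hbB hbD hbC haA haC haD

/-- The separator of a nonempty corner has at least three elements. -/
lemma three_le_boundary (hG : IsKConnected 3 G) {k : V} (hkB : k ∉ B) (hkD : k ∉ D)
    {W : Set (V ⊕ Sym2 V)}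
    (hW : ∀ w, w ∈ A → w ∈ B → w ∈ C → w ∈ D → Sum.inl w ∈ W)
    (hW₁ : link G A B C D ⊆ W) (hW₂ : link G C D A B ⊆ W)
    (hWk : Sum.inl k ∉ W) (hWz : ∃ z, (z ∈ B ∨ z ∈ D) ∧ Sum.inl z ∉ W) : ¬ W.encard ≤ 2 := by
  intro hle
  obtain ⟨z, hz, hzW⟩ := hWz
  refine hG.not_separated {w | w ∉ B ∧ w ∉ D} W hle (k := k) ⟨hkB, hkD⟩ hWk (z := z)
    (fun e => hz.elim e.1 e.2) hzW ?_
  rintro a b ⟨haB, haD⟩ hb hab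
  have hb' : b ∈ B ∨ b ∈ D := by
    by_contra hcon
    exact hb (not_or.1 hcon)
  rcases h.boundary hG hab ((h.tri₁.1.mem_or a).resolve_right haB) haB
    ((h.tri₂.1.mem_or a).resolve_right haD) haD hb' with h' | (h' | h') | (h' | h')
  · exact Or.inr (Or.inl (hW b h'.1 h'.2.1 h'.2.2.1 h'.2.2.2))
  · exact Or.inr (Or.inl (hW₁ h'))
  · exact Or.inr (Or.inr (hW₁ h'))
  · exact Or.inr (Or.inl (hW₂ h'))
  · exact Or.inr (Or.inr (hW₂ h'))

/-- If this corner were empty, the absence of vertices in its two links would give `A ⊆ D` and `C ⊆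
B`. -/
lemma exists_mem_corner (hn : ¬ Nested A B C D) (hv₁ : ∀ w, w ∈ A → w ∉ B → w ∈ C → w ∉ D)
    (hv₂ : ∀ w, w ∈ C → w ∉ D → w ∈ A → w ∉ B) : ∃ w, w ∈ A ∧ w ∉ B ∧ w ∈ C ∧ w ∉ D := by
  by_contra hcon
  push Not at hcon
  refine hn (Or.inr (Or.inr (Or.inl ⟨fun w hw => ?_, fun w hw => ?_⟩)))
  · by_contra hwD
    have hwC := (h.tri₂.1.mem_or w).resolve_right hwD
    by_cases hwB : w ∈ B
    · exact hv₂ w hwC hwD hw hwB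
    · exact hwD (hcon w hw hwB hwC)
  · by_contra hwB
    have hwA := (h.tri₁.1.mem_or w).resolve_right hwB
    exact hv₁ w hwA hwB hw (hcon w hwA hwB hw)

/-- If two opposite links are empty, then the separators agree. -/
lemma eq_of_links_eq_empty (hG : IsKConnected 3 G) (hn : ¬ Nested A B C D)
    (h₁ : link G A B C D = ∅) (h₂ : link G C D A B = ∅) :
    (∃ w, w ∈ A ∧ w ∉ B ∧ w ∈ C ∧ w ∉ D) ∧ (∀ w, (w ∈ A ∧ w ∈ B) ↔ (w ∈ C ∧ w ∈ D)) ∧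
      (A ∩ B).encard = 3 ∧
      (∀ a b, a ∈ A → a ∉ B → b ∈ B → b ∉ A → ¬ G.Adj a b) ∧
      (∀ a b, a ∈ C → a ∉ D → b ∈ D → b ∉ C → ¬ G.Adj a b) := by
  have hv₁ : ∀ w, w ∈ A → w ∉ B → w ∈ C → w ∉ D := fun w hA hB hC hD => by
    have := inl_mem_link (G := G).2 ⟨hA, hB, hC, hD⟩
    simp [h₁] at this
  have hv₂ : ∀ w, w ∈ C → w ∉ D → w ∈ A → w ∉ B := fun w hA hB hC hD => by
    have := inl_mem_link (G := G).2 ⟨hA, hB, hC, hD⟩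
    simp [h₂] at this
  have hne : ∃ w, w ∈ A ∧ w ∉ B ∧ w ∈ C ∧ w ∉ D :=
    h.exists_mem_corner hn hv₁ hv₂
  obtain ⟨k, hkA, hkB, hkC, hkD⟩ := hne
  -- With both links empty, the corner is separated by centre vertices alone. There are at least
  -- three of them, so they fill both separators.
  let W : Set (V ⊕ Sym2 V) := {e | ∃ w, w ∈ A ∧ w ∈ B ∧ w ∈ C ∧ w ∈ D ∧ e = Sum.inl w}
  have hW : ¬ W.encard ≤ 2 := by
    refine h.three_le_boundary hG hkB hkD (fun w h1 h2 h3 h4 => ⟨w, h1, h2, h3, h4, rfl⟩)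
      (by simp [h₁]) (by simp [h₂]) ?_ ?_
    · rintro ⟨w, h1, h2, h3, h4, h5⟩
      cases h5
      exact hkB h2
    · obtain ⟨z, h1, h2, h3, h4⟩ := h.ne₁
      refine ⟨z, Or.inr h3, ?_⟩
      rintro ⟨w, h1', h2', h3', h4', h5⟩
      cases h5
      exact h2 h2'
  have hW' : 3 ≤ W.encard := by
    rw [not_le] at hW
    exact Order.add_one_le_of_lt hW
  have hfin : ∀ {Z : Set (V ⊕ Sym2 V)}, W ⊆ Z → Z.encard = 3 → W = Z := fun hs hZ =>
    ((Set.finite_of_encard_eq_coe hZ).subset hs).eq_of_subset_of_encard_le hs (by rwa [hZ])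
  have hX : W = sep G A B := hfin (by
    rintro _ ⟨w, h1, h2, h3, h4, rfl⟩
    exact inl_mem_sep.2 ⟨h1, h2⟩) h.tri₁.encard_sep
  have hY : W = sep G C D := hfin (by
    rintro _ ⟨w, h1, h2, h3, h4, rfl⟩
    exact inl_mem_sep.2 ⟨h3, h4⟩) h.tri₂.encard_sep
  refine ⟨⟨k, hkA, hkB, hkC, hkD⟩, fun w => ?_, ?_, fun a b ha1 ha2 hb1 hb2 hab => ?_,
    fun a b ha1 ha2 hb1 hb2 hab => ?_⟩
  · rw [← inl_mem_sep (G := G), ← hX, hY, inl_mem_sep]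
  · rw [← h.tri₁.encard_sep, ← hX, ← Sum.inl_injective.encard_image (A ∩ B)]
    congr 1
    ext e
    constructor
    · rintro ⟨w, hw, rfl⟩
      rw [hX]
      exact inl_mem_sep.2 hw
    · rintro ⟨w, h1, h2, -, -, rfl⟩
      exact ⟨w, ⟨h1, h2⟩, rfl⟩
  · have : Sum.inr s(a, b) ∈ W := by
      rw [hX]
      exact inr_mem_sep.2 ⟨hab, Or.inl ⟨ha1, ha2, hb1, hb2⟩⟩
    obtain ⟨w, -, -, -, -, h'⟩ := this
    cases h'
  · have : Sum.inr s(a, b) ∈ W := by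
      rw [hY]
      exact inr_mem_sep.2 ⟨hab, Or.inl ⟨ha1, ha2, hb1, hb2⟩⟩
    obtain ⟨w, -, -, -, -, h'⟩ := this
    cases h'

/-- A vertex of the link of `A` has two neighbours in `C`. With corner and centre empty, each of
them yields its own element of the link of `C`, which has at most one. -/
lemma notMem_of_corner_eq_empty (hG : IsKConnected 3 G)
    (hST : ∀ w, w ∈ A → w ∈ B → w ∈ C → w ∉ D)
    (hcorner : ∀ w, w ∈ A → w ∉ B → w ∈ C → w ∈ D) (h₁ : (link G A B C D).encard ≤ 1)
    (h₂ : (link G C D A B).encard ≤ 1)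
    {u : V} (huA : u ∈ A) (huB : u ∉ B) (huC : u ∈ C) : u ∉ D := by
  intro huD
  obtain ⟨x, ⟨hux, hx⟩, y, ⟨huy, hy⟩, hxy⟩ := two_le_encard_iff.1 (h.tri₂.2.2 u ⟨huC, huD⟩).1
  have key : ∀ b, b ∈ C → G.Adj u b →
      Sum.inl b ∈ link G C D A B ∨ Sum.inr s(b, u) ∈ link G C D A B := by
    intro b hbC hub
    by_cases hbA : b ∈ A
    · by_cases hbB : b ∈ B
      · exact Or.inl (inl_mem_link.2 ⟨hbC, hST b hbA hbB hbC, hbA, hbB⟩)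
      · exact absurd (Sum.inl_injective (Set.encard_le_one_iff.1 h₁ _ _
          (inl_mem_link.2 ⟨huA, huB, huC, huD⟩)
          (inl_mem_link.2 ⟨hbA, hbB, hbC, hcorner b hbA hbB hbC⟩))) hub.ne
    · have hbB := (h.tri₁.1.mem_or b).resolve_left hbA
      rcases h.edge hG hub huA huB hbB hbA with h' | h'
      · exact Or.inr (inr_mem_link hub.symm h'.1 h'.2 hbB hbA huC huA huB)
      · exact absurd huC h'.2
  have hle := Set.encard_le_one_iff.1 h₂
  rcases key x hx hux with hx' | hx' <;> rcases key y hy huy with hy' | hy'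
  · exact hxy (Sum.inl_injective (hle _ _ hx' hy'))
  · cases hle _ _ hx' hy'
  · cases hle _ _ hx' hy'
  · have := hle _ _ hx' hy'
    rw [Sum.inr.injEq, Sym2.congr_left] at this
    exact hxy this

/-- Without a centre vertex, the corner would be cut off by two links of size at most one, so it is
empty. Then neither link contains a vertex, and the tri-separations are nested. -/
lemma exists_mem_of_encard_le_one (hG : IsKConnected 3 G) (hn : ¬ Nested A B C D)
    (h₁ : (link G A B C D).encard ≤ 1) (h₂ : (link G C D A B).encard ≤ 1) :
    ∃ w, w ∈ A ∧ w ∈ B ∧ w ∈ C ∧ w ∈ D := by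
  by_contra hcon
  push Not at hcon
  have hcorner : ∀ w, w ∈ A → w ∉ B → w ∈ C → w ∈ D := by
    intro k hkA hkB hkC
    by_contra hkD
    refine h.three_le_boundary hG hkB hkD (W := link G A B C D ∪ link G C D A B)
      (fun w h1 h2 h3 h4 => absurd h4 (hcon w h1 h2 h3)) Set.subset_union_left
      Set.subset_union_right ?_ ?_ (encard_union_le_two h₁ h₂)
    · simp only [Set.mem_union, inl_mem_link]
      tauto
    · obtain ⟨z, h1, h2, h3, h4⟩ := h.ne₁
      refine ⟨z, Or.inr h3, ?_⟩
      simp only [Set.mem_union, inl_mem_link]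
      tauto
  obtain ⟨w, h1, h2, h3, h4⟩ := h.exists_mem_corner hn
    (fun w hA hB hC => h.notMem_of_corner_eq_empty hG hcon hcorner h₁ h₂ hA hB hC)
    (fun w hC hD hA => h.swap.notMem_of_corner_eq_empty hG
      (fun w h1 h2 h3 h4 => hcon w h3 h4 h1 h2)
      (fun w h1 h2 h3 => by_contra fun hB => h2 (hcorner w h3 hB h1)) h₂ h₁ hC hD hA)
  exact h4 (hcorner w h1 h2 h3)

/-- In this configuration, moving an end of an edge of the separator into the separator leads to
another tri-separation, which is excluded by `hM`. -/
lemma not_adj_link (hG : IsKConnected 3 G)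
    (hM : ∀ u t s, u ∈ A → u ∉ B → t ∉ A → s ∈ A → s ∈ B → G.Adj u t → G.Adj u s →
      ∀ u', u' ∈ A → u' ∉ B → u' = u)
    {v : V} (hvA : v ∈ A) (hvB : v ∈ B) (hST : ∀ w, w ∈ A → w ∈ B → w ∈ C → w ∈ D → w = v)
    (h₁ : (link G A B C D).encard ≤ 1) (h₂ : (link G C D A B).encard ≤ 1) {u t : V}
    (huA : u ∈ A) (huB : u ∉ B) (huC : u ∈ C) (huD : u ∈ D) (htB : t ∈ B) (htA : t ∉ A)
    (htC : t ∈ C) (htD : t ∉ D) : ¬ G.Adj u t := by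
  intro hut
  have h₁' : ∀ e ∈ link G A B C D, e = Sum.inl u := fun e he =>
    Set.encard_le_one_iff.1 h₁ _ _ he (inl_mem_link.2 ⟨huA, huB, huC, huD⟩)
  have h₂' : ∀ e ∈ link G C D A B, e = Sum.inr s(t, u) := fun e he =>
    Set.encard_le_one_iff.1 h₂ _ _ he (inr_mem_link hut.symm htC htD htB htA huC huA huB)
  -- The edge `tu` is not incident with the corner of `A` and `C`, so a nonempty corner would be cut
  -- off by `v` and `u`.
  have hcorner : ∀ w, w ∈ A → w ∉ B → w ∈ D := by
    intro k hkA hkB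
    by_contra hkD
    have hne : ∀ {a b : V}, a ∈ A → b ∉ A → a ≠ b := fun ha hb e => hb (e ▸ ha)
    have hne' : ∀ {a b : V}, a ∈ B → b ∉ B → a ≠ b := fun ha hb e => hb (e ▸ ha)
    have hne'' : ∀ {a b : V}, a ∈ D → b ∉ D → a ≠ b := fun ha hb e => hb (e ▸ ha)
    refine hG.not_separated {w | w ∉ B ∧ w ∉ D} {Sum.inl v, Sum.inl u} (encard_pair_le _ _)
      (k := k) ⟨hkB, hkD⟩ ?_ (z := t) (fun e => e.1 htB) ?_ ?_
    · simp [(hne' hvB hkB).symm, (hne'' huD hkD).symm]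
    · simp [(hne hvA htA).symm, hut.ne']
    · rintro a b ⟨haB, haD⟩ hb hab
      have hb' : b ∈ B ∨ b ∈ D := by
        by_contra hcon
        exact hb (not_or.1 hcon)
      have haA := (h.tri₁.1.mem_or a).resolve_right haB
      rcases h.boundary hG hab haA haB
        ((h.tri₂.1.mem_or a).resolve_right haD) haD hb' with h' | (h' | h') | (h' | h')
      · simp [hST b h'.1 h'.2.1 h'.2.2.1 h'.2.2.2]
      · simp [Sum.inl_injective (h₁' _ h')]
      · cases h₁' _ h'
      · cases h₂' _ h'
      · have h3 := h₂' _ h'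
        rw [Sum.inr.injEq, Sym2.eq_iff] at h3
        rcases h3 with ⟨rfl, rfl⟩ | ⟨rfl, rfl⟩
        · exact absurd haA htA
        · exact absurd huD haD
  have key : ∀ b, b ∈ C → G.Adj u b → b = t ∨ b = v := by
    intro b hbC hub
    by_cases hbA : b ∈ A
    · by_cases hbB : b ∈ B
      · by_cases hbD : b ∈ D
        · exact Or.inr (hST b hbA hbB hbC hbD)
        · cases h₂' _ (inl_mem_link.2 ⟨hbC, hbD, hbA, hbB⟩)
      · exact absurd (Sum.inl_injective (h₁' _
          (inl_mem_link.2 ⟨hbA, hbB, hbC, hcorner b hbA hbB⟩))) hub.ne'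
    · have hbB := (h.tri₁.1.mem_or b).resolve_left hbA
      rcases h.edge hG hub huA huB hbB hbA with h' | h'
      · have := h₂' _ (inr_mem_link hub.symm h'.1 h'.2 hbB hbA huC huA huB)
        rw [Sum.inr.injEq, Sym2.congr_left] at this
        exact Or.inl this
      · exact absurd huC h'.2
  obtain ⟨x, ⟨hux, hx⟩, y, ⟨huy, hy⟩, hxy⟩ := two_le_encard_iff.1 (h.tri₂.2.2 u ⟨huC, huD⟩).1
  have huv : G.Adj u v := by
    rcases key x hx hux with rfl | rfl
    · rcases key y hy huy with rfl | rfl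
      · exact absurd rfl hxy
      · exact huy
    · exact hux
  -- Since `u` is adjacent to `t` and `v`, the hypothesis `hM` makes it the only vertex of `A \ B`;
  -- but the corner of `A` and `D` contains another one.
  obtain ⟨w, hwA, hwB, hwD, hwC⟩ := h.ne₁
  exact hwC (hM u t v huA huB htA hvA hvB hut huv w hwA hwB ▸ huC)

-- A link that consists of an edge is represented by its end in the corner of `A` and `D`.
omit h in
lemma exists_link_vertex (h₁ : (link G A B C D).encard = 1) :
    ∃ p, (p ∈ A ∧ p ∉ B ∧ p ∈ D) ∧ (∀ w, w ∈ A → w ∉ B → w ∈ C → w ∈ D → w = p) ∧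
      ∀ a b, G.Adj a b → a ∈ A → a ∉ B → a ∈ D → a ∉ C → b ∈ A → b ∈ C → b ∉ D → a = p := by
  obtain ⟨e, he⟩ := Set.encard_eq_one.1 h₁
  have he' : ∀ f ∈ link G A B C D, f = e := fun f hf => by simpa [he] using hf
  have : e ∈ link G A B C D := by simp [he]
  rcases this with ⟨w, hA, hB, hC, hD, rfl⟩ | ⟨a, b, hab, haA, haB, haD, haC, hbA, hbC, hbD, rfl⟩
  · exact ⟨w, ⟨hA, hB, hD⟩, fun x h1 h2 h3 h4 => Sum.inl_injective
      (he' _ (inl_mem_link.2 ⟨h1, h2, h3, h4⟩)), fun a b hab h1 h2 h3 h4 h5 h6 h7 => by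
        cases he' _ (inr_mem_link hab h1 h2 h3 h4 h5 h6 h7)⟩
  · refine ⟨a, ⟨haA, haB, haD⟩, fun x h1 h2 h3 h4 => ?_, fun x y hxy h1 h2 h3 h4 h5 h6 h7 => ?_⟩
    · cases he' _ (inl_mem_link.2 ⟨h1, h2, h3, h4⟩)
    · have := he' _ (inr_mem_link hxy h1 h2 h3 h4 h5 h6 h7)
      rw [Sum.inr.injEq, Sym2.eq_iff] at this
      rcases this with h' | ⟨rfl, rfl⟩
      · exact h'.1
      · exact absurd haD h7

-- Here an edge is represented by its end in the corner of `A` and `C`; `hno` ensures that this end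
-- is really there. With these conventions, the representatives of edge links lie in four different
-- corners.
omit h in
lemma exists_link_vertex_of_not_adj (h₂ : (link G C D A B).encard = 1)
    (hno : ∀ u t, u ∈ A → u ∉ B → u ∈ C → u ∈ D → t ∈ B → t ∉ A → t ∈ C → t ∉ D → ¬ G.Adj u t) :
    ∃ p, (p ∈ C ∧ p ∉ D ∧ p ∈ A) ∧ (∀ w, w ∈ A → w ∈ B → w ∈ C → w ∉ D → w = p) ∧
      ∀ a b, G.Adj a b → a ∈ A → a ∉ B → a ∈ C → a ∉ D → b ∈ B → b ∉ A → b ∈ C → b ∉ D →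
        a = p := by
  obtain ⟨e, he⟩ := Set.encard_eq_one.1 h₂
  have he' : ∀ f ∈ link G C D A B, f = e := fun f hf => by simpa [he] using hf
  have : e ∈ link G C D A B := by simp [he]
  rcases this with ⟨w, hC, hD, hA, hB, rfl⟩ | ⟨a, b, hab, haC, haD, haB, haA, hbC, hbA, hbB, rfl⟩
  · exact ⟨w, ⟨hC, hD, hA⟩, fun x h1 h2 h3 h4 => Sum.inl_injective
      (he' _ (inl_mem_link.2 ⟨h3, h4, h1, h2⟩)), fun a b hab h1 h2 h3 h4 h5 h6 h7 h8 => by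
        cases he' _ (inr_mem_link hab.symm h7 h8 h5 h6 h3 h1 h2)⟩
  · refine ⟨b, ⟨hbC, fun hbD => hno b a hbA hbB hbC hbD haB haA haC haD hab.symm, hbA⟩,
      fun x h1 h2 h3 h4 => ?_, fun x y hxy h1 h2 h3 h4 h5 h6 h7 h8 => ?_⟩
    · cases he' _ (inl_mem_link.2 ⟨h3, h4, h1, h2⟩)
    · have := he' _ (inr_mem_link hxy.symm h7 h8 h5 h6 h3 h1 h2)
      rw [Sum.inr.injEq, Sym2.eq_iff] at this
      rcases this with h' | ⟨rfl, rfl⟩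
      · exact h'.2
      · exact absurd hbA h6

end IsCross

/-! ### From crossing tri-separations to necklaces. -/

/-- Two crossing tri-separations whose separators meet in a vertex `v` and whose four links are
represented by the vertices `p`, `q`, `p'` and `q'`. -/
structure IsFrame (G : SimpleGraph V) (A B C D : Set V) (v p q p' q' : V) : Prop where
  orAB : ∀ w, w ∈ A ∨ w ∈ B
  orCD : ∀ w, w ∈ C ∨ w ∈ D
  centre : v ∈ A ∧ v ∈ B ∧ v ∈ C ∧ v ∈ D
  uniq : ∀ w, w ∈ A → w ∈ B → w ∈ C → w ∈ D → w = v
  diag : ∀ a b, G.Adj a b → a ∉ B → a ∉ C → b ∈ A ∨ b ∈ D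
  not_adj₁ : ∀ a b, G.Adj a b → a ∉ B → a ∈ C → a ∈ D → b ∉ A → b ∈ D
  not_adj₂ : ∀ a b, G.Adj a b → a ∉ A → a ∈ C → a ∈ D → b ∉ B → b ∈ C
  edge₁ : ∀ a b, G.Adj a b → a ∉ B → b ∉ A → b ∉ D ∨ a ∉ C
  edge₂ : ∀ a b, G.Adj a b → a ∉ D → b ∉ C → b ∉ B ∨ a ∉ A
  p_mem : p ∈ A ∧ p ∉ B ∧ p ∈ D
  q_mem : q ∈ C ∧ q ∉ D ∧ q ∈ A
  p'_mem : p' ∈ B ∧ p' ∉ A ∧ p' ∈ C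
  q'_mem : q' ∈ D ∧ q' ∉ C ∧ q' ∈ B
  eq_p : ∀ w, w ∉ B → w ∈ C → w ∈ D → w = p
  eq_q : ∀ w, w ∉ D → w ∈ A → w ∈ B → w = q
  eq_p' : ∀ w, w ∉ A → w ∈ C → w ∈ D → w = p'
  eq_q' : ∀ w, w ∉ C → w ∈ A → w ∈ B → w = q'
  adj_p : ∀ a b, G.Adj a b → a ∉ B → a ∉ C → b ∈ A → b ∉ D → a = p
  adj_q : ∀ a b, G.Adj a b → a ∉ B → a ∉ D → b ∉ A → b ∉ D → a = q
  adj_p' : ∀ a b, G.Adj a b → a ∉ A → a ∉ D → b ∈ B → b ∉ C → a = p'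
  adj_q' : ∀ a b, G.Adj a b → a ∉ A → a ∉ C → b ∉ B → b ∉ C → a = q'

namespace IsFrame

variable {A B C D : Set V} {v p q p' q' : V}

lemma symm (h : IsFrame G A B C D v p q p' q') : IsFrame G B A D C v p' q' p q where
  orAB w := (h.orAB w).symm
  orCD w := (h.orCD w).symm
  centre := by have := h.centre; tauto
  uniq w h1 h2 h3 h4 := h.uniq w h2 h1 h4 h3
  diag a b hab h1 h2 := by
    by_contra hcon
    rw [not_or] at hcon
    exact (h.diag b a hab.symm hcon.1 hcon.2).elim h1 h2
  not_adj₁ a b hab h1 h2 h3 h4 := h.not_adj₂ a b hab h1 h3 h2 h4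
  not_adj₂ a b hab h1 h2 h3 h4 := h.not_adj₁ a b hab h1 h3 h2 h4
  edge₁ a b hab h1 h2 := (h.edge₁ b a hab.symm h2 h1).symm
  edge₂ a b hab h1 h2 := (h.edge₂ b a hab.symm h2 h1).symm
  p_mem := h.p'_mem
  q_mem := h.q'_mem
  p'_mem := h.p_mem
  q'_mem := h.q_mem
  eq_p w h1 h2 h3 := h.eq_p' w h1 h3 h2
  eq_q w h1 h2 h3 := h.eq_q' w h1 h3 h2
  eq_p' w h1 h2 h3 := h.eq_p w h1 h3 h2
  eq_q' w h1 h2 h3 := h.eq_q w h1 h3 h2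
  adj_p := h.adj_p'
  adj_q := h.adj_q'
  adj_p' := h.adj_p
  adj_q' := h.adj_q

variable (h : IsFrame G A B C D v p q p' q')
include h

/-- The second alternative is a link that consists of an edge: its representative `q` is in this
corner and its other end is in the next one, whose bag also contains `q`. -/
lemma adj_corner {a b : V} (hab : G.Adj a b) (haB : a ∉ B) (haD : a ∉ D) (hbv : b ≠ v) :
    (b ∉ B ∧ b ∉ D ∨ b = p ∨ b = q) ∨ (a = q ∧ b ∉ A ∧ b ∉ D) := by
  have hA := (h.orAB a).resolve_right haB
  have hC := (h.orCD a).resolve_right haD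
  by_cases hbB : b ∈ B
  · by_cases hbA : b ∈ A
    · by_cases hbD : b ∈ D
      · by_cases hbC : b ∈ C
        · exact absurd (h.uniq b hbA hbB hbC hbD) hbv
        · rcases h.edge₂ a b hab haD hbC with h' | h'
          · exact absurd hbB h'
          · exact absurd hA h'
      · exact Or.inl (Or.inr (Or.inr (h.eq_q b hbD hbA hbB)))
    · rcases h.edge₁ a b hab haB hbA with h' | h'
      · exact Or.inr ⟨h.adj_q a b hab haB haD hbA h', hbA, h'⟩
      · exact absurd hC h'
  · by_cases hbD : b ∈ D
    · by_cases hbC : b ∈ C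
      · exact Or.inl (Or.inr (Or.inl (h.eq_p b hbB hbC hbD)))
      · exact Or.inl (Or.inr (Or.inl (h.adj_p b a hab.symm hbB hbC hA haD)))
    · exact Or.inl (Or.inl ⟨hbB, hbD⟩)

lemma adj_opposite_corner {a b : V} (hab : G.Adj a b) (haB : a ∉ B) (haC : a ∉ C) (hbv : b ≠ v) :
    (b ∉ B ∧ b ∉ C ∨ b = p ∨ b = q') ∨ (a = p ∧ (b ∉ B ∧ b ∉ D ∨ b = q)) := by
  by_cases hbA : b ∈ A
  · by_cases hbD : b ∈ D
    · by_cases hbB : b ∈ B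
      · by_cases hbC : b ∈ C
        · exact absurd (h.uniq b hbA hbB hbC hbD) hbv
        · exact Or.inl (Or.inr (Or.inr (h.eq_q' b hbC hbA hbB)))
      · by_cases hbC : b ∈ C
        · exact Or.inl (Or.inr (Or.inl (h.eq_p b hbB hbC hbD)))
        · exact Or.inl (Or.inl ⟨hbB, hbC⟩)
    · refine Or.inr ⟨h.adj_p a b hab haB haC hbA hbD, ?_⟩
      by_cases hbB : b ∈ B
      · exact Or.inr (h.eq_q b hbD hbA hbB)
      · exact Or.inl ⟨hbB, hbD⟩
  · have hbD := (h.diag a b hab haB haC).resolve_left hbA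
    by_cases hbC : b ∈ C
    · exact absurd (h.not_adj₂ b a hab.symm hbA hbC hbD haB) haC
    · exact Or.inl (Or.inr (Or.inr (h.adj_q' b a hab.symm hbA hbC haB haC)))

lemma cell {w : V} (hw : w ≠ v) : (w ∉ B ∧ w ∉ D) ∨ (w ∉ A ∧ w ∉ D) ∨ (w ∉ A ∧ w ∉ C) ∨
    (w ∉ B ∧ w ∉ C) ∨ (w = p ∧ w ∉ B ∧ w ∈ C) ∨ (w = q ∧ w ∉ D ∧ w ∈ A) ∨
    (w = p' ∧ w ∉ A ∧ w ∈ D) ∨ (w = q' ∧ w ∉ C ∧ w ∈ B) := by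
  have := h.uniq w
  have := h.eq_p w
  have := h.eq_q w
  have := h.eq_p' w
  have := h.eq_q' w
  have := h.orAB w
  have := h.orCD w
  grind

lemma edge_of_corner {a b : V} (hab : G.Adj a b) (hb : b ≠ v) (ha : (a ∉ B ∧ a ∉ D) ∨
    (a ∉ A ∧ a ∉ D) ∨ (a ∉ A ∧ a ∉ C) ∨ (a ∉ B ∧ a ∉ C)) :
    ((a ∉ B ∧ a ∉ D ∨ a = p ∨ a = q) ∧ (b ∉ B ∧ b ∉ D ∨ b = p ∨ b = q)) ∨
    ((a ∉ A ∧ a ∉ D ∨ a = q ∨ a = p') ∧ (b ∉ A ∧ b ∉ D ∨ b = q ∨ b = p')) ∨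
    ((a ∉ A ∧ a ∉ C ∨ a = p' ∨ a = q') ∧ (b ∉ A ∧ b ∉ C ∨ b = p' ∨ b = q')) ∨
    ((a ∉ B ∧ a ∉ C ∨ a = q' ∨ a = p) ∧ (b ∉ B ∧ b ∉ C ∨ b = q' ∨ b = p)) := by
  rcases ha with ha | ha | ha | ha
  · rcases h.adj_corner hab ha.1 ha.2 hb with h' | ⟨h1, h'⟩
    · exact Or.inl ⟨Or.inl ha, h'⟩
    · exact Or.inr (Or.inl ⟨Or.inr (Or.inl h1), Or.inl h'⟩)
  · rcases h.symm.adj_opposite_corner hab ha.1 ha.2 hb with h' | ⟨h1, h'⟩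
    · exact Or.inr (Or.inl ⟨Or.inl ha, h'.imp_right Or.symm⟩)
    · exact Or.inr (Or.inr (Or.inl ⟨Or.inr (Or.inl h1), h'.imp_right Or.inr⟩))
  · rcases h.symm.adj_corner hab ha.1 ha.2 hb with h' | ⟨h1, h'⟩
    · exact Or.inr (Or.inr (Or.inl ⟨Or.inl ha, h'⟩))
    · exact Or.inr (Or.inr (Or.inr ⟨Or.inr (Or.inl h1), Or.inl h'⟩))
  · rcases h.adj_opposite_corner hab ha.1 ha.2 hb with h' | ⟨h1, h'⟩
    · exact Or.inr (Or.inr (Or.inr ⟨Or.inl ha, h'.imp_right Or.symm⟩))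
    · exact Or.inl ⟨Or.inr (Or.inl h1), h'.imp_right Or.inr⟩

lemma edge {a b : V} (hab : G.Adj a b) (ha : a ≠ v) (hb : b ≠ v) :
    ((a ∉ B ∧ a ∉ D ∨ a = p ∨ a = q) ∧ (b ∉ B ∧ b ∉ D ∨ b = p ∨ b = q)) ∨
    ((a ∉ A ∧ a ∉ D ∨ a = q ∨ a = p') ∧ (b ∉ A ∧ b ∉ D ∨ b = q ∨ b = p')) ∨
    ((a ∉ A ∧ a ∉ C ∨ a = p' ∨ a = q') ∧ (b ∉ A ∧ b ∉ C ∨ b = p' ∨ b = q')) ∨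
    ((a ∉ B ∧ a ∉ C ∨ a = q' ∨ a = p) ∧ (b ∉ B ∧ b ∉ C ∨ b = q' ∨ b = p)) := by
  by_cases ha' : (a ∉ B ∧ a ∉ D) ∨ (a ∉ A ∧ a ∉ D) ∨ (a ∉ A ∧ a ∉ C) ∨ (a ∉ B ∧ a ∉ C)
  · exact h.edge_of_corner hab hb ha'
  by_cases hb' : (b ∉ B ∧ b ∉ D) ∨ (b ∉ A ∧ b ∉ D) ∨ (b ∉ A ∧ b ∉ C) ∨ (b ∉ B ∧ b ∉ C)
  · exact (h.edge_of_corner hab.symm ha hb').imp And.symm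
      (Or.imp And.symm (Or.imp And.symm And.symm))
  have ca := h.cell ha
  have cb := h.cell hb
  replace ca := ((((ca.resolve_left fun e => ha' (Or.inl e)).resolve_left
    fun e => ha' (Or.inr (Or.inl e))).resolve_left
    fun e => ha' (Or.inr (Or.inr (Or.inl e)))).resolve_left
    fun e => ha' (Or.inr (Or.inr (Or.inr e))))
  replace cb := ((((cb.resolve_left fun e => hb' (Or.inl e)).resolve_left
    fun e => hb' (Or.inr (Or.inl e))).resolve_left
    fun e => hb' (Or.inr (Or.inr (Or.inl e)))).resolve_left
    fun e => hb' (Or.inr (Or.inr (Or.inr e))))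
  have e1 := h.edge₁ a b hab
  have e2 := h.edge₁ b a hab.symm
  have e3 := h.edge₂ a b hab
  have e4 := h.edge₂ b a hab.symm
  have hne := hab.ne
  -- Both ends are vertices of links. Consecutive links share a bag, opposite links are not joined
  -- because of `edge₁` and `edge₂`, and equal links would give a loop.
  rcases ca with ⟨h1, h2, h3⟩ | ⟨h1, h2, h3⟩ | ⟨h1, h2, h3⟩ | ⟨h1, h2, h3⟩ <;>
  rcases cb with ⟨h4, h5, h6⟩ | ⟨h4, h5, h6⟩ | ⟨h4, h5, h6⟩ | ⟨h4, h5, h6⟩ <;>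
  first
  | exact absurd (h1.trans h4.symm) hne
  | exact ((e1 h2 h5).elim (· h6) (· h3)).elim
  | exact ((e2 h5 h2).elim (· h3) (· h6)).elim
  | exact ((e3 h2 h5).elim (· h6) (· h3)).elim
  | exact ((e4 h5 h2).elim (· h3) (· h6)).elim
  | (refine Or.inl ⟨Or.inr ?_, Or.inr ?_⟩ <;> first | exact Or.inl ‹_› | exact Or.inr ‹_›)
  | (refine Or.inr (Or.inl ⟨Or.inr ?_, Or.inr ?_⟩) <;> first | exact Or.inl ‹_› | exact Or.inr ‹_›)
  | (refine Or.inr (Or.inr (Or.inl ⟨Or.inr ?_, Or.inr ?_⟩)) <;>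
      first | exact Or.inl ‹_› | exact Or.inr ‹_›)
  | (refine Or.inr (Or.inr (Or.inr ⟨Or.inr ?_, Or.inr ?_⟩)) <;>
      first | exact Or.inl ‹_› | exact Or.inr ‹_›)

/-- Each bag is a corner together with the representatives of its two links. -/
lemma isNecklace : IsNecklace G v {w | w ∉ B ∧ w ∉ D ∨ w = p ∨ w = q}
    {w | w ∉ A ∧ w ∉ D ∨ w = q ∨ w = p'} {w | w ∉ A ∧ w ∉ C ∨ w = p' ∨ w = q'}
    {w | w ∉ B ∧ w ∉ C ∨ w = q' ∨ w = p} p q p' q' := by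
  have hc := h.centre
  have hp := h.p_mem
  have hq := h.q_mem
  have hp' := h.p'_mem
  have hq' := h.q'_mem
  have hAB := h.orAB
  have hCD := h.orCD
  constructor
  case edge => exact fun a b hab ha hb => h.edge hab ha hb
  case cover =>
    intro w hw
    have := h.cell hw
    simp only [Set.mem_ofPred_eq]
    tauto
  all_goals
    simp only [Set.mem_ofPred_eq]
    grind

end IsFrame

namespace IsCross

variable {A B C D : Set V}

/-- Crossing tri-separations give rise to a necklace, or else they have the same separator. -/
lemma exists_isNecklace_or (h : IsCross G A B C D) (hG : IsKConnected 3 G)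
    (hn : ¬ Nested A B C D)
    (hM₁ : ∀ u t s, u ∈ A → u ∉ B → t ∉ A → s ∈ A → s ∈ B → G.Adj u t → G.Adj u s →
      ∀ u', u' ∈ A → u' ∉ B → u' = u)
    (hM₂ : ∀ u t s, u ∈ B → u ∉ A → t ∉ B → s ∈ B → s ∈ A → G.Adj u t → G.Adj u s →
      ∀ u', u' ∈ B → u' ∉ A → u' = u) :
    (∃ v P Q₁ Q₂ Q₃ x₀ x₁ x₂ x₃, IsNecklace G v P Q₁ Q₂ Q₃ x₀ x₁ x₂ x₃) ∨
    ((∀ w, (w ∈ A ∧ w ∈ B) ↔ (w ∈ C ∧ w ∈ D)) ∧ (A ∩ B).encard = 3 ∧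
      (∀ a b, a ∈ A → a ∉ B → b ∈ B → b ∉ A → ¬ G.Adj a b) ∧
      (∀ a b, a ∈ C → a ∉ D → b ∈ D → b ∉ C → ¬ G.Adj a b) ∧
      (∃ w, w ∈ A ∧ w ∉ B ∧ w ∈ C ∧ w ∉ D) ∧ (∃ w, w ∈ B ∧ w ∉ A ∧ w ∈ D ∧ w ∉ C)) := by
  obtain ⟨-, -, r, r', m, hsum, ha, hc, hb, hd, hm⟩ := h.counts hG
  have hn' : ¬ Nested B A D C := fun h' => hn h'.swap_left.swap_right
  by_cases hr : r = 0
  · subst hr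
    rw [Nat.cast_zero, Set.encard_eq_zero] at ha hc
    obtain ⟨h1, h2, h3, h4, h5⟩ := h.eq_of_links_eq_empty hG hn ha hc
    refine Or.inr ⟨h2, h3, h4, h5, h1, ?_⟩
    have hempty : ∀ {A B C D : Set V}, (∀ w, (w ∈ A ∧ w ∈ B) ↔ (w ∈ C ∧ w ∈ D)) →
        ∀ w, w ∈ A → w ∉ B → w ∈ C → w ∉ D := fun h w hA hB hC hD => hB ((h w).2 ⟨hC, hD⟩).2
    exact h.symm.exists_mem_corner hn' (hempty (by simpa only [and_comm] using h2))
      (hempty (by simpa only [and_comm, iff_comm] using h2))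
  -- Here too the separators would agree, which empties the link of `A` and contradicts `r ≠ 0`.
  by_cases hr' : r' = 0
  · subst hr'
    rw [Nat.cast_zero, Set.encard_eq_zero] at hb hd
    obtain ⟨h1, h2, h3, h4, h5⟩ := h.symm.eq_of_links_eq_empty hG hn' hb hd
    refine absurd ?_ hr
    have : link G A B C D = ∅ := by
      rw [Set.eq_empty_iff_forall_notMem]
      rintro e (⟨w, hA, hB, hC, hD, rfl⟩ | ⟨a, b, hab, haA, haB, haD, haC, hbA, hbC, hbD, rfl⟩)
      · exact hB ((h2 w).2 ⟨hD, hC⟩).1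
      · exact h5 a b haD haC hbC hbD hab
    rw [this, Set.encard_empty] at ha
    exact_mod_cast ha.symm
  -- As `r + r' ≤ 3`, one of the two is at most one, which yields a centre vertex. Then all of `r`,
  -- `r'` and `m` are positive with sum three.
  obtain ⟨v, hvA, hvB, hvC, hvD⟩ : ∃ w, w ∈ A ∧ w ∈ B ∧ w ∈ C ∧ w ∈ D := by
    by_cases h1 : r ≤ 1
    · exact h.exists_mem_of_encard_le_one hG hn (by rw [ha]; exact_mod_cast h1)
        (by rw [hc]; exact_mod_cast h1)
    · have h2 : r' ≤ 1 := by omega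
      obtain ⟨w, h3, h4, h5, h6⟩ := h.symm.exists_mem_of_encard_le_one hG hn'
        (by rw [hb]; exact_mod_cast h2) (by rw [hd]; exact_mod_cast h2)
      exact ⟨w, h4, h3, h6, h5⟩
  have hvm : Sum.inl v ∈ sep G A B ∩ sep G C D :=
    ⟨inl_mem_sep.2 ⟨hvA, hvB⟩, inl_mem_sep.2 ⟨hvC, hvD⟩⟩
  have hm0 : m ≠ 0 := by
    rintro rfl
    rw [Nat.cast_zero, Set.encard_eq_zero] at hm
    rw [hm] at hvm
    exact hvm
  obtain rfl : r = 1 := by omega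
  obtain rfl : r' = 1 := by omega
  obtain rfl : m = 1 := by omega
  rw [Nat.cast_one] at ha hb hc hd hm
  have hXY : ∀ e ∈ sep G A B ∩ sep G C D, e = Sum.inl v := fun e he =>
    Set.encard_le_one_iff.1 hm.le _ _ he hvm
  have hST : ∀ w, w ∈ A → w ∈ B → w ∈ C → w ∈ D → w = v := fun w h1 h2 h3 h4 =>
    Sum.inl_injective (hXY _ ⟨inl_mem_sep.2 ⟨h1, h2⟩, inl_mem_sep.2 ⟨h3, h4⟩⟩)
  have no₁ := fun u t h1 h2 h3 h4 h5 h6 h7 h8 => h.not_adj_link hG hM₁ hvA hvB hST ha.le hc.le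
    (u := u) (t := t) h1 h2 h3 h4 h5 h6 h7 h8
  have no₂ := fun u t h1 h2 h3 h4 h5 h6 h7 h8 => h.symm.not_adj_link hG hM₂ hvB hvA
    (fun w h1 h2 h3 h4 => hST w h2 h1 h4 h3) hb.le hd.le (u := u) (t := t) h1 h2 h3 h4 h5 h6 h7 h8
  obtain ⟨p, hp, hp1, hp2⟩ := exists_link_vertex ha
  obtain ⟨p', hp', hp1', hp2'⟩ := exists_link_vertex hb
  obtain ⟨q, hq, hq1, hq2⟩ := exists_link_vertex_of_not_adj hc no₁
  obtain ⟨q', hq', hq1', hq2'⟩ := exists_link_vertex_of_not_adj hd no₂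
  have hA : ∀ {w}, w ∉ B → w ∈ A := fun h' => (h.tri₁.1.mem_or _).resolve_right h'
  have hB : ∀ {w}, w ∉ A → w ∈ B := fun h' => (h.tri₁.1.mem_or _).resolve_left h'
  have hC : ∀ {w}, w ∉ D → w ∈ C := fun h' => (h.tri₂.1.mem_or _).resolve_right h'
  have hD : ∀ {w}, w ∉ C → w ∈ D := fun h' => (h.tri₂.1.mem_or _).resolve_left h'
  refine Or.inl ⟨v, _, _, _, _, p, q, p', q', IsFrame.isNecklace (A := A) (B := B) (C := C)
    (D := D) ?_⟩
  exact {
    orAB := h.tri₁.1.mem_or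
    orCD := h.tri₂.1.mem_or
    centre := ⟨hvA, hvB, hvC, hvD⟩
    uniq := hST
    diag := fun a b hab h1 h2 => by
      by_contra hcon
      rw [not_or] at hcon
      cases hXY (Sum.inr s(a, b)) ⟨inr_mem_sep.2 ⟨hab, Or.inl ⟨hA h1, h1, hB hcon.1, hcon.1⟩⟩,
        inr_mem_sep.2 ⟨hab, Or.inr ⟨hC hcon.2, hcon.2, hD h2, h2⟩⟩⟩
    not_adj₁ := fun a b hab h1 h2 h3 h4 => by
      by_contra h5
      exact no₁ a b (hA h1) h1 h2 h3 (hB h4) h4 (hC h5) h5 hab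
    not_adj₂ := fun a b hab h1 h2 h3 h4 => by
      by_contra h5
      exact no₂ a b (hB h1) h1 h3 h2 (hA h4) h4 (hD h5) h5 hab
    edge₁ := fun a b hab h1 h2 => (h.edge hG hab (hA h1) h1 (hB h2) h2).imp And.right And.right
    edge₂ := fun a b hab h1 h2 => (h.swap.edge hG hab (hC h1) h1 (hD h2) h2).imp And.right And.right
    p_mem := hp
    q_mem := hq
    p'_mem := hp'
    q'_mem := hq'
    eq_p := fun w h1 h2 h3 => hp1 w (hA h1) h1 h2 h3
    eq_q := fun w h1 h2 h3 => hq1 w h2 h3 (hC h1) h1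
    eq_p' := fun w h1 h2 h3 => hp1' w (hB h1) h1 h3 h2
    eq_q' := fun w h1 h2 h3 => hq1' w h3 h2 (hD h1) h1
    adj_p := fun a b hab h1 h2 h3 h4 => hp2 a b hab (hA h1) h1 (hD h2) h2 h3 (hC h4) h4
    adj_q := fun a b hab h1 h2 h3 h4 => hq2 a b hab (hA h1) h1 (hC h2) h2 (hB h3) h3 (hC h4) h4
    adj_p' := fun a b hab h1 h2 h3 h4 => hp2' a b hab (hB h1) h1 (hC h2) h2 h3 (hD h4) h4
    adj_q' := fun a b hab h1 h2 h3 h4 => hq2' a b hab (hB h1) h1 (hD h2) h2 (hA h3) h3 (hD h4) h4 }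

end IsCross

/-! ### Maximal tri-separations, and the reduction to four parts. -/

lemma IsTriSeparation.insert_right (hG : IsKConnected 3 G) {A B : Set V}
    (h : IsTriSeparation G A B) {u t s u' : V} (huA : u ∈ A) (huB : u ∉ B) (htA : t ∉ A)
    (hsB : s ∈ B) (hut : G.Adj u t) (hus : G.Adj u s) (huA' : u' ∈ A)
    (huB' : u' ∉ B) (hne : u' ≠ u) (hsA : s ∈ A) : IsTriSeparation G A (insert u B) := by
  have htB := (h.1.mem_or t).resolve_left htA
  have hmix : IsMixedSeparation A (insert u B) := by
    refine ⟨?_, ⟨u', huA', ?_⟩, ⟨t, Or.inr htB, htA⟩⟩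
    · rw [Set.union_insert, h.1.1]
      simp
    · rintro (h' | h')
      · exact hne h'
      · exact huB' h'
  refine ⟨hmix, le_antisymm ?_ (hG.three_le_order hmix), ?_⟩
  · have hmem : Sum.inr s(u, t) ∈ sep G A B := inr_mem_sep.2 ⟨hut, Or.inl ⟨huA, huB, htB, htA⟩⟩
    -- The vertex `u` replaces the edge `ut` in the separator.
    have hsub : sep G A (insert u B) ⊆ insert (Sum.inl u) (sep G A B \ {Sum.inr s(u, t)}) := by
      rw [sep_subset_iff]
      constructor
      · rintro w hwA (rfl | hwB)
        · exact Or.inl rfl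
        · exact Or.inr ⟨inl_mem_sep.2 ⟨hwA, hwB⟩, by simp⟩
      · intro a b hab haA haB hbB hbA
        rw [Set.mem_insert_iff, not_or] at haB
        refine Or.inr ⟨inr_mem_sep.2 ⟨hab, Or.inl ⟨haA, haB.2, ?_, hbA⟩⟩, ?_⟩
        · exact hbB.resolve_left fun e => hbA (e ▸ huA)
        · intro e
          rw [Set.mem_singleton_iff, Sum.inr.injEq, Sym2.eq_iff] at e
          rcases e with e | e
          · exact haB.1 e.1
          · exact hbA (e.2 ▸ huA)
    rw [order_eq_encard_sep]
    calc _ ≤ _ := Set.encard_le_encard hsub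
      _ ≤ _ := Set.encard_insert_le _ _
      _ ≤ 2 + 1 := by gcongr; exact encard_sdiff_singleton_le_two h.encard_sep hmem
      _ = 3 := by norm_num
  · rintro w ⟨hwA, rfl | hwB⟩
    · refine ⟨?_, two_le_encard_iff.2 ⟨t, ⟨hut, Or.inr htB⟩, s, ⟨hus, Or.inr hsB⟩,
        fun e => htA (e ▸ hsA)⟩⟩
      obtain ⟨a, ha, b, hb, c, hc, hab, hac, hbc⟩ := three_le_encard_iff.1 (hG.three_le_degree w)
      -- By the matching property, `t` is the only neighbour of `u` outside `A`, so at least two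
      -- neighbours remain in `A`.
      have key : ∀ x, G.Adj w x → x ≠ t → x ∈ A := by
        intro x hx hxt
        by_contra hxA
        exact hxt (hG.eq_of_adj_of_adj h.1 h.encard_sep huA huB huA' huB' hne hxA htA hx hut)
      rw [two_le_encard_iff]
      by_cases hat : a = t
      · exact ⟨b, ⟨hb, key b hb (by grind)⟩, c, ⟨hc, key c hc (by grind)⟩, hbc⟩
      · by_cases hbt : b = t
        · exact ⟨a, ⟨ha, key a ha hat⟩, c, ⟨hc, key c hc (by grind)⟩, hac⟩
        · exact ⟨a, ⟨ha, key a ha hat⟩, b, ⟨hb, key b hb hbt⟩, hab⟩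
    · obtain ⟨h1, h2⟩ := h.2.2 w ⟨hwA, hwB⟩
      exact ⟨h1, h2.trans (Set.encard_le_encard
        (Set.inter_subset_inter_right _ (Set.subset_insert _ _)))⟩

lemma IsTriSeparation.encard_inter_le {A B : Set V} (h : IsTriSeparation G A B) :
    (A ∩ B).encard ≤ 3 := by
  rw [← h.2.1]
  exact le_self_add

lemma IsTriSeparation.finite_inter {A B : Set V} (h : IsTriSeparation G A B) :
    (A ∩ B).Finite := Set.finite_of_encard_le_coe (k := 3) h.encard_inter_le

lemma IsTriSeparation.ncard_inter_le {A B : Set V} (h : IsTriSeparation G A B) :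
    (A ∩ B).ncard ≤ 3 := by
  have := h.encard_inter_le
  rw [← h.finite_inter.cast_ncard_eq] at this
  exact_mod_cast this

/-- A nontrivial tri-separation whose separator has the maximum number of vertices. -/
lemma exists_maximal_isTriSeparation
    (hex : ∃ A B : Set V, IsTriSeparation G A B ∧ IsNontrivial G A B) :
    ∃ A B : Set V, IsTriSeparation G A B ∧ IsNontrivial G A B ∧
      ∀ A' B' : Set V, IsTriSeparation G A' B' → IsNontrivial G A' B' →
        (A' ∩ B').ncard ≤ (A ∩ B).ncard := by
  obtain ⟨A, B, hAB⟩ := hex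
  obtain ⟨⟨A, B⟩, ⟨h1, h2⟩, hmin⟩ := WellFounded.has_min
    -- Truncated subtraction is harmless here, since a separator has at most three vertices.
    (InvImage.wf (fun p : Set V × Set V => 3 - (p.1 ∩ p.2).ncard) Nat.lt_wfRel.wf)
    {p | IsTriSeparation G p.1 p.2 ∧ IsNontrivial G p.1 p.2} ⟨(A, B), hAB⟩
  refine ⟨A, B, h1, h2, fun A' B' h1' h2' => ?_⟩
  have := hmin (A', B') ⟨h1', h2'⟩
  have h3 := h1'.ncard_inter_le
  simp only [InvImage, not_lt, WellFoundedRelation.rel] at this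
  omega

/-- A second vertex of `A \ B` would allow `insert_right`, giving a nontrivial tri-separation with
one more separator vertex. -/
lemma eq_of_maximal (hG : IsKConnected 3 G) {A B : Set V} (h : IsTriSeparation G A B)
    (hmax : ∀ A' B' : Set V, IsTriSeparation G A' B' → IsNontrivial G A' B' →
        (A' ∩ B').ncard ≤ (A ∩ B).ncard)
    (u t s : V) (huA : u ∈ A) (huB : u ∉ B) (htA : t ∉ A) (hsA : s ∈ A) (hsB : s ∈ B)
    (hut : G.Adj u t) (hus : G.Adj u s) (u' : V) (huA' : u' ∈ A) (huB' : u' ∉ B) : u' = u := by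
  by_contra hne
  have htB := (h.1.mem_or t).resolve_left htA
  have h' := h.insert_right hG huA huB htA hsB hut hus huA' huB' hne hsA
  have hle := hmax A (insert u B) h' (h'.isNontrivial hG
    (two_le_encard_iff.2 ⟨u, huA, u', huA', fun e => hne e.symm⟩)
    (two_le_encard_iff.2 ⟨u, Or.inl rfl, t, Or.inr htB, hut.ne⟩))
  rw [Set.inter_insert_of_mem huA, Set.ncard_insert_of_notMem (fun e => huB e.2) h.finite_inter]
    at hle
  omega

/-- `K` is a nonempty union of components of `G - X`. -/
structure IsPart (G : SimpleGraph V) (X K : Set V) : Prop where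
  nonempty : K.Nonempty
  notMem : ∀ a ∈ K, a ∉ X
  adj : ∀ a ∈ K, ∀ b, G.Adj a b → b ∈ K ∨ b ∈ X

lemma isPart_corner {A B C D : Set V} (hAB : A ∪ B = Set.univ) (hCD : C ∪ D = Set.univ)
    (hST : ∀ w, (w ∈ A ∧ w ∈ B) ↔ (w ∈ C ∧ w ∈ D))
    (h₁ : ∀ a b, a ∈ A → a ∉ B → b ∈ B → b ∉ A → ¬ G.Adj a b)
    (h₂ : ∀ a b, a ∈ C → a ∉ D → b ∈ D → b ∉ C → ¬ G.Adj a b)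
    (hne : ∃ w, w ∈ A ∧ w ∉ B ∧ w ∈ C ∧ w ∉ D) :
    IsPart G (A ∩ B) {w | w ∉ B ∧ w ∉ D} where
  nonempty := by
    obtain ⟨w, -, h1, -, h2⟩ := hne
    exact ⟨w, h1, h2⟩
  notMem a ha h := ha.1 h.2
  adj a ha b hab := by
    have hor : ∀ w, (w ∈ A ∨ w ∈ B) ∧ (w ∈ C ∨ w ∈ D) := fun w =>
      ⟨Set.ext_iff.1 hAB w |>.2 trivial, Set.ext_iff.1 hCD w |>.2 trivial⟩
    have h1 := h₁ a b
    have h2 := h₂ a b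
    have h3 := hST b
    have h4 := hor a
    have h5 := hor b
    have h6 := ha.1
    have h7 := ha.2
    simp only [Set.mem_ofPred_eq, Set.mem_inter_iff]
    by_cases hb : b ∈ B <;> by_cases hd : b ∈ D <;> grind

lemma IsTriSeparation.exists_mem_corner (hG : IsKConnected 3 G) (hst : IsStrong G)
    {A B C D : Set V} (h : IsTriSeparation G A B) (h' : IsTriSeparation G C D) :
    (∃ w, w ∈ A ∧ w ∉ B ∧ w ∈ C ∧ w ∉ D) ∨ (∃ w, w ∈ A ∧ w ∉ B ∧ w ∈ D ∧ w ∉ C) := by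
  by_contra hcon
  rw [not_or] at hcon
  push Not at hcon
  refine h.not_subset_separator hG hst h' fun w hwA hwB => ?_
  have := hcon.1 w hwA hwB
  have := hcon.2 w hwA hwB
  have := h'.1.mem_or w
  tauto

/-- Each of the four strict sides contains a nonempty corner. With the corners seen as a 4-cycle
whose edges are the strict sides, a vertex cover contains two opposite vertices. -/
lemma IsTriSeparation.isCross_or (hG : IsKConnected 3 G) (hst : IsStrong G)
    {A B C D : Set V} (h : IsTriSeparation G A B) (h' : IsTriSeparation G C D) :
    IsCross G A B C D ∨ IsCross G A B D C := by
  have hcomm : ∀ {A B C D : Set V}, (∃ w, w ∈ A ∧ w ∉ B ∧ w ∈ C ∧ w ∉ D) →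
      ∃ w, w ∈ C ∧ w ∉ D ∧ w ∈ A ∧ w ∉ B := fun ⟨w, h1, h2, h3, h4⟩ => ⟨w, h3, h4, h1, h2⟩
  rcases h.exists_mem_corner hG hst h' with h1 | h1
  · rcases h'.symm.exists_mem_corner hG hst h with h2 | h2
    · rcases h.symm.exists_mem_corner hG hst h' with h3 | h3
      · exact Or.inl ⟨h, h', hcomm h2, h3⟩
      · exact Or.inr ⟨h, h'.symm, h1, h3⟩
    · exact Or.inr ⟨h, h'.symm, h1, hcomm h2⟩
  · rcases h'.exists_mem_corner hG hst h with h2 | h2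
    · rcases h.symm.exists_mem_corner hG hst h' with h3 | h3
      · exact Or.inl ⟨h, h', h1, h3⟩
      · exact Or.inr ⟨h, h'.symm, hcomm h2, h3⟩
    · exact Or.inl ⟨h, h', h1, hcomm h2⟩

/-- If some tri-separation is nontrivial but none is totally nested, then either there is a
necklace, or three vertices separate the graph into four parts. -/
lemma exists_isPart (hG : IsKConnected 3 G) (hno : ¬ HasTotallyNestedNontrivial G)
    (hw : ¬ IsWheel G) (hex : ∃ A B : Set V, IsTriSeparation G A B ∧ IsNontrivial G A B) :
    ∃ X K₁ K₂ K₃ K₄ : Set V, X.encard = 3 ∧ IsPart G X K₁ ∧ IsPart G X K₂ ∧ IsPart G X K₃ ∧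
      IsPart G X K₄ ∧ Disjoint K₁ K₂ ∧ Disjoint K₁ K₃ ∧ Disjoint K₁ K₄ ∧ Disjoint K₂ K₃ ∧
      Disjoint K₂ K₄ ∧ Disjoint K₃ K₄ := by
  have hst : IsStrong G := by
    intro A B h u huA huB hle
    exact (h.hasTotallyNestedNontrivial_or_isWheel hG huA huB hle).elim hno hw
  obtain ⟨A, B, h, hnt, hmax⟩ := exists_maximal_isTriSeparation hex
  have hM₁ := eq_of_maximal hG h hmax
  have hM₂ := eq_of_maximal hG h.symm (by simpa only [Set.inter_comm B A] using hmax)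
  have hcross : ∃ C D, IsTriSeparation G C D ∧ ¬ Nested A B C D := by
    by_contra hcon
    push Not at hcon
    exact hno ⟨A, B, h, hnt, hcon⟩
  obtain ⟨C, D, h', hn⟩ := hcross
  have key : ∀ C D, ¬ Nested A B C D → IsCross G A B C D → ∃ X K₁ K₂ K₃ K₄ : Set V,
      X.encard = 3 ∧ IsPart G X K₁ ∧ IsPart G X K₂ ∧ IsPart G X K₃ ∧
      IsPart G X K₄ ∧ Disjoint K₁ K₂ ∧ Disjoint K₁ K₃ ∧ Disjoint K₁ K₄ ∧ Disjoint K₂ K₃ ∧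
      Disjoint K₂ K₄ ∧ Disjoint K₃ K₄ := by
    intro C D hn hc
    rcases hc.exists_isNecklace_or hG hn hM₁ hM₂ with ⟨v, P, Q₁, Q₂, Q₃, x₀, x₁, x₂, x₃, hN⟩ |
      ⟨h1, h2, h3, h4, h5, h6⟩
    · exact absurd (hN.isWheel hG hno) hw
    have hAB := hc.tri₁.1.1
    have hCD := hc.tri₂.1.1
    have hBA := hc.tri₁.symm.1.1
    have hDC := hc.tri₂.symm.1.1
    have h3' := fun a b h1 h2 h5 h6 h7 => h3 b a h5 h6 h1 h2 (SimpleGraph.Adj.symm h7)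
    have h4' := fun a b h1 h2 h5 h6 h7 => h4 b a h5 h6 h1 h2 (SimpleGraph.Adj.symm h7)
    have k1 := isPart_corner hAB hCD h1 h3 h4 h5
    have k2 := isPart_corner hAB hDC (by simpa only [and_comm] using h1) h3 h4' hc.ne₁
    have k3 := isPart_corner hBA hCD (by simpa only [and_comm] using h1) h3' h4 hc.ne₂
    have k4 := isPart_corner hBA hDC (by simpa only [and_comm] using h1) h3' h4' h6
    rw [Set.inter_comm] at k3 k4
    have hor : ∀ w, (w ∈ A ∨ w ∈ B) ∧ (w ∈ C ∨ w ∈ D) := fun w =>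
      ⟨hc.tri₁.1.mem_or w, hc.tri₂.1.mem_or w⟩
    refine ⟨_, _, _, _, _, h2, k1, k2, k3, k4, ?_⟩
    simp only [Set.disjoint_left, Set.mem_ofPred_eq]
    refine ⟨?_, ?_, ?_, ?_, ?_, ?_⟩ <;> intro w <;> have := hor w <;> tauto
  rcases h.isCross_or hG hst h' with h1 | h1
  · exact key C D hn h1
  · exact key D C (fun e => hn e.swap_right) h1

/-! ### Parts left by three vertices. -/

namespace IsPart

variable {X K K' C D : Set V}

lemma exists_adj (hG : IsKConnected 3 G) (hX : X.encard = 3) (hK : IsPart G X K)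
    (hR : ∃ z, z ∉ K ∧ z ∉ X) {x : V} (hx : x ∈ X) : ∃ k ∈ K, G.Adj x k := by
  by_contra hcon
  push Not at hcon
  obtain ⟨k, hk⟩ := hK.nonempty
  obtain ⟨z, hzK, hzX⟩ := hR
  refine hG.not_separated K (Sum.inl '' (X \ {x}))
    (by rw [Sum.inl_injective.encard_image]; exact encard_sdiff_singleton_le_two hX hx)
    hk ?_ hzK ?_ ?_
  · rintro ⟨w, hw, h⟩
    exact hK.notMem k hk (Sum.inl_injective h ▸ hw.1)
  · rintro ⟨w, hw, h⟩
    exact hzX (Sum.inl_injective h ▸ hw.1)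
  · intro a b ha hb hab
    refine Or.inr (Or.inl ⟨b, ⟨(hK.adj a ha b hab).resolve_left hb, ?_⟩, rfl⟩)
    rintro rfl
    exact hcon a ha hab.symm

lemma compl (X : Set V) (hX : Xᶜ.Nonempty) : IsPart G X Xᶜ where
  nonempty := hX
  notMem a ha := ha
  adj a _ b _ := by
    by_cases hb : b ∈ X
    · exact Or.inr hb
    · exact Or.inl hb

lemma sdiff (hK : IsPart G X K) (hK' : IsPart G X K') (hne : (K \ K').Nonempty) :
    IsPart G X (K \ K') where
  nonempty := hne
  notMem a ha := hK.notMem a ha.1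
  adj a ha b hab := by
    rcases hK.adj a ha.1 b hab with hb | hb
    · by_cases hb' : b ∈ K'
      · rcases hK'.adj b hb' a hab.symm with h | h
        · exact absurd h ha.2
        · exact absurd h (hK.notMem a ha.1)
      · exact Or.inl ⟨hb, hb'⟩
    · exact Or.inr hb

lemma inter (hK : IsPart G X K) (hK' : IsPart G X K') (hne : (K ∩ K').Nonempty) :
    IsPart G X (K ∩ K') where
  nonempty := hne
  notMem a ha := hK.notMem a ha.1
  adj a ha b hab := by
    rcases hK.adj a ha.1 b hab with hb | hb
    · exact (hK'.adj a ha.2 b hab).imp_left fun hb' => ⟨hb, hb'⟩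
    · exact Or.inr hb

/-- The component of `k`, defined as the intersection of all parts containing `k`. A part inside it
that missed `k` could be removed from it, leaving a smaller part with `k`. -/
lemma exists_minimal {k : V} (hk : k ∉ X) :
    ∃ K, k ∈ K ∧ IsPart G X K ∧ ∀ K' ⊆ K, IsPart G X K' → K' = K := by
  have hpart : IsPart G X {w | ∀ K', IsPart G X K' → k ∈ K' → w ∈ K'} := by
    refine ⟨⟨k, fun K' _ h => h⟩, fun a ha => ?_, fun a ha b hab => ?_⟩
    · exact ha Xᶜ (compl X ⟨k, hk⟩) hk
    · by_cases hb : b ∈ X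
      · exact Or.inr hb
      · exact Or.inl fun K' hK' hk' => (hK'.adj a (ha K' hK' hk') b hab).resolve_right hb
  refine ⟨_, fun K' _ h => h, hpart, fun K' hsub hK' => hsub.antisymm fun w hw => ?_⟩
  refine hw K' hK' ?_
  by_contra hk'
  obtain ⟨z, hz⟩ := hK'.nonempty
  exact (hsub hz _ (hpart.sdiff hK' ⟨k, fun K' _ h => h, hk'⟩) ⟨fun K' _ h => h, hk'⟩).2 hz

/-- If `(C, D)` separates two vertices of `X`, then its separator has an element in every part. -/
lemma exists_mem_sep (hG : IsKConnected 3 G) (hX : X.encard = 3) (hK : IsPart G X K)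
    (hR : ∃ z, z ∉ K ∧ z ∉ X) (hCD : IsMixedSeparation C D) {x y : V} (hx : x ∈ X) (hxD : x ∉ D)
    (hy : y ∈ X) (hyC : y ∉ C) :
    ∃ e ∈ sep G C D, ∃ a ∈ K, e = Sum.inl a ∨ ∃ b, G.Adj a b ∧ e = Sum.inr s(a, b) := by
  by_contra hcon
  push Not at hcon
  have hv : ∀ a ∈ K, a ∈ C → a ∉ D := fun a ha hC hD =>
    (hcon _ (inl_mem_sep.2 ⟨hC, hD⟩) a ha).1 rfl
  have he : ∀ a ∈ K, ∀ b, G.Adj a b → Sum.inr s(a, b) ∉ sep G C D := fun a ha b hab hs =>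
    (hcon _ hs a ha).2 b hab rfl
  have hxC := (hCD.mem_or x).resolve_right hxD
  have hyD := (hCD.mem_or y).resolve_left hyC
  obtain ⟨k, hk, hxk⟩ := hK.exists_adj hG hX hR hx
  obtain ⟨z, hz, hyz⟩ := hK.exists_adj hG hX hR hy
  have hkC : k ∈ C := by
    by_contra hkC
    exact he k hk x hxk.symm (inr_mem_sep.2 ⟨hxk.symm,
      Or.inr ⟨hxC, hxD, (hCD.mem_or k).resolve_left hkC, hkC⟩⟩)
  have hzC : z ∉ C := fun hzC =>
    he z hz y hyz.symm (inr_mem_sep.2 ⟨hyz.symm, Or.inl ⟨hzC, hv z hz hzC, hyD, hyC⟩⟩)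
  -- With no separator element at `K`, the set `K ∩ C` is attached only to vertices of `X` in `C`,
  -- hence not to `y`.
  refine hG.not_separated (K ∩ C) (Sum.inl '' (X \ {y}))
    (by rw [Sum.inl_injective.encard_image]; exact encard_sdiff_singleton_le_two hX hy)
    (k := k) ⟨hk, hkC⟩ ?_ (z := z) (fun e => hzC e.2) ?_ ?_
  · rintro ⟨w, hw, h⟩
    exact hK.notMem k hk (Sum.inl_injective h ▸ hw.1)
  · rintro ⟨w, hw, h⟩
    exact hK.notMem z hz (Sum.inl_injective h ▸ hw.1)
  · rintro a b ⟨haK, haC⟩ hb hab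
    have hbC : b ∈ C := by
      by_contra hbC
      exact he a haK b hab (inr_mem_sep.2 ⟨hab,
        Or.inl ⟨haC, hv a haK haC, (hCD.mem_or b).resolve_left hbC, hbC⟩⟩)
    refine Or.inr (Or.inl ⟨b, ⟨(hK.adj a haK b hab).resolve_left fun h => hb ⟨h, hbC⟩, ?_⟩, rfl⟩)
    exact fun e => hyC (e ▸ hbC)

lemma ne_of_disjoint (hK : IsPart G X K) (hK' : IsPart G X K') (hd : Disjoint K K')
    {e e' : V ⊕ Sym2 V} (he : ∃ a ∈ K, e = Sum.inl a ∨ ∃ b, G.Adj a b ∧ e = Sum.inr s(a, b))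
    (he' : ∃ a ∈ K', e' = Sum.inl a ∨ ∃ b, G.Adj a b ∧ e' = Sum.inr s(a, b)) : e ≠ e' := by
  rintro rfl
  obtain ⟨a, ha, h⟩ := he
  obtain ⟨a', ha', h'⟩ := he'
  have hd' := Set.disjoint_left.1 hd
  rcases h with rfl | ⟨b, hab, rfl⟩ <;> rcases h' with h' | ⟨b', hab', h'⟩
  · cases h'
    exact hd' ha ha'
  · cases h'
  · cases h'
  · rw [Sum.inr.injEq, Sym2.eq_iff] at h'
    rcases h' with ⟨rfl, rfl⟩ | ⟨rfl, rfl⟩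
    · exact hd' ha ha'
    · rcases hK'.adj b ha' a hab.symm with h | h
      · exact hd' ha h
      · exact hK.notMem a ha h

/-- If `X` is included in `C` but not in the separator, and `K` has a vertex in `D \ C`, then all
elements of the separator are in `X` or meet `K`. -/
lemma sep_subset (hG : IsKConnected 3 G) (hK : IsPart G X K)
    (hCD : IsTriSeparation G C D) (hXC : X ⊆ C) {x k : V} (hx : x ∈ X) (hxD : x ∉ D) (hk : k ∈ K)
    (hkC : k ∉ C) : ∀ e ∈ sep G C D, (∃ w, e = Sum.inl w ∧ (w ∈ X ∨ w ∈ K)) ∨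
      ∃ a ∈ K, ∃ b, e = Sum.inr s(a, b) := by
  let W : Set (V ⊕ Sym2 V) := {e | e ∈ sep G C D ∧ ((∃ w, e = Sum.inl w ∧ (w ∈ X ∨ w ∈ K)) ∨
      ∃ a ∈ K, ∃ b, e = Sum.inr s(a, b))}
  have hsub : W ⊆ sep G C D := fun e he => he.1
  -- The elements in `W` already separate `K \ C` from `x`, so there are three of them and they are
  -- the whole separator.
  have hW : ¬ W.encard ≤ 2 := by
    intro hle
    refine hG.not_separated (K \ C) W hle ⟨hk, hkC⟩ ?_ (z := x) (fun e => e.2 (hXC hx)) ?_ ?_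
    · exact fun h => hkC (inl_mem_sep.1 h.1).1
    · exact fun h => hxD (inl_mem_sep.1 h.1).2
    · rintro a b ⟨haK, haC⟩ hb hab
      have haD := (hCD.1.mem_or a).resolve_left haC
      have hb' := hK.adj a haK b hab
      have hbC : b ∈ C := by
        rcases hb' with h | h
        · by_contra hbC
          exact hb ⟨h, hbC⟩
        · exact hXC h
      by_cases hbD : b ∈ D
      · exact Or.inr (Or.inl ⟨inl_mem_sep.2 ⟨hbC, hbD⟩, Or.inl ⟨b, rfl, hb'.symm⟩⟩)
      · exact Or.inr (Or.inr ⟨inr_mem_sep.2 ⟨hab, Or.inr ⟨hbC, hbD, haD, haC⟩⟩,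
          Or.inr ⟨a, haK, b, rfl⟩⟩)
  have hW' : 3 ≤ W.encard := by
    rw [not_le] at hW
    exact Order.add_one_le_of_lt hW
  have heq : W = sep G C D := ((Set.finite_of_encard_eq_coe hCD.encard_sep).subset
    hsub).eq_of_subset_of_encard_le hsub (by rwa [hCD.encard_sep])
  intro e he
  rw [← heq] at he
  exact he.2

end IsPart

lemma exists_equiv_fin_three {X : Set V} (hX : X.encard = 3) : Nonempty (Fin 3 ≃ X) := by
  have : Finite X := Set.finite_of_encard_eq_coe hX
  have hcard : Nat.card X = 3 := by
    rw [Nat.card_coe_set_eq, Set.ncard, hX]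
    rfl
  exact ⟨(Finite.equivFinOfCardEq hcard).symm⟩

lemma isKThreeM_of_adj_iff {X : Set V} (hX : X.encard = 3) (hX' : 3 ≤ Xᶜ.encard)
    (hadj : ∀ a b, G.Adj a b ↔ ¬ (a ∈ X ↔ b ∈ X)) : IsKThreeM G := by
  classical
  obtain ⟨e₀⟩ := exists_equiv_fin_three hX
  let e : Fin 3 ⊕ ↥Xᶜ ≃ V := (e₀.sumCongr (Equiv.refl _)).trans (Equiv.Set.sumCompl X)
  have hl : ∀ i, e (Sum.inl i) ∈ X := fun i => by simp [e]
  have hr : ∀ i, e (Sum.inr i) ∉ X := fun i => i.2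
  refine ⟨↥Xᶜ, hX', ⟨SimpleGraph.Iso.symm ⟨e, ?_⟩⟩⟩
  rintro (i | i) (j | j) <;> simp [hadj, hl, hr]

/-- The part `K` together with the vertices of `X` that have two neighbours in `K ∪ X`. -/
def partSide (G : SimpleGraph V) (X K : Set V) : Set V :=
  K ∪ {x | x ∈ X ∧ ∃ a b, (a ∈ K ∨ a ∈ X) ∧ (b ∈ K ∨ b ∈ X) ∧ a ≠ b ∧ G.Adj x a ∧ G.Adj x b}

lemma partSide_subset (X K : Set V) : partSide G X K ⊆ K ∪ X :=
  Set.union_subset_union_right _ fun _ h => h.1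

namespace IsPart

variable {X K P Q C D : Set V}

/-- Each vertex of `X` contributes itself or its only edge into `K`. The two further parts `P` and
`Q` supply the two neighbours outside `K`. -/
lemma isTriSeparation (hG : IsKConnected 3 G) (hX : X.encard = 3) (hK : IsPart G X K)
    (hP : IsPart G X P) (hQ : IsPart G X Q) (hKP : Disjoint K P) (hKQ : Disjoint K Q)
    (hPQ : Disjoint P Q) : IsTriSeparation G (partSide G X K) Kᶜ := by
  have hKP' := Set.disjoint_left.1 hKP
  have hKQ' := Set.disjoint_left.1 hKQ
  have hPQ' := Set.disjoint_left.1 hPQ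
  obtain ⟨p, hp⟩ := hP.nonempty
  obtain ⟨q, hq⟩ := hQ.nonempty
  obtain ⟨k, hk⟩ := hK.nonempty
  have hpX := hP.notMem p hp
  have hpK : p ∉ K := fun h => hKP' h hp
  have hmix : IsMixedSeparation (partSide G X K) Kᶜ := by
    refine ⟨?_, ⟨k, Or.inl hk, fun h => h hk⟩, ⟨p, hpK, ?_⟩⟩
    · ext w
      by_cases hw : w ∈ K
      · simp [hw, partSide]
      · simp [hw]
    · exact fun h => (partSide_subset X K h).elim hpK hpX
  have hnbr : ∀ x ∈ X, ∀ b, (b ∈ K ∨ b ∈ X) → G.Adj x b → b ∈ partSide G X K := by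
    rintro x hx b (hb | hb) hxb
    · exact Or.inl hb
    · obtain ⟨a, ha, hba⟩ := hK.exists_adj hG hX ⟨p, hpK, hpX⟩ hb
      exact Or.inr ⟨hb, a, x, Or.inl ha, Or.inr hx, fun e => hK.notMem a ha (e ▸ hx), hba,
        hxb.symm⟩
  refine ⟨hmix, le_antisymm ?_ (hG.three_le_order hmix), ?_⟩
  · have hf : ∀ x : V, ∃ e : V ⊕ Sym2 V, x ∈ X → (x ∈ partSide G X K → e = Sum.inl x) ∧
        (x ∉ partSide G X K → ∀ a ∈ K, G.Adj x a → e = Sum.inr s(x, a)) := by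
      intro x
      by_cases hx : x ∈ X
      · by_cases hxA : x ∈ partSide G X K
        · exact ⟨Sum.inl x, fun _ => ⟨fun _ => rfl, fun h => absurd hxA h⟩⟩
        · obtain ⟨a, ha, hxa⟩ := hK.exists_adj hG hX ⟨p, hpK, hpX⟩ hx
          refine ⟨Sum.inr s(x, a), fun _ => ⟨fun h => absurd h hxA, fun _ b hb hxb => ?_⟩⟩
          by_contra hne
          exact hxA (Or.inr ⟨hx, a, b, Or.inl ha, Or.inl hb, fun e => hne (by rw [e]), hxa, hxb⟩)
      · exact ⟨Sum.inl x, fun h => absurd h hx⟩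
    choose f hf using hf
    rw [order_eq_encard_sep, ← hX]
    refine (Set.encard_le_encard (t := f '' X) ?_).trans (Set.encard_image_le _ _)
    rw [sep_subset_iff]
    constructor
    · intro w hwA hwK
      have hwX : w ∈ X := (partSide_subset X K hwA).resolve_left hwK
      exact ⟨w, hwX, (hf w hwX).1 hwA⟩
    · intro a b hab haA haK hbK hbA
      have haK' : a ∈ K := not_not.1 haK
      have hbX := (hK.adj a haK' b hab).resolve_left hbK
      refine ⟨b, hbX, ?_⟩
      rw [Sym2.eq_swap]
      exact (hf b hbX).2 hbA a haK' hab.symm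
  · rintro x ⟨hxA, hxK⟩
    have hx : x ∈ X := (partSide_subset X K hxA).resolve_left hxK
    rw [two_le_encard_iff, two_le_encard_iff]
    constructor
    · obtain h | ⟨-, a, b, ha, hb, hab, hxa, hxb⟩ := hxA
      · exact absurd h hxK
      · exact ⟨a, ⟨hxa, hnbr x hx a ha hxa⟩, b, ⟨hxb, hnbr x hx b hb hxb⟩, hab⟩
    · obtain ⟨a, ha, hxa⟩ := hP.exists_adj hG hX ⟨k, fun h => hKP' hk h, hK.notMem k hk⟩ hx
      obtain ⟨b, hb, hxb⟩ := hQ.exists_adj hG hX ⟨k, fun h => hKQ' hk h, hK.notMem k hk⟩ hx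
      exact ⟨a, ⟨hxa, fun h => hKP' h ha⟩, b, ⟨hxb, fun h => hKQ' h hb⟩,
        fun e => hPQ' ha (e ▸ hb)⟩

/-- If `D \ C` met two disjoint parts, `sep_subset` for both would confine the separator to `X`
without `x`, which has two elements. -/
lemma not_sep_parts (hG : IsKConnected 3 G) (hX : X.encard = 3) (hK : IsPart G X K)
    (hP : IsPart G X P) (hKP : Disjoint K P) (hCD : IsTriSeparation G C D) (hXC : X ⊆ C)
    {x k p : V} (hx : x ∈ X) (hxD : x ∉ D) (hk : k ∈ K) (hkC : k ∉ C) (hp : p ∈ P) : p ∈ C := by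
  by_contra hpC
  have h1 := hK.sep_subset hG hCD hXC hx hxD hk hkC
  have h2 := hP.sep_subset hG hCD hXC hx hxD hp hpC
  have hKP' := Set.disjoint_left.1 hKP
  have hsub : sep G C D ⊆ Sum.inl '' (X \ {x}) := by
    intro e he
    rcases h1 e he with ⟨w, rfl, hw⟩ | ⟨a, ha, b, rfl⟩
    · rcases h2 _ he with ⟨w', h, hw'⟩ | ⟨a, ha, b, h⟩
      · cases h
        refine ⟨w, ⟨?_, ?_⟩, rfl⟩
        · rcases hw with hw | hw
          · exact hw
          · exact hw'.resolve_right fun h => hKP' hw h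
        · rintro rfl
          exact hxD (inl_mem_sep.1 he).2
      · cases h
    · exfalso
      rcases h2 _ he with ⟨w', h, hw'⟩ | ⟨a', ha', b', h⟩
      · cases h
      · have hab := (inr_mem_sep.1 he).1
        exact hK.ne_of_disjoint hP hKP ⟨a, ha, Or.inr ⟨b, hab, rfl⟩⟩
          ⟨a', ha', Or.inr ⟨b', by rw [Sum.inr.injEq] at h; rwa [← SimpleGraph.mem_edgeSet, ← h],
            h⟩⟩ rfl
  have h3 := Set.encard_le_encard hsub
  rw [hCD.encard_sep, Sum.inl_injective.encard_image] at h3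
  exact absurd (h3.trans (encard_sdiff_singleton_le_two hX hx)) (by norm_num)

/-- If `X` is also in `D`, it is the separator of `(C, D)`, and minimality keeps `K` on one side.
Otherwise `D \ C` lies in exactly one of `K` and the rest of `G - X`, and `sep_subset` confines `D`
accordingly. -/
lemma nested (hG : IsKConnected 3 G) (hX : X.encard = 3) (hK : IsPart G X K)
    (hmin : ∀ K' ⊆ K, IsPart G X K' → K' = K) (hR : IsPart G X (X ∪ K)ᶜ)
    (hCD : IsTriSeparation G C D) (hXC : X ⊆ C) : Nested (partSide G X K) Kᶜ C D := by
  have hKR : Disjoint K (X ∪ K)ᶜ := Set.disjoint_left.2 fun w hw hw' => hw' (Or.inr hw)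
  have hAsub := partSide_subset (G := G) X K
  by_cases hXD : X ⊆ D
  · have hT : Sum.inl '' X = sep G C D := by
      have hsub : Sum.inl '' X ⊆ sep G C D := by
        rintro _ ⟨w, hw, rfl⟩
        exact inl_mem_sep.2 ⟨hXC hw, hXD hw⟩
      refine ((Set.finite_of_encard_eq_coe hCD.encard_sep).subset
        hsub).eq_of_subset_of_encard_le hsub ?_
      rw [hCD.encard_sep, Sum.inl_injective.encard_image, hX]
    have hTX : ∀ w, w ∈ C → w ∈ D → w ∈ X := by
      intro w hC hD
      have : Sum.inl w ∈ sep G C D := inl_mem_sep.2 ⟨hC, hD⟩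
      rw [← hT] at this
      simpa using this
    have hE : ∀ a b, G.Adj a b → a ∈ C → a ∉ D → b ∈ C := by
      intro a b hab haC haD
      by_contra hbC
      have : Sum.inr s(a, b) ∈ sep G C D :=
        inr_mem_sep.2 ⟨hab, Or.inl ⟨haC, haD, (hCD.1.mem_or b).resolve_left hbC, hbC⟩⟩
      rw [← hT] at this
      simp at this
    by_cases hne : (K ∩ C).Nonempty
    · have hpart : IsPart G X (K ∩ C) := by
        refine ⟨hne, fun a ha => hK.notMem a ha.1, fun a ha b hab => ?_⟩
        refine (hK.adj a ha.1 b hab).imp_left fun hb => ⟨hb, hE a b hab ha.2 fun haD => ?_⟩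
        exact hK.notMem a ha.1 (hTX a ha.2 haD)
      have hKC : K ⊆ C := by
        rw [← hmin _ Set.inter_subset_left hpart]
        exact Set.inter_subset_right
      refine Or.inl ⟨hAsub.trans (Set.union_subset hKC hXC), fun w hw hwK => ?_⟩
      exact hK.notMem w hwK (hTX w (hKC hwK) hw)
    · have hKC : ∀ w ∈ K, w ∉ C := fun w hw hC => hne ⟨w, hw, hC⟩
      refine Or.inr (Or.inr (Or.inl ⟨hAsub.trans (Set.union_subset ?_ hXD), fun w hw hwK => ?_⟩))
      · exact fun w hw => (hCD.1.mem_or w).resolve_left (hKC w hw)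
      · exact hKC w hwK hw
  · obtain ⟨x, hx, hxD⟩ := Set.not_subset.1 hXD
    obtain ⟨d, hdD, hdC⟩ := hCD.1.2.2
    by_cases hdK : d ∈ K
    · have hRC : ∀ w ∈ (X ∪ K)ᶜ, w ∈ C := fun w hw =>
        hK.not_sep_parts hG hX hR hKR hCD hXC hx hxD hdK hdC hw
      have hTs := hK.sep_subset hG hCD hXC hx hxD hdK hdC
      have hDs : ∀ w ∈ D, w ∈ X ∨ w ∈ K := by
        intro w hwD
        by_contra hcon
        have hwC := hRC w hcon
        rcases hTs _ (inl_mem_sep.2 ⟨hwC, hwD⟩) with ⟨w', h, hw'⟩ | ⟨a, _, b, h⟩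
        · cases h
          exact hcon hw'
        · cases h
      refine Or.inr (Or.inl ⟨fun w hw => ?_, fun w hw => ?_⟩)
      · by_cases hwX : w ∈ X
        · exact hXC hwX
        · exact hRC w fun h => h.elim hwX hw
      · rcases hDs w hw with hwX | hwK
        · obtain ⟨a, ⟨hwa, ha⟩, b, ⟨hwb, hb⟩, hab⟩ :=
            two_le_encard_iff.1 (hCD.2.2 w ⟨hXC hwX, hw⟩).2
          exact Or.inr ⟨hwX, a, b, (hDs a ha).symm, (hDs b hb).symm, hab, hwa, hwb⟩
        · exact Or.inl hwK
    · have hdR : d ∈ (X ∪ K)ᶜ := fun h => h.elim (fun h => hdC (hXC h)) hdK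
      have hKC : ∀ w ∈ K, w ∈ C := fun w hw =>
        hR.not_sep_parts hG hX hK hKR.symm hCD hXC hx hxD hdR hdC hw
      refine Or.inl ⟨hAsub.trans (Set.union_subset hKC hXC), fun w hw hwK => ?_⟩
      rcases hR.sep_subset hG hCD hXC hx hxD hdR hdC _ (inl_mem_sep.2 ⟨hKC w hwK, hw⟩) with
        ⟨w', h, hw'⟩ | ⟨a, _, b, h⟩
      · cases h
        rcases hw' with h | h
        · exact hK.notMem w hwK h
        · exact h (Or.inr hwK)
      · cases h

end IsPart

lemma not_adj_of_forall_eq {X : Set V} (hX : ∀ K, IsPart G X K →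
    (∀ K' ⊆ K, IsPart G X K' → K' = K) → K.Subsingleton) {a b : V} (ha : a ∉ X) (hb : b ∉ X) :
    ¬ G.Adj a b := by
  intro hab
  obtain ⟨K, haK, hK, hmin⟩ := IsPart.exists_minimal (G := G) ha
  exact hab.ne (hX K hK hmin haK ((hK.adj a haK b hab).resolve_right hb))

/-- Three vertices that separate the graph into at least four parts. -/
theorem hasTotallyNestedNontrivial_or_isKThreeM (hG : IsKConnected 3 G)
    {X K₁ K₂ K₃ K₄ : Set V} (hX : X.encard = 3) (h₁ : IsPart G X K₁) (h₂ : IsPart G X K₂)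
    (h₃ : IsPart G X K₃) (h₄ : IsPart G X K₄) (h₁₂ : Disjoint K₁ K₂) (h₁₃ : Disjoint K₁ K₃)
    (h₁₄ : Disjoint K₁ K₄) (h₂₃ : Disjoint K₂ K₃) (h₂₄ : Disjoint K₂ K₄) (h₃₄ : Disjoint K₃ K₄) :
    HasTotallyNestedNontrivial G ∨ IsKThreeM G := by
  have hout : ∀ {K P : Set V}, IsPart G X P → Disjoint K P → ∃ z, z ∉ K ∧ z ∉ X := by
    intro K P hP hKP
    obtain ⟨p, hp⟩ := hP.nonempty
    exact ⟨p, fun h => Set.disjoint_left.1 hKP h hp, hP.notMem p hp⟩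
  -- Otherwise each of the four parts contains or meets a separator element of its own, one too
  -- many.
  have hside : ∀ C D, IsTriSeparation G C D → X ⊆ C ∨ X ⊆ D := by
    intro C D hCD
    by_contra hcon
    rw [not_or, Set.not_subset, Set.not_subset] at hcon
    obtain ⟨⟨y, hy, hyC⟩, x, hx, hxD⟩ := hcon
    obtain ⟨e₁, he₁, m₁⟩ := h₁.exists_mem_sep hG hX (hout h₂ h₁₂) hCD.1 hx hxD hy hyC
    obtain ⟨e₂, he₂, m₂⟩ := h₂.exists_mem_sep hG hX (hout h₁ h₁₂.symm) hCD.1 hx hxD hy hyC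
    obtain ⟨e₃, he₃, m₃⟩ := h₃.exists_mem_sep hG hX (hout h₁ h₁₃.symm) hCD.1 hx hxD hy hyC
    obtain ⟨e₄, he₄, m₄⟩ := h₄.exists_mem_sep hG hX (hout h₁ h₁₄.symm) hCD.1 hx hxD hy hyC
    exact not_four_of_encard_eq_three hCD.encard_sep he₁ he₂ he₃ he₄
      (h₁.ne_of_disjoint h₂ h₁₂ m₁ m₂) (h₁.ne_of_disjoint h₃ h₁₃ m₁ m₃)
      (h₁.ne_of_disjoint h₄ h₁₄ m₁ m₄) (h₂.ne_of_disjoint h₃ h₂₃ m₂ m₃)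
      (h₂.ne_of_disjoint h₄ h₂₄ m₂ m₄) (h₃.ne_of_disjoint h₄ h₃₄ m₃ m₄)
  -- A minimal part that meets some `Kᵢ` lies inside it, so it avoids at least two of `K₁`, `K₂`,
  -- `K₃`.
  have htwo : ∀ K, IsPart G X K → (∀ K' ⊆ K, IsPart G X K' → K' = K) →
      ∃ P Q, IsPart G X P ∧ IsPart G X Q ∧ Disjoint K P ∧ Disjoint K Q ∧ Disjoint P Q := by
    intro K hK hmin
    have hdisj : ∀ {P Q}, IsPart G X P → Disjoint P Q → ¬ Disjoint K P → Disjoint K Q := by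
      intro P Q hP hPQ hKP
      rw [Set.not_disjoint_iff] at hKP
      have hKP' : K ⊆ P := by
        rw [← hmin _ Set.inter_subset_left (hK.inter hP hKP)]
        exact Set.inter_subset_right
      exact hPQ.mono_left hKP'
    by_cases k₁ : Disjoint K K₁
    · by_cases k₂ : Disjoint K K₂
      · exact ⟨K₁, K₂, h₁, h₂, k₁, k₂, h₁₂⟩
      · exact ⟨K₁, K₃, h₁, h₃, k₁, hdisj h₂ h₂₃ k₂, h₁₃⟩
    · exact ⟨K₂, K₃, h₂, h₃, hdisj h₁ h₁₂ k₁, hdisj h₁ h₁₃ k₁, h₂₃⟩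
  have hgood : ∀ K, IsPart G X K → (∀ K' ⊆ K, IsPart G X K' → K' = K) →
      2 ≤ (partSide G X K).encard → HasTotallyNestedNontrivial G := by
    intro K hK hmin hle
    obtain ⟨P, Q, hP, hQ, hKP, hKQ, hPQ⟩ := htwo K hK hmin
    have htri := hK.isTriSeparation hG hX hP hQ hKP hKQ hPQ
    obtain ⟨p, hp⟩ := hP.nonempty
    obtain ⟨q, hq⟩ := hQ.nonempty
    have hpK : p ∉ K := fun h => Set.disjoint_left.1 hKP h hp
    have hR : IsPart G X (X ∪ K)ᶜ := by
      rw [Set.compl_union]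
      have hXc : Xᶜ.Nonempty := ⟨p, hP.notMem p hp⟩
      exact (IsPart.compl X hXc).sdiff hK ⟨p, hP.notMem p hp, hpK⟩
    refine ⟨_, _, htri, htri.isNontrivial hG hle (two_le_encard_iff.2 ⟨p, hpK, q, fun h =>
      Set.disjoint_left.1 hKQ h hq, fun e => Set.disjoint_left.1 hPQ hp (e ▸ hq)⟩), ?_⟩
    intro C D hCD
    rcases hside C D hCD with h | h
    · exact hK.nested hG hX hmin hR hCD h
    · exact (hK.nested hG hX hmin hR hCD.symm h).swap_right
  rw [or_iff_not_imp_left]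
  intro hno
  have hsub : ∀ K, IsPart G X K → (∀ K' ⊆ K, IsPart G X K' → K' = K) → K.Subsingleton := by
    intro K hK hmin a ha b hb
    by_contra hab
    exact hno (hgood K hK hmin (two_le_encard_iff.2 ⟨a, Or.inl ha, b, Or.inl hb, hab⟩))
  obtain ⟨a₁, m₁⟩ := h₁.nonempty
  obtain ⟨a₂, m₂⟩ := h₂.nonempty
  obtain ⟨a₃, m₃⟩ := h₃.nonempty
  -- An edge `xy` inside `X` gives `x` a second neighbour in `K ∪ X`, so the side of `K` has two
  -- vertices.
  have hind : ∀ x y, x ∈ X → y ∈ X → ¬ G.Adj x y := by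
    intro x y hx hy hxy
    obtain ⟨K, -, hK, hmin⟩ := IsPart.exists_minimal (G := G) (h₁.notMem a₁ m₁)
    obtain ⟨P, Q, hP, hQ, hKP, hKQ, hPQ⟩ := htwo K hK hmin
    obtain ⟨k, hk⟩ := hK.nonempty
    obtain ⟨a, ha, hxa⟩ := hK.exists_adj hG hX (hout hP hKP) hx
    refine hno (hgood K hK hmin (two_le_encard_iff.2 ⟨k, Or.inl hk, x, Or.inr ⟨hx, a, y,
      Or.inl ha, Or.inr hy, fun e => hK.notMem a ha (e ▸ hy), hxa, hxy⟩,
      fun e => hK.notMem k hk (e ▸ hx)⟩))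
  have hfull : ∀ x k, x ∈ X → k ∉ X → G.Adj x k := by
    intro x k hx hk
    obtain ⟨K, hkK, hK, hmin⟩ := IsPart.exists_minimal (G := G) hk
    obtain ⟨P, Q, hP, hQ, hKP, hKQ, hPQ⟩ := htwo K hK hmin
    obtain ⟨a, ha, hxa⟩ := hK.exists_adj hG hX (hout hP hKP) hx
    exact hsub K hK hmin ha hkK ▸ hxa
  refine isKThreeM_of_adj_iff hX (three_le_encard_iff.2 ⟨a₁, h₁.notMem a₁ m₁, a₂, h₂.notMem a₂ m₂,
    a₃, h₃.notMem a₃ m₃, fun e => Set.disjoint_left.1 h₁₂ m₁ (e ▸ m₂),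
    fun e => Set.disjoint_left.1 h₁₃ m₁ (e ▸ m₃), fun e => Set.disjoint_left.1 h₂₃ m₂ (e ▸ m₃)⟩) ?_
  intro a b
  by_cases ha : a ∈ X <;> by_cases hb : b ∈ X
  · simp [ha, hb, hind a b ha hb]
  · simp [ha, hb, hfull a b ha hb]
  · simp [ha, hb, (hfull b a hb ha).symm]
  · simp [ha, hb, not_adj_of_forall_eq hsub ha hb]

/-! ### From 3-separations to nontrivial tri-separations. -/

lemma inducesClaw {X : Set V} {a : V} (hX : X.encard = 3) (ha : a ∉ X)
    (hadj : ∀ x ∈ X, G.Adj a x) (hind : ∀ x ∈ X, ∀ y ∈ X, ¬ G.Adj x y) :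
    InducesClaw G (insert a X) := by
  obtain ⟨e⟩ := exists_equiv_fin_three hX
  let f : Fin 1 ⊕ Fin 3 → ↥(insert a X) :=
    Sum.elim (fun _ => ⟨a, Or.inl rfl⟩) fun i => ⟨e i, Or.inr (e i).2⟩
  have hf : Function.Bijective f := by
    constructor
    · rintro (i | i) (j | j) hij
      · rw [Subsingleton.elim i j]
      · have h : a = e j := congrArg (fun w : ↥(insert a X) => (w : V)) hij
        exact absurd (h ▸ (e j).2) ha
      · have h : e i = a := congrArg (fun w : ↥(insert a X) => (w : V)) hij
        exact absurd (h ▸ (e i).2) ha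
      · have h : (e i : V) = e j := congrArg (fun w : ↥(insert a X) => (w : V)) hij
        rw [e.injective (Subtype.ext h)]
    · rintro ⟨w, rfl | hw⟩
      · exact ⟨Sum.inl 0, rfl⟩
      · exact ⟨Sum.inr (e.symm ⟨w, hw⟩), by simp [f]⟩
  refine ⟨SimpleGraph.Iso.symm ⟨Equiv.ofBijective f hf, ?_⟩⟩
  rintro (i | i) (j | j)
  · exact iff_of_false (G.irrefl) (by simp)
  · exact iff_of_true (hadj _ (e j).2) (by simp)
  · exact iff_of_true (hadj _ (e i).2).symm (by simp)
  · exact iff_of_false (hind _ (e i).2 _ (e j).2) (by simp)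

/-- The vertices of `A` that are not in the separator of `(A, B)` or have two neighbours in `A`. -/
def reducedSide (G : SimpleGraph V) (A B : Set V) : Set V :=
  {w | w ∈ A ∧ (w ∈ B → ∃ a ∈ A, ∃ b ∈ A, a ≠ b ∧ G.Adj w a ∧ G.Adj w b)}

namespace IsThreeSeparation

variable {A B : Set V}

lemma symm (h : IsThreeSeparation G A B) : IsThreeSeparation G B A :=
  ⟨h.1.symm, by rw [sepEdges_comm]; exact h.2.1, by rw [order_comm]; exact h.2.2⟩

lemma encard_inter (h : IsThreeSeparation G A B) : (A ∩ B).encard = 3 := by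
  have := h.2.2
  rw [order, h.2.1, Set.encard_empty, add_zero] at this
  exact this

lemma encard_sep (h : IsThreeSeparation G A B) : (sep G A B).encard = 3 := by
  rw [← order_eq_encard_sep]
  exact h.2.2

lemma not_adj (h : IsThreeSeparation G A B) {a b : V} (ha : a ∉ B) (hb : b ∉ A) :
    ¬ G.Adj a b := by
  intro hab
  have : s(a, b) ∈ sepEdges G A B := ⟨hab, a, ⟨(h.1.mem_or a).resolve_right ha, ha⟩, b,
    ⟨(h.1.mem_or b).resolve_left hb, hb⟩, rfl⟩
  rw [h.2.1] at this
  exact this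

lemma mem_reducedSide_of_adj (hG : IsKConnected 3 G) (h : IsThreeSeparation G A B) {x b : V}
    (hxA : x ∈ A) (hxB : x ∈ B) (hb : b ∈ A) (hxb : G.Adj x b) : b ∈ reducedSide G A B := by
  refine ⟨hb, fun hbB => ?_⟩
  obtain ⟨a, haA, haB, hba⟩ := hG.exists_adj_left h.1 h.encard_sep hb hbB
  exact ⟨a, haA, x, hxA, fun e => haB (e ▸ hxB), hba, hxb.symm⟩

/-- A separator vertex has three neighbours, and two of them share a side. -/
lemma mem_reducedSide_or (hG : IsKConnected 3 G) (h : IsThreeSeparation G A B) (w : V) :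
    w ∈ reducedSide G A B ∨ w ∈ reducedSide G B A := by
  by_cases hwA : w ∈ A
  · by_cases hwB : w ∈ B
    · obtain ⟨a, ha, b, hb, c, hc, hab, hac, hbc⟩ := three_le_encard_iff.1 (hG.three_le_degree w)
      by_contra hcon
      rw [not_or] at hcon
      have key : ∀ {A B : Set V}, w ∈ A → w ∉ reducedSide G A B → ∀ a b, a ∈ A → b ∈ A →
          G.Adj w a → G.Adj w b → a = b := by
        intro A B hA hw a b ha hb hwa hwb
        by_contra hab
        exact hw ⟨hA, fun _ => ⟨a, ha, b, hb, hab, hwa, hwb⟩⟩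
      have k₁ := key hwA hcon.1
      have k₂ := key hwB hcon.2
      have := k₁ a b
      have := k₁ a c
      have := k₁ b c
      have := k₂ a b
      have := k₂ a c
      have := k₂ b c
      have := h.1.mem_or a
      have := h.1.mem_or b
      have := h.1.mem_or c
      have ha' : G.Adj w a := ha
      have hb' : G.Adj w b := hb
      have hc' : G.Adj w c := hc
      grind
    · exact Or.inl ⟨hwA, fun h => absurd h hwB⟩
  · exact Or.inr ⟨(h.1.mem_or w).resolve_left hwA, fun h => absurd h hwA⟩

/-- A vertex of the separator that is not in the reduced side has only one neighbour in the side,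
and that neighbour is not in the separator. -/
lemma adj_unique (hG : IsKConnected 3 G) (h : IsThreeSeparation G A B) {x : V} (hxA : x ∈ A)
    (hxB : x ∈ B) (hx : x ∉ reducedSide G A B) :
    ∃ a, a ∉ B ∧ G.Adj x a ∧ ∀ b ∈ A, G.Adj x b → b = a := by
  obtain ⟨a, haA, haB, hxa⟩ := hG.exists_adj_left h.1 h.encard_sep hxA hxB
  refine ⟨a, haB, hxa, fun b hb hxb => ?_⟩
  by_contra hne
  exact hx ⟨hxA, fun _ => ⟨b, hb, a, haA, hne, hxb, hxa⟩⟩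

/-- Each vertex of `A ∩ B` either stays in the separator or is replaced by its unique edge into the
side that it leaves. Neighbours of separator vertices survive the reduction by
`mem_reducedSide_of_adj`. -/
lemma isTriSeparation (hG : IsKConnected 3 G) (h : IsThreeSeparation G A B) :
    IsTriSeparation G (reducedSide G A B) (reducedSide G B A) := by
  have hmix : IsMixedSeparation (reducedSide G A B) (reducedSide G B A) := by
    refine ⟨?_, ?_, ?_⟩
    · ext w
      simpa using h.mem_reducedSide_or hG w
    · obtain ⟨w, hA, hB⟩ := h.1.2.1
      exact ⟨w, ⟨hA, fun h => absurd h hB⟩, fun h => hB h.1⟩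
    · obtain ⟨w, hB, hA⟩ := h.1.2.2
      exact ⟨w, ⟨hB, fun h => absurd h hA⟩, fun h => hA h.1⟩
  refine ⟨hmix, le_antisymm ?_ (hG.three_le_order hmix), ?_⟩
  · have hf : ∀ x : V, ∃ e : V ⊕ Sym2 V, x ∈ A ∩ B →
        (x ∈ reducedSide G A B → x ∈ reducedSide G B A → e = Sum.inl x) ∧
        (x ∉ reducedSide G A B → ∀ b ∈ A, G.Adj x b → e = Sum.inr s(x, b)) ∧
        (x ∉ reducedSide G B A → ∀ b ∈ B, G.Adj x b → e = Sum.inr s(x, b)) := by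
      intro x
      by_cases hx : x ∈ A ∩ B
      · by_cases hxA : x ∈ reducedSide G A B
        · by_cases hxB : x ∈ reducedSide G B A
          · exact ⟨Sum.inl x, fun _ => ⟨fun _ _ => rfl, fun h => absurd hxA h,
              fun h => absurd hxB h⟩⟩
          · obtain ⟨a, -, -, ha⟩ := h.symm.adj_unique hG hx.2 hx.1 hxB
            exact ⟨Sum.inr s(x, a), fun _ => ⟨fun _ h => absurd h hxB, fun h => absurd hxA h,
              fun _ b hb hxb => by rw [ha b hb hxb]⟩⟩
        · have hxB := (h.mem_reducedSide_or hG x).resolve_left hxA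
          obtain ⟨a, -, -, ha⟩ := h.adj_unique hG hx.1 hx.2 hxA
          exact ⟨Sum.inr s(x, a), fun _ => ⟨fun h => absurd h hxA,
            fun _ b hb hxb => by rw [ha b hb hxb], fun h => absurd hxB h⟩⟩
      · exact ⟨Sum.inl x, fun h => absurd h hx⟩
    choose f hf using hf
    rw [order_eq_encard_sep, ← h.encard_inter]
    refine (Set.encard_le_encard (t := f '' (A ∩ B)) ?_).trans (Set.encard_image_le _ _)
    rw [sep_subset_iff]
    constructor
    · intro w hwA hwB
      exact ⟨w, ⟨hwA.1, hwB.1⟩, (hf w ⟨hwA.1, hwB.1⟩).1 hwA hwB⟩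
    · intro a b hab haA haB hbB hbA
      have hor : a ∈ B ∨ b ∈ A := by
        by_contra hcon
        rw [not_or] at hcon
        exact h.not_adj hcon.1 hcon.2 hab
      rcases hor with ha | hb
      · refine ⟨a, ⟨haA.1, ha⟩, (hf a ⟨haA.1, ha⟩).2.2 haB b hbB.1 hab⟩
      · refine ⟨b, ⟨hb, hbB.1⟩, ?_⟩
        rw [Sym2.eq_swap]
        exact (hf b ⟨hb, hbB.1⟩).2.1 hbA a haA.1 hab.symm
  · have key : ∀ {A B : Set V}, IsThreeSeparation G A B → ∀ w, w ∈ reducedSide G A B → w ∈ B →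
        2 ≤ (G.neighborSet w ∩ reducedSide G A B).encard := by
      intro A B h w hwA hwB
      obtain ⟨a, ha, b, hb, hab, hwa, hwb⟩ := hwA.2 hwB
      exact two_le_encard_iff.2 ⟨a, ⟨hwa, h.mem_reducedSide_of_adj hG hwA.1 hwB ha hwa⟩, b,
        ⟨hwb, h.mem_reducedSide_of_adj hG hwA.1 hwB hb hwb⟩, hab⟩
    rintro w ⟨hwA, hwB⟩
    exact ⟨key h w hwA hwB.1, key h.symm w hwB hwA.1⟩

/-- If a single vertex `a` remains, it is all of `A \ B` and the only neighbour in `A` of each of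
the three separator vertices: a claw. -/
lemma two_le_encard_reducedSide (hG : IsKConnected 3 G) (h : IsThreeSeparation G A B)
    (hA : ¬ InducesClaw G A) : 2 ≤ (reducedSide G A B).encard := by
  by_contra hlt
  rw [not_two_le_encard] at hlt
  obtain ⟨a, haA, haB⟩ := h.1.2.1
  have ha : a ∈ reducedSide G A B := ⟨haA, fun h => absurd h haB⟩
  have hx : ∀ x ∈ A ∩ B, x ∉ reducedSide G A B := fun x hx h' => haB (hlt _ h' _ ha ▸ hx.2)
  have hnbr : ∀ x ∈ A ∩ B, ∀ b ∈ A, G.Adj x b → b = a := fun x hx b hb hxb =>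
    hlt _ (h.mem_reducedSide_of_adj hG hx.1 hx.2 hb hxb) _ ha
  have heq : A = insert a (A ∩ B) := by
    ext w
    constructor
    · intro hw
      by_cases hwB : w ∈ B
      · exact Or.inr ⟨hw, hwB⟩
      · exact Or.inl (hlt w ⟨hw, fun h => absurd h hwB⟩ a ha)
    · rintro (rfl | hw)
      · exact haA
      · exact hw.1
  refine hA ?_
  rw [heq]
  refine inducesClaw h.encard_inter (fun h' => haB h'.2) (fun x hx => ?_) fun x hx y hy hxy => ?_
  · obtain ⟨b, hbA, hbB, hxb⟩ := hG.exists_adj_left h.1 h.encard_sep hx.1 hx.2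
    exact (hnbr x hx b hbA hxb ▸ hxb).symm
  · exact haB (hnbr x hx y hy.1 hxy ▸ hy.2)

end IsThreeSeparation

lemma isWheel_of_iso_top (hG : IsKConnected 3 G) (e : G ≃g (⊤ : SimpleGraph (Fin 4))) :
    IsWheel G := by
  refine hG.isWheel_of_card_le_four (a := e.symm 0) (b := e.symm 1) (c := e.symm 2)
    (d := e.symm 3) fun w => ?_
  have : ∀ i : Fin 4, i = 0 ∨ i = 1 ∨ i = 2 ∨ i = 3 := by decide
  rcases this (e w) with h | h | h | h <;> simp [← h]

lemma isKThreeM_of_iso (e : G ≃g completeBipartiteGraph (Fin 3) (Fin 3)) : IsKThreeM G := by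
  refine ⟨ULift (Fin 3), by simp, ⟨e.trans ⟨(Equiv.refl _).sumCongr Equiv.ulift.symm, ?_⟩⟩⟩
  rintro (i | i) (j | j) <;> simp

theorem exists_isNontrivial (hG : IsKConnected 3 G) (hw : ¬ IsWheel G) (hk : ¬ IsKThreeM G)
    (hi : ¬ IsInternallyFourConnected G) :
    ∃ A B : Set V, IsTriSeparation G A B ∧ IsNontrivial G A B := by
  have : ∃ A B, IsThreeSeparation G A B ∧ ¬ InducesClaw G A ∧ ¬ InducesClaw G B := by
    by_contra hcon
    push Not at hcon
    refine hi ⟨hG, fun A B h => ?_, fun ⟨e⟩ => hw (isWheel_of_iso_top hG e),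
      fun ⟨e⟩ => hk (isKThreeM_of_iso e)⟩
    have := hcon A B h
    tauto
  obtain ⟨A, B, h, hA, hB⟩ := this
  have htri := h.isTriSeparation hG
  exact ⟨_, _, htri, htri.isNontrivial hG (h.two_le_encard_reducedSide hG hA)
    (h.symm.two_le_encard_reducedSide hG hB)⟩

/-! ### The three outcomes exclude each other. -/

lemma not_inducesClaw {A U : Set V} (hUA : U ⊆ A) (hne : U.Nonempty)
    (hU : ∀ u ∈ U, ∃ a ∈ U, ∃ b ∈ U, a ≠ b ∧ G.Adj u a ∧ G.Adj u b) : ¬ InducesClaw G A := by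
  rintro ⟨e⟩
  have hadj : ∀ a b (ha : a ∈ A) (hb : b ∈ A), G.Adj a b →
      (completeBipartiteGraph (Fin 1) (Fin 3)).Adj (e ⟨a, ha⟩) (e ⟨b, hb⟩) :=
    fun a b ha hb hab => e.map_adj_iff.2 hab
  -- A leaf of the claw has only one neighbour, so `U` could contain only the centre.
  have hleaf : ∀ u (hu : u ∈ U) i, e ⟨u, hUA hu⟩ ≠ Sum.inr i := by
    intro u hu i hi
    obtain ⟨a, ha, b, hb, hab, hua, hub⟩ := hU u hu
    have h1 := hadj u a (hUA hu) (hUA ha) hua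
    have h2 := hadj u b (hUA hu) (hUA hb) hub
    rw [hi] at h1 h2
    rcases hea : e ⟨a, hUA ha⟩ with j | j <;> rcases heb : e ⟨b, hUA hb⟩ with k | k <;>
      simp [hea, heb] at h1 h2
    have : e ⟨a, hUA ha⟩ = e ⟨b, hUA hb⟩ := by rw [hea, heb, Subsingleton.elim j k]
    exact hab (congrArg Subtype.val (e.injective this))
  obtain ⟨u, hu⟩ := hne
  obtain ⟨a, ha, -, -, -, hua, -⟩ := hU u hu
  have h1 := hadj u a (hUA hu) (hUA ha) hua
  rcases heu : e ⟨u, hUA hu⟩ with j | j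
  · rcases hea : e ⟨a, hUA ha⟩ with k | k
    · simp [heu, hea] at h1
    · exact hleaf a ha k hea
  · exact hleaf u hu j heu

lemma IsInternallyFourConnected.four_lt_card (h : IsInternallyFourConnected G) :
    4 < ENat.card V := by
  by_contra hlt
  rw [not_lt] at hlt
  have hG := h.1
  have hcard : ENat.card V = 4 := le_antisymm hlt (Order.add_one_le_of_lt hG.1)
  have hfin : Finite V := by
    rw [← ENat.card_lt_top, hcard]
    exact ENat.natCast_lt_top 4
  have hcard' : Nat.card V = 4 := by
    rw [ENat.card_eq_coe_natCard] at hcard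
    exact_mod_cast hcard
  have hadj : ∀ w, G.neighborSet w = {w}ᶜ := by
    intro w
    refine (Set.toFinite _).eq_of_subset_of_encard_le ?_ ?_
    · intro x hx
      exact fun e => G.irrefl (e ▸ hx : G.Adj w w)
    · refine le_trans ?_ (hG.three_le_degree w)
      have := Set.encard_add_encard_compl ({w} : Set V)
      rw [Set.encard_univ, hcard, Set.encard_singleton] at this
      have h4 : (4 : ℕ∞) = 1 + 3 := by norm_num
      rw [h4] at this
      exact (ENat.add_right_injective_of_ne_top (by simp) this).le
  refine h.2.2.1 ⟨⟨Finite.equivFinOfCardEq hcard', ?_⟩⟩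
  intro a b
  have : b ∈ G.neighborSet a ↔ b ∈ ({a}ᶜ : Set V) := by rw [hadj]
  simpa [eq_comm] using this.symm

/-- Enlarging the sides to those of a 3-separation preserves their cycles, and a claw has none. -/
theorem IsInternallyFourConnected.not_isNontrivial (h : IsInternallyFourConnected G) {A B : Set V}
    (hAB : IsTriSeparation G A B) : ¬ IsNontrivial G A B := by
  rintro ⟨hA, hB⟩
  obtain ⟨A', B', hAA, hBB, hmix, hE, ho⟩ := exists_vertex_separation (G := G) (n := 3)
    h.four_lt_card hAB.1 hAB.2.1.le
  obtain ⟨U, hUA, hne, hU⟩ := exists_core_of_not_isAcyclic hA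
  obtain ⟨U', hUB, hne', hU'⟩ := exists_core_of_not_isAcyclic hB
  rcases h.2.1 A' B' ⟨hmix, hE, le_antisymm ho (h.1.three_le_order hmix)⟩ with hc | hc
  · exact not_inducesClaw (hUA.trans hAA) hne hU hc
  · exact not_inducesClaw (hUB.trans hBB) hne' hU' hc

/-- Cutting around the vertex `b` of degree three gives a 3-separation with the triangle `xab` on
one side and `xcd` on the other. Long wheels contain this configuration. -/
lemma IsInternallyFourConnected.not_triangles (h : IsInternallyFourConnected G) {x a b c d : V}
    (hN : G.neighborSet b = {x, a, c}) (hxa : G.Adj x a) (hxc : G.Adj x c) (hxd : G.Adj x d)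
    (hcd : G.Adj c d) (hac : a ≠ c) (hda : d ≠ a) (hdb : d ≠ b) : False := by
  have hN' : ∀ w, G.Adj b w ↔ w = x ∨ w = a ∨ w = c := by
    intro w
    have : w ∈ G.neighborSet b ↔ w ∈ ({x, a, c} : Set V) := by rw [hN]
    simpa using this
  have hbx := (hN' x).2 (by simp)
  have hba := (hN' a).2 (by simp)
  have hbc := (hN' c).2 (by simp)
  have hinter : ({x, a, b, c} : Set V) ∩ {b}ᶜ = {x, a, c} := by
    ext w
    simp only [Set.mem_inter_iff, Set.mem_insert_iff, Set.mem_singleton_iff, Set.mem_compl_iff]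
    have := hbx.ne
    have := hba.ne
    have := hbc.ne
    grind
  have hmix : IsMixedSeparation ({x, a, b, c} : Set V) {b}ᶜ := by
    refine ⟨?_, ⟨b, by simp, by simp⟩, ⟨d, by simpa using hdb, ?_⟩⟩
    · ext w
      by_cases hw : w = b <;> simp [hw]
    · simp [hxd.ne', hda, hdb, hcd.ne']
  have hE : sepEdges G ({x, a, b, c} : Set V) {b}ᶜ = ∅ := by
    rw [Set.eq_empty_iff_forall_notMem]
    rintro e ⟨he, p, ⟨hp, hp'⟩, q, ⟨hq, hq'⟩, rfl⟩
    have hpb : p = b := by simpa using hp'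
    subst hpb
    have := (hN' q).1 he
    simp only [Set.mem_insert_iff, Set.mem_singleton_iff, not_or] at hq'
    tauto
  have hthree : IsThreeSeparation G ({x, a, b, c} : Set V) {b}ᶜ := by
    refine ⟨hmix, hE, ?_⟩
    rw [order, hE, Set.encard_empty, add_zero, hinter]
    exact Set.encard_eq_three.2 ⟨x, a, c, hxa.ne, hxc.ne, hac, rfl⟩
  have htri : ∀ {p q r : V}, G.Adj p q → G.Adj q r → G.Adj p r → ∀ u ∈ ({p, q, r} : Set V),
      ∃ a ∈ ({p, q, r} : Set V), ∃ b ∈ ({p, q, r} : Set V), a ≠ b ∧ G.Adj u a ∧ G.Adj u b := by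
    rintro p q r hpq hqr hpr u (rfl | rfl | rfl)
    · exact ⟨q, by simp, r, by simp, hqr.ne, hpq, hpr⟩
    · exact ⟨p, by simp, r, by simp, hpr.ne, hpq.symm, hqr⟩
    · exact ⟨p, by simp, q, by simp, hpq.ne, hpr.symm, hqr.symm⟩
  rcases h.2.1 _ _ hthree with hc | hc
  · refine not_inducesClaw (U := {x, a, b}) ?_ ⟨x, by simp⟩ (htri hxa hba.symm hbx.symm) hc
    rintro u (rfl | rfl | rfl) <;> simp
  · refine not_inducesClaw (U := {x, c, d}) ?_ ⟨x, by simp⟩ (htri hxc hcd hxd) hc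
    rintro u (rfl | rfl | rfl)
    · exact hbx.ne'
    · exact hbc.ne'
    · exact hdb

/-- A vertex of degree three is not in the separator of a totally-nested tri-separation. -/
lemma IsTotallyNested.notMem (hG : IsKConnected 3 G) {A B : Set V} (hAB : IsMixedSeparation A B)
    (h : IsTotallyNested G A B) {u : V} (hu : (G.neighborSet u).encard ≤ 3) (huA : u ∈ A) :
    u ∉ B := by
  intro huB
  have hmix : IsMixedSeparation ({u} : Set V) {u}ᶜ := by
    refine ⟨Set.union_compl_self _, ⟨u, rfl, fun h => h rfl⟩, ?_⟩
    obtain ⟨a, ha, -⟩ := three_le_encard_iff.1 (hG.three_le_degree u)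
    exact ⟨a, ha.ne', ha.ne'⟩
  have htri : IsTriSeparation G ({u} : Set V) {u}ᶜ := by
    refine ⟨hmix, le_antisymm ?_ (hG.three_le_order hmix), by simp⟩
    rw [order_eq_encard_sep]
    refine le_trans ?_ hu
    refine (Set.encard_le_encard (t := (fun b => Sum.inr s(u, b)) '' G.neighborSet u) ?_).trans
      (Set.encard_image_le _ _)
    rw [sep_subset_iff]
    refine ⟨fun w h1 h2 => absurd h1 h2, ?_⟩
    rintro a b hab rfl - - -
    exact ⟨b, hab, rfl⟩
  obtain ⟨a, haA, haB⟩ := hAB.2.1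
  obtain ⟨b, hbB, hbA⟩ := hAB.2.2
  rcases h _ _ htri with h' | h' | h' | h'
  · exact haB ((h'.1 haA : a = u) ▸ huB)
  · exact hbA ((h'.1 hbB : b = u) ▸ huA)
  · exact h'.1 huA rfl
  · exact h'.1 huB rfl

lemma IsKThreeM.exists_adj_iff (h : IsKThreeM G) : ∃ X : Set V, X.encard = 3 ∧ 3 ≤ Xᶜ.encard ∧
    ∀ a b, G.Adj a b ↔ ¬ (a ∈ X ↔ b ∈ X) := by
  obtain ⟨I, hI, ⟨e⟩⟩ := h
  have hr : ∀ w, w ∈ Set.range (fun i : Fin 3 => e.symm (Sum.inl i)) ↔ (e w).isLeft = true := by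
    intro w
    constructor
    · rintro ⟨i, rfl⟩
      simp
    · intro hw
      obtain ⟨i, hi⟩ := Sum.isLeft_iff.1 hw
      exact ⟨i, by simp [← hi]⟩
  refine ⟨Set.range fun i : Fin 3 => e.symm (Sum.inl i), ?_, ?_, fun a b => ?_⟩
  · rw [← Set.image_univ, Function.Injective.encard_image]
    · simp [Set.encard_univ]
    · exact fun i j hij => Sum.inl_injective (e.symm.injective hij)
  · refine hI.trans ?_
    rw [← Set.encard_univ, ← Function.Injective.encard_image (f := fun i => e.symm (Sum.inr i))
      (fun i j hij => Sum.inr_injective (e.symm.injective hij))]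
    refine Set.encard_le_encard ?_
    rintro _ ⟨i, -, rfl⟩
    rw [Set.mem_compl_iff, hr]
    simp
  · rw [hr, hr, ← e.map_adj_iff]
    rcases e a with i | i <;> rcases e b with j | j <;> simp

namespace IsKThreeM

variable {X : Set V} (hadj : ∀ a b, G.Adj a b ↔ ¬ (a ∈ X ↔ b ∈ X))
include hadj

lemma adj_of_mem {x y : V} (hx : x ∈ X) (hy : y ∉ X) : G.Adj x y := by
  rw [hadj]
  tauto

lemma isThreeSeparation (hX : X.encard = 3) {A B : Set V} (hA : (A \ X).Nonempty)
    (hB : (B \ X).Nonempty) (hAB : A ∩ B = X) (hun : A ∪ B = Set.univ) :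
    IsThreeSeparation G A B := by
  have hX' : ∀ w, w ∈ A ∧ w ∈ B ↔ w ∈ X := fun w => Set.ext_iff.1 hAB w
  have hE : sepEdges G A B = ∅ := by
    rw [Set.eq_empty_iff_forall_notMem]
    rintro e ⟨he, a, ha, b, hb, rfl⟩
    have h1 : ¬ (a ∈ X ↔ b ∈ X) := (hadj a b).1 he
    have := hX' a
    have := hX' b
    have h2 := ha.2
    have h3 := hb.2
    tauto
  refine ⟨⟨hun, ?_, ?_⟩, hE, ?_⟩
  · obtain ⟨a, ha, haX⟩ := hA
    exact ⟨a, ha, fun h => haX ((hX' a).1 ⟨ha, h⟩)⟩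
  · obtain ⟨a, ha, haX⟩ := hB
    exact ⟨a, ha, fun h => haX ((hX' a).1 ⟨h, ha⟩)⟩
  · rw [order, hE, Set.encard_empty, add_zero, hAB, hX]

lemma exists_two_adj (hX : X.encard = 3) {A : Set V} (hXA : X ⊆ A) {y z : V} (hy : y ∈ A)
    (hyX : y ∉ X) (hz : z ∈ A) (hzX : z ∉ X) (hyz : y ≠ z) :
    ∀ u ∈ A, ∃ a ∈ A, ∃ b ∈ A, a ≠ b ∧ G.Adj u a ∧ G.Adj u b := by
  intro u hu
  by_cases huX : u ∈ X
  · exact ⟨y, hy, z, hz, hyz, adj_of_mem hadj huX hyX, adj_of_mem hadj huX hzX⟩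
  · obtain ⟨a, ha, b, hb, -, -, hab, -⟩ := three_le_encard_iff.1 hX.ge
    exact ⟨a, hXA ha, b, hXA hb, hab, (adj_of_mem hadj ha huX).symm,
      (adj_of_mem hadj hb huX).symm⟩

/-- A subgraph with a cycle contains two vertices of the large class. -/
lemma exists_two_notMem {A : Set V} (hA : ¬ (G.induce A).IsAcyclic) :
    ∃ y ∈ A, ∃ z ∈ A, y ∉ X ∧ z ∉ X ∧ y ≠ z := by
  obtain ⟨U, hUA, ⟨u, hu⟩, hU⟩ := exists_core_of_not_isAcyclic hA
  have key : ∀ x ∈ U, x ∈ X → ∃ y ∈ A, ∃ z ∈ A, y ∉ X ∧ z ∉ X ∧ y ≠ z := by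
    intro x hx hxX
    obtain ⟨y, hy, z, hz, hyz, hxy, hxz⟩ := hU x hx
    rw [hadj] at hxy hxz
    exact ⟨y, hUA hy, z, hUA hz, by tauto, by tauto, hyz⟩
  by_cases huX : u ∈ X
  · exact key u hu huX
  · obtain ⟨x, hx, -, -, -, hux, -⟩ := hU u hu
    rw [hadj] at hux
    exact key x hx (by tauto)

end IsKThreeM

/-- If the large class has four vertices, splitting two of them from the rest along `X` leaves a
cycle on both sides. Otherwise the graph is the excluded `K_{3,3}`. -/
theorem IsKThreeM.not_isInternallyFourConnected (h : IsKThreeM G) :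
    ¬ IsInternallyFourConnected G := by
  intro hI
  obtain ⟨X, hX, hX', hadj⟩ := h.exists_adj_iff
  by_cases h4 : 4 ≤ Xᶜ.encard
  · obtain ⟨s, hs, hs4⟩ := Set.exists_subset_encard_eq h4
    obtain ⟨a, b, c, d, hab, hac, had, hbc, hbd, hcd, rfl⟩ := Set.encard_eq_four.1 hs4
    have haX : a ∉ X := hs (by simp)
    have hbX : b ∉ X := hs (by simp)
    have hcX : c ∉ X := hs (by simp)
    have hdX : d ∉ X := hs (by simp)
    have h3 : IsThreeSeparation G (X ∪ {a, b}) ({a, b}ᶜ) := by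
      refine IsKThreeM.isThreeSeparation hadj hX ⟨a, by simp, haX⟩
        ⟨c, by simp [hac.symm, hbc.symm], hcX⟩ ?_ ?_
      · ext w
        simp only [Set.mem_inter_iff, Set.mem_union, Set.mem_insert_iff, Set.mem_singleton_iff,
          Set.mem_compl_iff]
        grind
      · ext w
        simp only [Set.mem_union, Set.mem_compl_iff, Set.mem_univ, iff_true]
        tauto
    rcases hI.2.1 _ _ h3 with hc | hc
    · exact not_inducesClaw subset_rfl ⟨a, by simp⟩ (IsKThreeM.exists_two_adj hadj hX
        Set.subset_union_left (by simp) haX (by simp) hbX hab) hc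
    · refine not_inducesClaw subset_rfl ⟨c, by simp [hac.symm, hbc.symm]⟩
        (IsKThreeM.exists_two_adj hadj hX ?_ (by simp [hac.symm, hbc.symm]) hcX
        (by simp [had.symm, hbd.symm]) hdX hcd) hc
      rintro x hx (rfl | rfl)
      · exact haX hx
      · exact hbX hx
  · have hX3 : Xᶜ.encard = 3 := by
      refine le_antisymm ?_ hX'
      rw [not_le] at h4
      exact Order.le_of_lt_add_one h4
    classical
    obtain ⟨e₁⟩ := exists_equiv_fin_three hX
    obtain ⟨e₂⟩ := exists_equiv_fin_three hX3
    let e : Fin 3 ⊕ Fin 3 ≃ V := (e₁.sumCongr e₂).trans (Equiv.Set.sumCompl X)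
    have hl : ∀ i, e (Sum.inl i) ∈ X := fun i => by simp [e]
    have hr : ∀ i, e (Sum.inr i) ∉ X := fun i => (e₂ i).2
    refine hI.2.2.2 ⟨SimpleGraph.Iso.symm ⟨e, ?_⟩⟩
    rintro (i | i) (j | j) <;> simp [hadj, hl, hr]

/-- Vertices of the large class have degree three and so avoid the separator, and each strict side
contains two of them. The matching property then forces `X` into the separator. Regrouping one
vertex `a` of `A` with one vertex `b` of `B` gives a crossing tri-separation. -/
theorem IsKThreeM.not_hasTotallyNestedNontrivial (hG : IsKConnected 3 G) (h : IsKThreeM G) :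
    ¬ HasTotallyNestedNontrivial G := by
  rintro ⟨A, B, hAB, ⟨hA, hB⟩, hn⟩
  obtain ⟨X, hX, -, hadj⟩ := h.exists_adj_iff
  obtain ⟨a, haA, a', haA', haX, haX', haa⟩ := IsKThreeM.exists_two_notMem hadj hA
  obtain ⟨b, hbB, b', hbB', hbX, hbX', hbb⟩ := IsKThreeM.exists_two_notMem hadj hB
  have hdeg : ∀ y, y ∉ X → (G.neighborSet y).encard ≤ 3 := by
    intro y hy
    rw [← hX]
    refine Set.encard_le_encard fun x hx => ?_
    have : G.Adj y x := hx
    rw [hadj] at this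
    tauto
  have hS : ∀ y, y ∉ X → y ∈ A → y ∉ B := fun y hy hyA => hn.notMem hG hAB.1 (hdeg y hy) hyA
  have hbA : ∀ y, y ∉ X → y ∈ B → y ∉ A := fun y hy hyB hyA => hS y hy hyA hyB
  have key : ∀ {A B : Set V} {a b b' : V}, IsTriSeparation G A B → a ∈ A → a ∉ B → b ∉ A →
      b' ∉ A → b ∉ X → b' ∉ X → b ≠ b' → a ∉ X → ∀ x ∈ X, x ∈ B := by
    intro A B a b b' h haA haB hbA hbA' hbX hbX' hbb haX x hx
    by_contra hxB
    have hxA := (h.1.mem_or x).resolve_right hxB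
    exact hbb (hG.eq_of_adj_of_adj h.1 h.encard_sep hxA hxB haA haB (fun e => haX (e ▸ hx))
      hbA hbA' (IsKThreeM.adj_of_mem hadj hx hbX) (IsKThreeM.adj_of_mem hadj hx hbX'))
  have hXB : X ⊆ B := fun x hx => key hAB haA (hS a haX haA) (hbA b hbX hbB)
    (hbA b' hbX' hbB') hbX hbX' hbb haX x hx
  have hXA : X ⊆ A := fun x hx => key hAB.symm hbB (hbA b hbX hbB) (hS a haX haA)
    (hS a' haX' haA') haX haX' haa hbX x hx
  have haB := hS a haX haA
  have haB' := hS a' haX' haA'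
  have hbA1 := hbA b hbX hbB
  have hbA2 := hbA b' hbX' hbB'
  have hne : ∀ {p q : V}, p ∈ A → q ∉ A → p ≠ q := fun hp hq e => hq (e ▸ hp)
  have h3 : IsThreeSeparation G (X ∪ {a, b}) ({a, b}ᶜ) := by
    refine IsKThreeM.isThreeSeparation hadj hX ⟨a, by simp, haX⟩
      ⟨a', by simp [haa.symm, hne haA' hbA1], haX'⟩ ?_ ?_
    · ext w
      simp only [Set.mem_inter_iff, Set.mem_union, Set.mem_insert_iff, Set.mem_singleton_iff,
        Set.mem_compl_iff]
      grind
    · ext w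
      simp only [Set.mem_union, Set.mem_compl_iff, Set.mem_univ, iff_true]
      tauto
  have htri : IsTriSeparation G (X ∪ {a, b}) ({a, b}ᶜ) := by
    refine ⟨h3.1, h3.2.2, ?_⟩
    intro x hx
    have hxX : x ∈ X := by
      rcases hx.1 with h | h
      · exact h
      · exact absurd h hx.2
    rw [two_le_encard_iff, two_le_encard_iff]
    exact ⟨⟨a, ⟨IsKThreeM.adj_of_mem hadj hxX haX, by simp⟩, b,
      ⟨IsKThreeM.adj_of_mem hadj hxX hbX, by simp⟩, hne haA hbA1⟩,
      ⟨a', ⟨IsKThreeM.adj_of_mem hadj hxX haX', by simp [haa.symm, hne haA' hbA1]⟩, b',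
      ⟨IsKThreeM.adj_of_mem hadj hxX hbX', by simp [hbb.symm, (hne haA hbA2).symm]⟩,
      hne haA' hbA2⟩⟩
  rcases hn _ _ htri with h' | h' | h' | h'
  · have := h'.1 haA'
    simp [haX', haa.symm, hne haA' hbA1] at this
  · have := h'.1 hbB'
    simp [hbX', hbb.symm, (hne haA hbA2).symm] at this
  · exact h'.1 haA (by simp)
  · exact h'.1 hbB (by simp)

/-! ### Wheels and their rotations. -/

lemma IsTriSeparation.image (hG : IsKConnected 3 G) {A B : Set V} (h : IsTriSeparation G A B)
    (φ : G ≃g G) : IsTriSeparation G (φ '' A) (φ '' B) := by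
  have hmem : ∀ {S : Set V} {w}, φ w ∈ φ '' S ↔ w ∈ S := fun {S w} =>
    φ.injective.mem_set_image
  have hmix : IsMixedSeparation (φ '' A) (φ '' B) := by
    refine ⟨?_, ?_, ?_⟩
    · rw [← Set.image_union, h.1.1, Set.image_univ, φ.surjective.range_eq]
    · obtain ⟨w, hA, hB⟩ := h.1.2.1
      exact ⟨φ w, hmem.2 hA, fun h => hB (hmem.1 h)⟩
    · obtain ⟨w, hA, hB⟩ := h.1.2.2
      exact ⟨φ w, hmem.2 hA, fun h => hB (hmem.1 h)⟩
  refine ⟨hmix, le_antisymm ?_ (hG.three_le_order hmix), ?_⟩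
  · rw [order_eq_encard_sep, ← h.encard_sep]
    refine (Set.encard_le_encard (t := Sum.map φ (Sym2.map φ) '' sep G A B) ?_).trans
      (Set.encard_image_le _ _)
    rw [sep_subset_iff]
    constructor
    · rintro _ ⟨w, hA, rfl⟩ hB
      exact ⟨Sum.inl w, inl_mem_sep.2 ⟨hA, hmem.1 hB⟩, rfl⟩
    · rintro _ _ hab ⟨a, haA, rfl⟩ haB ⟨b, hbB, rfl⟩ hbA
      exact ⟨Sum.inr s(a, b), inr_mem_sep.2 ⟨φ.map_adj_iff.1 hab, Or.inl ⟨haA,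
        fun h => haB (hmem.2 h), hbB, fun h => hbA (hmem.2 h)⟩⟩, rfl⟩
  · rintro _ ⟨⟨w, hA, rfl⟩, hB⟩
    have key : ∀ S : Set V, 2 ≤ (G.neighborSet w ∩ S).encard →
        2 ≤ (G.neighborSet (φ w) ∩ φ '' S).encard := by
      intro S hS
      obtain ⟨a, ⟨hwa, ha⟩, b, ⟨hwb, hb⟩, hab⟩ := two_le_encard_iff.1 hS
      exact two_le_encard_iff.2 ⟨φ a, ⟨φ.map_adj_iff.2 hwa, hmem.2 ha⟩, φ b,
        ⟨φ.map_adj_iff.2 hwb, hmem.2 hb⟩, fun e => hab (φ.injective e)⟩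
    obtain ⟨h1, h2⟩ := h.2.2 w ⟨hA, hmem.1 hB⟩
    exact ⟨key A h1, key B h2⟩

/-- The rotation of a wheel. -/
def wheelGraph.rotation (m : ℕ) : wheelGraph (m + 3) ≃g wheelGraph (m + 3) where
  toEquiv := (Equiv.addRight (1 : Fin (m + 3))).sumCongr (Equiv.refl Unit)
  map_rel_iff' := by
    rintro (i | i) (j | j)
    · change (wheelGraph (m + 3)).Adj (Sum.inl (i + 1)) (Sum.inl (j + 1)) ↔ _
      rw [wheelGraph_adj_inl_inl, wheelGraph_adj_inl_inl, SimpleGraph.cycleGraph_adj (n := m + 1),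
        SimpleGraph.cycleGraph_adj (n := m + 1), add_sub_add_right_eq_sub,
        add_sub_add_right_eq_sub]
    · exact iff_of_true wheelGraph_adj_inl_inr wheelGraph_adj_inl_inr
    · exact iff_of_true wheelGraph_adj_inl_inr.symm wheelGraph_adj_inl_inr.symm
    · rfl

/-- A wheel with centre `x` and rim `r`, and a rotation `σ` of it. -/
structure IsWheelWith (G : SimpleGraph V) (m : ℕ) (x : V) (r : Fin (m + 3) → V) (σ : G ≃g G) :
    Prop where
  inj : Function.Injective r
  ne : ∀ i, r i ≠ x
  cover : ∀ w, w = x ∨ ∃ i, w = r i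
  spoke : ∀ i, G.Adj x (r i)
  rim : ∀ i j, G.Adj (r i) (r j) ↔ j = i - 1 ∨ j = i + 1
  rot : ∀ i, σ (r i) = r (i + 1)

lemma exists_isWheelWith {m : ℕ} (e : G ≃g wheelGraph (m + 3)) :
    ∃ x r σ, IsWheelWith G m x r σ := by
  refine ⟨e.symm (Sum.inr ()), fun i => e.symm (Sum.inl i),
    e.trans ((wheelGraph.rotation m).trans e.symm), ?_, ?_, ?_, ?_, ?_, ?_⟩
  · exact fun i j hij => Sum.inl_injective (e.symm.injective hij)
  · intro i hi
    cases e.symm.injective hi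
  · intro w
    rcases hw : e w with i | i
    · exact Or.inr ⟨i, by simp [← hw]⟩
    · exact Or.inl (by rw [show (Sum.inr () : Fin (m + 3) ⊕ Unit) = Sum.inr i from rfl, ← hw]; simp)
  · intro i
    exact e.symm.map_adj_iff.2 wheelGraph_adj_inl_inr.symm
  · intro i j
    rw [e.symm.map_adj_iff, wheelGraph_adj_inl_inl]
    change j ∈ (SimpleGraph.cycleGraph (m + 1 + 2)).neighborSet i ↔ _
    rw [SimpleGraph.cycleGraph_neighborSet]
    simp
  · intro i
    simp [wheelGraph.rotation]

namespace IsWheelWith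

variable {m : ℕ} {x : V} {r : Fin (m + 3) → V} {σ : G ≃g G} {A B : Set V}

lemma neighborSet_eq (h : IsWheelWith G m x r σ) (i : Fin (m + 3)) :
    G.neighborSet (r i) = {x, r (i - 1), r (i + 1)} := by
  ext w
  simp only [SimpleGraph.mem_neighborSet, Set.mem_insert_iff, Set.mem_singleton_iff]
  rcases h.cover w with rfl | ⟨j, rfl⟩
  · simp [(h.spoke i).symm]
  · simp [h.rim, h.ne, h.inj.eq_iff]

lemma encard_neighborSet_le (h : IsWheelWith G m x r σ) (i : Fin (m + 3)) :
    (G.neighborSet (r i)).encard ≤ 3 := by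
  rw [h.neighborSet_eq]
  calc _ ≤ _ := Set.encard_insert_le _ _
    _ ≤ 2 + 1 := by gcongr; exact encard_pair_le _ _
    _ = 3 := by norm_num

/-- If the centre were only in `A`, at least two spokes would run from it to rim vertices of `B \
A`, contradicting the matching property. -/
lemma centre_mem (hG : IsKConnected 3 G) (h : IsWheelWith G m x r σ) (hAB : IsTriSeparation G A B)
    (hA : ¬ (G.induce A).IsAcyclic) (hB : ¬ (G.induce B).IsAcyclic)
    (hS : ∀ i, r i ∈ A → r i ∉ B) : x ∈ B := by
  by_contra hxB
  have hxA := (hAB.1.mem_or x).resolve_right hxB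
  obtain ⟨U, hUA, ⟨u, hu⟩, hU⟩ := exists_core_of_not_isAcyclic hA
  obtain ⟨U', hUB, ⟨u', hu'⟩, hU'⟩ := exists_core_of_not_isAcyclic hB
  obtain ⟨a, ha, b, hb, hab, hua, hub⟩ := hU u hu
  obtain ⟨a', ha', b', hb', hab', -, -⟩ := hU' u' hu'
  have hex : ∃ w ∈ A, w ≠ x := by
    by_cases hax : a = x
    · exact ⟨b, hUA hb, fun e => hab (hax.trans e.symm)⟩
    · exact ⟨a, hUA ha, hax⟩
  obtain ⟨w, hwA, hwx⟩ := hex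
  obtain ⟨i, rfl⟩ := (h.cover w).resolve_left hwx
  have hrim : ∀ w ∈ B, w ∉ A ∧ G.Adj x w := by
    intro w hw
    obtain ⟨j, rfl⟩ := (h.cover w).resolve_left fun e => hxB (e ▸ hw)
    exact ⟨fun h' => hS j h' hw, h.spoke j⟩
  have h1 := hrim a' (hUB ha')
  have h2 := hrim b' (hUB hb')
  exact hab' (hG.eq_of_adj_of_adj hAB.1 hAB.encard_sep hxA hxB hwA (hS i hwA) hwx h1.1 h2.1
    h1.2 h2.2)

open scoped Fin.CommRing in
lemma forall_of_step {p : Fin (m + 3) → Prop} (hp : ∀ i, p i → p (i - 1)) {i : Fin (m + 3)}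
    (hi : p i) (j : Fin (m + 3)) : p j := by
  have key : ∀ k : ℕ, p (i - (k : Fin (m + 3))) := by
    intro k
    induction k with
    | zero => simpa using hi
    | succ k ih =>
      have := hp _ ih
      rwa [sub_sub, ← Nat.cast_one, ← Nat.cast_add] at this
  have := key (i - j).val
  rwa [Fin.cast_val_eq_self, sub_sub_cancel] at this

/-- The vertices of the rim in a side with a cycle are not independent. -/
lemma isAcyclic_of_independent (h : IsWheelWith G m x r σ)
    (hA : ∀ i, r i ∈ A → r (i - 1) ∉ A) : (G.induce A).IsAcyclic := by
  by_contra hcon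
  obtain ⟨U, hUA, ⟨u, hu⟩, hU⟩ := exists_core_of_not_isAcyclic hcon
  have hex : ∃ i, r i ∈ U := by
    obtain ⟨a, ha, b, hb, hab, -, -⟩ := hU u hu
    rcases h.cover a with rfl | ⟨i, rfl⟩
    · rcases h.cover b with rfl | ⟨i, rfl⟩
      · exact absurd rfl hab
      · exact ⟨i, hb⟩
    · exact ⟨i, ha⟩
  obtain ⟨i, hi⟩ := hex
  have hno : ∀ a ∈ U, G.Adj (r i) a → a = x := by
    intro a ha hia
    have ha' : a ∈ G.neighborSet (r i) := hia
    rw [h.neighborSet_eq] at ha'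
    rcases ha' with rfl | rfl | rfl
    · rfl
    · exact absurd (hUA ha) (hA i (hUA hi))
    · have := hA (i + 1) (hUA ha)
      rw [add_sub_cancel_right] at this
      exact absurd (hUA hi) this
  obtain ⟨a, ha, b, hb, hab, hia, hib⟩ := hU _ hi
  exact hab ((hno a ha hia).trans (hno b hb hib).symm)

/-- The separator contains the centre and no rim vertex, so the sides partition the rim. Being
nested with its rotation by one step would make one side contain the whole rim or have no two
consecutive rim vertices. -/
lemma not_isTotallyNested (hG : IsKConnected 3 G) (h : IsWheelWith G m x r σ)
    (hAB : IsTriSeparation G A B) (hnt : IsNontrivial G A B) : ¬ IsTotallyNested G A B := by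
  intro hn
  have hS : ∀ i, r i ∈ A → r i ∉ B := fun i hi =>
    hn.notMem hG hAB.1 (h.encard_neighborSet_le i) hi
  have hS' : ∀ i, r i ∈ B → r i ∉ A := fun i hi hi' => hS i hi' hi
  have hxB := h.centre_mem hG hAB hnt.1 hnt.2 hS
  have hxA := h.centre_mem hG hAB.symm hnt.2 hnt.1 hS'
  have hi : ∃ i, r i ∈ A := by
    obtain ⟨w, hwA, hwB⟩ := hAB.1.2.1
    obtain ⟨i, rfl⟩ := (h.cover w).resolve_left fun e => hwB (e ▸ hxB)
    exact ⟨i, hwA⟩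
  have hj : ∃ i, r i ∈ B := by
    obtain ⟨w, hwB, hwA⟩ := hAB.1.2.2
    obtain ⟨i, rfl⟩ := (h.cover w).resolve_left fun e => hwA (e ▸ hxA)
    exact ⟨i, hwB⟩
  obtain ⟨i, hi⟩ := hi
  obtain ⟨j, hj⟩ := hj
  have hmem : ∀ {S : Set V} {i}, r i ∈ σ '' S → r (i - 1) ∈ S := by
    rintro S i ⟨w, hw, hwi⟩
    have : σ (r (i - 1)) = r i := by rw [h.rot, sub_add_cancel]
    rwa [← σ.injective (hwi.trans this.symm)]
  rcases hn _ _ (hAB.image hG σ) with h' | h' | h' | h'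
  · exact hS j (forall_of_step (p := fun i => r i ∈ A) (fun i hi => hmem (h'.1 hi)) hi j) hj
  · exact hnt.2 (h.isAcyclic_of_independent fun i hi => hS _ (hmem (h'.1 hi)))
  · exact hnt.1 (h.isAcyclic_of_independent fun i hi => hS' _ (hmem (h'.1 hi)))
  · exact hS i hi (forall_of_step (p := fun i => r i ∈ B) (fun i hi => hmem (h'.1 hi)) hj i)

lemma not_isInternallyFourConnected {m : ℕ} {r : Fin (m + 1 + 3) → V}
    (h : IsWheelWith G (m + 1) x r σ) : ¬ IsInternallyFourConnected G := by
  intro hI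
  -- The rim vertices `0`, `1`, `2`, `3` are distinct because the rim has length at least four.
  have h1 : (1 : Fin (m + 1 + 3)) - 1 = 0 := sub_self _
  have h2 : (1 : Fin (m + 1 + 3)) + 1 = 2 := rfl
  have h3 : (2 : Fin (m + 1 + 3)) + 1 = 3 := rfl
  have hN := h.neighborSet_eq 1
  rw [h1, h2] at hN
  refine hI.not_triangles hN (h.spoke 0) (h.spoke 2) (h.spoke 3) ((h.rim 2 3).2 (Or.inr h3.symm))
    ?_ ?_ ?_
  · exact fun e => absurd (h.inj e) (ne_of_beq_false rfl)
  · exact fun e => absurd (h.inj e) (ne_of_beq_false rfl)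
  · exact fun e => absurd (h.inj e) (ne_of_beq_false rfl)

end IsWheelWith

theorem IsWheel.not_hasTotallyNestedNontrivial (hG : IsKConnected 3 G) (h : IsWheel G) :
    ¬ HasTotallyNestedNontrivial G := by
  obtain ⟨n, hn, ⟨e⟩⟩ := h
  obtain ⟨m, rfl⟩ := Nat.exists_eq_add_of_le' hn
  obtain ⟨x, r, σ, h⟩ := exists_isWheelWith e
  rintro ⟨A, B, hAB, hnt, hn⟩
  exact h.not_isTotallyNested hG hAB hnt hn

theorem IsWheel.not_isInternallyFourConnected (h : IsWheel G) :
    ¬ IsInternallyFourConnected G := by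
  obtain ⟨n, hn, ⟨e⟩⟩ := h
  obtain ⟨m, rfl⟩ := Nat.exists_eq_add_of_le' hn
  cases m with
  | zero =>
    -- The smallest wheel has only four vertices.
    intro hI
    have := hI.four_lt_card
    rw [ENat.card_congr e.toEquiv] at this
    simp at this
  | succ m =>
    obtain ⟨x, r, σ, h⟩ := exists_isWheelWith e
    exact h.not_isInternallyFourConnected

theorem exactlyOne (hG : IsKConnected 3 G) : ExactlyOne (HasTotallyNestedNontrivial G)
    (IsWheel G ∨ IsKThreeM G) (IsInternallyFourConnected G) := by
  have h12 : IsWheel G ∨ IsKThreeM G → ¬ HasTotallyNestedNontrivial G := fun h =>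
    h.elim (fun h => h.not_hasTotallyNestedNontrivial hG)
      fun h => h.not_hasTotallyNestedNontrivial hG
  have h23 : IsWheel G ∨ IsKThreeM G → ¬ IsInternallyFourConnected G := fun h =>
    h.elim (fun h => h.not_isInternallyFourConnected) fun h => h.not_isInternallyFourConnected
  have h13 : HasTotallyNestedNontrivial G → ¬ IsInternallyFourConnected G :=
    fun ⟨A, B, hAB, hnt, _⟩ h => h.not_isNontrivial hAB hnt
  have hex : HasTotallyNestedNontrivial G ∨ (IsWheel G ∨ IsKThreeM G) ∨
      IsInternallyFourConnected G := by
    by_contra hcon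
    simp only [not_or] at hcon
    obtain ⟨hno, ⟨hw, hk⟩, hi⟩ := hcon
    obtain ⟨X, K₁, K₂, K₃, K₄, hX, h1, h2, h3, h4, h5, h6, h7, h8, h9, h10⟩ :=
      exists_isPart hG hno hw (exists_isNontrivial hG hw hk hi)
    exact (hasTotallyNestedNontrivial_or_isKThreeM hG hX h1 h2 h3 h4 h5 h6 h7 h8 h9 h10).elim
      hno hk
  unfold ExactlyOne
  tauto

end TriSep

theorem mainTheorem3 {V : Type*} (G : SimpleGraph V) (hG : TriSep.IsKConnected 3 G) :
    TriSep.ExactlyOne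
      (TriSep.HasTotallyNestedNontrivial G)
      (TriSep.IsWheel G ∨ TriSep.IsKThreeM G)
      (TriSep.IsInternallyFourConnected G) := by
  exact TriSep.exactlyOne hG
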